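/- **Setting.** Let $n\ge 0$ and $\mathbf m=(m_1,\dots,m_n)$ with all $m_i\ge1$, $N=\sum_i m_i$, and let $I_{\mathbf m}$ be the set of $\mathbf k\in\mathbb Z^n$ with $-m_i\le k_i\le m_i$ and $k_i\equiv m_i \pmod 2$. A path is a lattice path from $(0,0)$ with $N$ steps $(1,\pm1)$, written as a word in $+,-$; $\alpha\le\beta$ means that $\alpha$ is (weakly) below $\beta$. For $\mathbf k\in I_{\mathbf m}$ let $\eta(\mathbf k)$ (resp. $\zeta(\mathbf k)$) be the concatenation over $i=1,\dots,n$ of the words $-^{(m_i+k_i)/2}\,+^{(m_i-k_i)/2}$ (resp. $+^{(m_i-k_i)/2}\,-^{(m_i+k_i)/2}$). For paths $\alpha\le\gamma$ let $\mathrm{Adm}(\alpha,\gamma)$ be the set of paths $\beta=\eta(\mathbf k'')$ with $\mathbf k''\in I_{\mathbf m}$ and $\alpha\le\beta\le\gamma$. **Ballot strips.** For a path $\alpha$ let $\lambda(\alpha)$ be the set of squares (rotated by 45 degrees, of side $\sqrt2$) with centres $(i,j)$ above $\alpha$ such that $0<i\le N$, $|j|<i$ and $i+j-1$ is even. For $\alpha\le\beta$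 put $\mu=\lambda(\alpha)\setminus\lambda(\beta)$. A ballot strip of length $(l,l')$, $l,l'\ge0$, is the set of squares centred at the vertices of a path with steps $(1,\pm1)$ from some $(x,y)$ to $(x+2l+l',y+l')$ that never goes below height $y$; if $l'\ge1$, its rightmost square is required to be an anchor square, i.e. to have a centre $(N,j)$ with $|j|<N$ and $N-j-1$ even. Let $\mathrm{Conf}(\alpha,\beta)$ be the set of partitions of $\mu$ into ballot strips. "Just below", "just above", "NW", "NE" of the square $(i,j)$ mean the squares $(i,j-2)$, $(i,j+2)$, $(i-1,j+1)$, $(i+1,j+1)$. *Rule I* for a configuration $\mathcal C\in \mathrm{Conf}(\alpha,\beta)$: (a) for $\mathcal D,\mathcal D'\in\mathcal C$, if some square of $\mathcal D$ is just below a square of $\mathcal D'$, then all squares just below squares of $\mathcal D'$ belong to $\mathcal D$; (b) for all $l$ and all $l'\ge1$, the number of strips of length $(l,l')$ in $\mathcal C$ is even if $l'$ is odd and zero if $l'$ is even. The weight $\mathrm{wt}^I$ of a strip of length $(l,l')$ is $t^{-1}$ if $l'$ is even and $1$ if $l'$ is odd. *Rule II.* For $\alpha=\eta(\mathbf k)\le\beta$,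 $\mathbf k\in I_{\mathbf m}$, a projection domain for $(\alpha,\beta)$ is a (possibly empty) set $P=(\lambda(\alpha)\setminus\lambda(\delta))\cap\mu$ with a path $\delta$ satisfying $\eta(\mathbf k)\le\delta\le\zeta(\mathbf k)$. A pair $(P,\mathcal C)$ with $\mathcal C\in\mathrm{Conf}(\alpha,\beta)$ satisfies Rule II if: (a) for distinct $\mathcal D,\mathcal D'\in\mathcal C$, if some square of $\mathcal D'$ is just above, NW or NE of a square of $\mathcal D$, then all squares $(i,j)$ with $i\le N$ (whether or not they lie in $\mu$) that are just above, NW or NE of a square of $\mathcal D$ not in $P$ belong to $\mathcal D\cup\mathcal D'$; (b) for $l'\ge1$, if $\mathcal D\in\mathcal C$ has length $(l,l')$ with $l'$ odd (resp. even), then there is a strip in $\mathcal C$ of length $(l'',l'+1)$ with $l''\ge l$ (resp. $(l'',l'-1)$ with $l''\le l$) containing a square just above (resp. just below) a square of $\mathcal D$; (c) no strip of length $(l,l')$ with $l+l'\ge1$ meets $P$; (d) every square of $P$ is by itself a strip of $\mathcal C$. The weight $\mathrm{wt}^{II}_P$ is $t^{-1}$ for a unit square in $P$; for any other strip, of length $(l,l')$,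 it is $-t^{-1}$ if $l'$ is even and $1$ if $l'$ is odd. Let $Q^{I,-}_{\alpha,\alpha}=Q^{II,-}_{\alpha,\alpha}=1$ and, for $\alpha\le\beta$, $\alpha\ne\beta$ (with $\alpha=\eta(\mathbf k)$ for some $\mathbf k\in I_{\mathbf m}$ in the case of $Q^{II,-}$), define in $\mathbb Z[t,t^{-1}]$ $$Q^{I,-}_{\alpha,\beta}(t^{-1})=\sum_{\mathcal C}\prod_{\mathcal D\in\mathcal C}\mathrm{wt}^I(\mathcal D),\qquad Q^{II,-}_{\alpha,\beta}(t^{-1})=\sum_{(P,\mathcal C)}\prod_{\mathcal D\in\mathcal C}\mathrm{wt}^{II}_P(\mathcal D),$$ where the first sum is over the $\mathcal C\in\mathrm{Conf}(\alpha,\beta)$ satisfying Rule I and the second over the pairs $(P,\mathcal C)$ satisfying Rule II. **Theorem.** Let $\alpha=\eta(\mathbf k)$ and $\gamma=\eta(\mathbf k')$ with $\mathbf k,\mathbf k'\in I_{\mathbf m}$. If $\alpha\le\gamma$, then $$\sum_{\beta\in\mathrm{Adm}(\alpha,\gamma)}Q^{I,-}_{\alpha,\beta}(t^{-1})\,Q^{II,-}_{\beta,\gamma}(t^{-1})=\delta_{\alpha,\gamma}.$$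 (If $\alpha\not\le\gamma$, the set $\mathrm{Adm}(\alpha,\gamma)$ of paths $\beta$ with $\alpha\le\beta\le\gamma$ is empty and both sides are $0$.) -/

import Mathlib

namespace BallotStrip

/-- A lattice path starting at `(0, 0)`, as the list of its steps: `true` is the step `(1, 1)`
(written `+`) and `false` is the step `(1, -1)` (written `-`). -/
abbrev Path := List Bool

/-- The unit square (rotated by 45 degrees) with centre `(i, j)` is represented by its centre. -/
abbrev Square := ℤ × ℤ

/-- The ordinate of a path after its first `i` steps. -/
def height (α : Path) (i : ℕ) : ℤ :=
  ((α.take i).map fun b => if b then (1 : ℤ) else -1).sum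

/-- `α` is (weakly) below `β`, the two paths having the same number of steps. -/
def Below (α β : Path) : Prop :=
  α.length = β.length ∧ ∀ i ≤ α.length, height α i ≤ height β i

/-- The shifted Ferrers diagram `λ(α)`: the squares with centre `(i, j)` above the path `α` with
`0 < i ≤ N`, `|j| < i` and `i + j - 1` even, where `N` is the number of steps of `α`. -/
noncomputable def diagram (α : Path) : Finset Square :=
  (Finset.Icc (1 : ℤ) α.length ×ˢ Finset.Icc (-(α.length : ℤ)) α.length).filter fun s =>
    |s.2| < s.1 ∧ Even (s.1 + s.2 - 1) ∧ height α s.1.toNat < s.2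

/-- The shifted skew Ferrers diagram `λ(α)/λ(β)`. -/
noncomputable def skew (α β : Path) : Finset Square := diagram α \ diagram β

/-- The index set `I_m`: the integer vectors `k` with `-m_i ≤ k_i ≤ m_i` and
`k_i ≡ m_i (mod 2)`. -/
noncomputable def weights {n : ℕ} (m : Fin n → ℕ) : Finset (Fin n → ℤ) :=
  Fintype.piFinset fun i =>
    (Finset.Icc (-(m i : ℤ)) (m i)).filter fun k => k ≡ m i [ZMOD 2]

/-- The path `η(k)`: the concatenation of the blocks consisting of `(m_i + k_i) / 2` steps `-`
followed by `(m_i - k_i) / 2` steps `+`. -/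
def eta {n : ℕ} (m : Fin n → ℕ) (k : Fin n → ℤ) : Path :=
  (List.ofFn fun i =>
    List.replicate ((m i + k i) / 2).toNat false ++
      List.replicate ((m i - k i) / 2).toNat true).flatten

/-- The path `ζ(k)`: the concatenation of the blocks consisting of `(m_i - k_i) / 2` steps `+`
followed by `(m_i + k_i) / 2` steps `-`. -/
def zeta {n : ℕ} (m : Fin n → ℕ) (k : Fin n → ℤ) : Path :=
  (List.ofFn fun i =>
    List.replicate ((m i - k i) / 2).toNat true ++
      List.replicate ((m i + k i) / 2).toNat false).flatten

open Classical in
/-- The admissible paths between `α` and `γ`: those of the form `η(k)`, `k ∈ I_m`, which are above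
`α` and below `γ`. -/
noncomputable def Adm {n : ℕ} (m : Fin n → ℕ) (α γ : Path) : Finset Path :=
  ((weights m).image (eta m)).filter fun β => Below α β ∧ Below β γ

/-- `D` is a ballot strip of length `(l, l')`: it consists of the squares whose centres are the
vertices of a ballot path of length `(l, l')`, that is, of a path with steps `(1, ±1)` from some
point `(x, y)` to `(x + 2 l + l', y + l')` which never goes below the ordinate `y`. -/
def HasLength (D : Finset Square) (l l' : ℕ) : Prop :=
  ∃ (x : ℤ) (h : ℕ → ℤ),
    (∀ i < 2 * l + l', h (i + 1) = h i + 1 ∨ h (i + 1) = h i - 1) ∧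
    (∀ i ≤ 2 * l + l', h 0 ≤ h i) ∧
    h (2 * l + l') = h 0 + l' ∧
    D = (Finset.range (2 * l + l' + 1)).image fun i : ℕ => (x + (i : ℤ), h i)

/-- The anchor squares, where `N` is the number of steps of the paths. -/
def IsAnchor (N : ℕ) (s : Square) : Prop :=
  s.1 = N ∧ |s.2| < N ∧ Even ((N : ℤ) - s.2 - 1)

/-- The ballot strips which may be put in a diagram: the rightmost square of a strip of length
`(l, l')` with `l' ≥ 1` is an anchor square. -/
def IsStrip (N : ℕ) (D : Finset Square) : Prop :=
  ∃ l l' : ℕ, HasLength D l l' ∧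
    (1 ≤ l' → ∃ s ∈ D, IsAnchor N s ∧ ∀ s' ∈ D, s'.1 ≤ s.1)

open Classical in
/-- `Conf(α, β)`: the configurations of ballot strips filling `λ(α)/λ(β)`, i.e. the sets of
pairwise disjoint ballot strips with union `λ(α)/λ(β)`. -/
noncomputable def Conf (α β : Path) : Finset (Finset (Finset Square)) :=
  (skew α β).powerset.powerset.filter fun C =>
    (∀ D ∈ C, IsStrip α.length D) ∧
    (∀ D ∈ C, ∀ D' ∈ C, D ≠ D' → Disjoint D D') ∧
    C.biUnion id = skew α β

/-- The square just above `s`. -/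
def up (s : Square) : Square := (s.1, s.2 + 2)

/-- The square just below `s`. -/
def down (s : Square) : Square := (s.1, s.2 - 2)

/-- The squares just above, NW and NE of `s`. -/
def uppers (s : Square) : Finset Square :=
  {up s, (s.1 - 1, s.2 + 1), (s.1 + 1, s.2 + 1)}

open Classical in
/-- Rule I. Here there are no projection domains.
(a) If some square of `D` is just below a square of `D'`, then all squares just below a square of
`D'` belong to `D`.
(b) For `l' ≥ 1`, the number of strips of length `(l, l')` is even if `l'` is odd and zero if `l'`
is even. -/
def RuleI (C : Finset (Finset Square)) : Prop :=
  (∀ D ∈ C, ∀ D' ∈ C, (∃ s ∈ D', down s ∈ D) → ∀ s ∈ D', down s ∈ D) ∧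
  (∀ l l' : ℕ, 1 ≤ l' →
    (Odd l' → Even (C.filter fun D => HasLength D l l').card) ∧
    (Even l' → (C.filter fun D => HasLength D l l').card = 0))

/-- Rule II for configurations with projection domain `P`, in diagrams of paths with `N` steps.
(a) If some square of `D' ≠ D` is just above, NW or NE of a square of `D`, then all squares just
above, NW and NE of a square of `D` belong to `D` or `D'`, except in the projection domain. The
diagrams end at the vertical line of the anchor squares, so there are no squares to the right of
it; squares which are not in the skew diagram do count.
(b) For `l' ≥ 1`: if `D` has length `(l, l')` with `l'` odd, there is a strip of length
`(l'', l' + 1)` with `l'' ≥ l` just above `D`; if `l'` is even, there is a strip of length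
`(l'', l' - 1)` with `l'' ≤ l` just below `D`.
(c) A strip of length `(l, l')` with `l + l' ≥ 1` has no squares in the projection domain.
(d) The projection domain is filled with unit squares. -/
def RuleII (N : ℕ) (P : Finset Square) (C : Finset (Finset Square)) : Prop :=
  (∀ D ∈ C, ∀ D' ∈ C, D ≠ D' → (∃ s ∈ D, ∃ u ∈ uppers s, u ∈ D') →
    ∀ s ∈ D, s ∉ P → ∀ u ∈ uppers s, u.1 ≤ N → u ∈ D ∨ u ∈ D') ∧
  (∀ D ∈ C, ∀ l l' : ℕ, 1 ≤ l' → HasLength D l l' →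
    (Odd l' → ∃ D' ∈ C, ∃ l'' ≥ l, HasLength D' l'' (l' + 1) ∧ ∃ s ∈ D, up s ∈ D') ∧
    (Even l' → ∃ D' ∈ C, ∃ l'' ≤ l, HasLength D' l'' (l' - 1) ∧ ∃ s ∈ D, down s ∈ D')) ∧
  (∀ D ∈ C, ∀ l l' : ℕ, 1 ≤ l + l' → HasLength D l l' → Disjoint D P) ∧
  (∀ s ∈ P, {s} ∈ C)

open Classical in
/-- The projection domains for `(α, β)`, where `α = η(k)`: the sets `(λ(α)/λ(γ)) ∩ (λ(α)/λ(β))`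
with `γ` a path between `α = η(k)` and `ζ(k)`. The empty set (`γ = α`) is the case of no
projection domain. -/
noncomputable def pDomains {n : ℕ} (m : Fin n → ℕ) (α β : Path) : Finset (Finset Square) :=
  (skew α β).powerset.filter fun P =>
    ∃ k ∈ weights m, α = eta m k ∧
      ∃ γ : Path, Below α γ ∧ Below γ (zeta m k) ∧ P = skew α γ ∩ skew α β

open LaurentPolynomial in
open Classical in
/-- The weight of a strip in Rule I, a Laurent polynomial in the indeterminate `t = T 1`. -/
noncomputable def wtI (D : Finset Square) : LaurentPolynomial ℤ :=
  if ∃ l l' : ℕ, HasLength D l l' ∧ Even l' then T (-1) else 1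

open LaurentPolynomial in
open Classical in
/-- The weight of a strip in Rule II, for the projection domain `P`. -/
noncomputable def wtII (P D : Finset Square) : LaurentPolynomial ℤ :=
  if ∃ s ∈ P, D = {s} then T (-1)
  else if ∃ l l' : ℕ, HasLength D l l' ∧ Even l' then -T (-1) else 1

open Classical in
/-- The generating function `Q^{I,-}_{α,β}(t⁻¹)`, for `α` below `β`. -/
noncomputable def QI (α β : Path) : LaurentPolynomial ℤ :=
  if α = β then 1
  else ∑ C ∈ (Conf α β).filter RuleI, ∏ D ∈ C, wtI D

open Classical in
/-- The generating function `Q^{II,-}_{α,β}(t⁻¹)`, for `α` below `β`, both of the form `η(k)` with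
`k ∈ I_m`. A configuration for Rule II comes with a choice of its projection domain. -/
noncomputable def QII {n : ℕ} (m : Fin n → ℕ) (α β : Path) : LaurentPolynomial ℤ :=
  if α = β then 1
  else ∑ P ∈ pDomains m α β, ∑ C ∈ (Conf α β).filter (RuleII α.length P), ∏ D ∈ C, wtII P D

end BallotStrip

/-! ### Paths as height functions, and the squares between two paths. -/

namespace BallotStrip

/-! The sum over admissible `β` is unfolded into a sum over all paths `δ` between `α` and `γ`, where
projection domains disappear. A Rule II configuration whose projection domain is P = λ(β)\λ(δ)
consists of unit squares on P and of a configuration for `(δ, γ)` without projection domain. Hence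
the Rule II factor is the sum of t^{-|P|} `SII δ γ` over the `δ` between `β` and `γ` that agree with
`β` at the block ends (`QII_eq`). On the Rule I side, a path η(k) has no peak inside a block. If `δ`
is above `β`, agrees with it at the block ends and differs from it, then `δ` has a peak above `β`
inside a block; `α` has none there, and Rule I forces the square under that peak to be a strip by
itself. Removing such squares one by one gives `SI α δ` = t^{-|P|} `SI α β` (`SI_eq_pow_mul`). Each
`δ` belongs to exactly one `β`, so it remains to invert `SI` by `SII` over all paths
(`sum_SI_mul_SII`).

Rule II is rigid. Match the `+` and `-` steps of `γ` like parentheses. Every strip is parallel to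
`γ`, begins at a `+` step of `γ` where `δ` has a `-` step, and runs until just before the matching
`-` step or to the last column. So there is at most one configuration, and `δ` arises from `γ` by
flipping a set X of `+` steps together with their matches (`eq_confOf`, `H_eq_flipH`). Condition (b)
makes X a union of groups: a matched `+` step, the last unmatched one, or a pair of consecutive
unmatched ones, the first having even `lp` ≥ 2. Each group contributes -t^{-1} (`prod_grp`).

In Rule I the same groups appear as removable pieces at the upper rim, of total weight t^{-1}: one
strip for a single step; for a pair, one strip from the first step to just before the second, and
two equal strips with odd l', one on top of the other, from the second step to the last column. On
the pairs (X, C), with C a Rule I configuration below the flipped path, take the last group that is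
flipped or removable. Either unflip it and add its strips, or remove its strips and flip it. The
weight changes sign (`sum_states`). Rule I is preserved because strips follow the upper path below
ballot stretches without removable groups (`flat_of`). The last group stays last
(`Toggle.rem_union`, `Toggle.rem_sdiff`), and one exists whenever `α ≠ γ` (`exists_rem`). -/

/-- The ordinate of a path above an integer abscissa. -/
def H (α : Path) (v : ℤ) : ℤ := height α v.toNat

lemma H_zero (α : Path) : H α 0 = 0 := by simp [H, height]

lemma height_succ (α : Path) (i : ℕ) (hi : i < α.length) :
    height α (i + 1) = height α i + if α[i] then 1 else -1 := by
  unfold height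
  rw [List.take_succ_eq_append_getElem hi, List.map_append, List.sum_append]
  simp only [List.map_cons, List.map_nil, List.sum_cons, List.sum_nil, add_zero]

lemma H_step (α : Path) {v : ℤ} (h0 : 0 ≤ v) (h1 : v < α.length) :
    H α (v + 1) = H α v + 1 ∨ H α (v + 1) = H α v - 1 := by
  obtain ⟨i, rfl⟩ := Int.eq_ofNat_of_zero_le h0
  have hi : i < α.length := by exact_mod_cast h1
  have := height_succ α i hi
  have e : ((i : ℤ) + 1).toNat = i + 1 := by omega
  unfold H
  rw [e, Int.toNat_natCast, this]
  split_ifs <;> simp [sub_eq_add_neg]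

/-- `c` is the number of `-` steps among the first `v`; this packs together the parity of the height
and the bounds `-v` and `v`. -/
lemma H_parity (α : Path) {v : ℤ} (h0 : 0 ≤ v) (h1 : v ≤ α.length) :
    ∃ c, 0 ≤ c ∧ c ≤ v ∧ H α v = v - 2 * c := by
  obtain ⟨i, rfl⟩ := Int.eq_ofNat_of_zero_le h0
  induction i with
  | zero => exact ⟨0, by simp [H_zero]⟩
  | succ i ih =>
    obtain ⟨c, hc0, hc1, hc⟩ := ih (by omega) (by push_cast at h1; omega)
    have := H_step α (v := i) (by omega) (by push_cast at h1; omega)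
    push_cast
    rcases this with h | h
    · exact ⟨c, by omega, by omega, by omega⟩
    · exact ⟨c + 1, by omega, by omega, by omega⟩

lemma path_ext {α β : Path} (hl : α.length = β.length)
    (h : ∀ v : ℤ, 0 ≤ v → v ≤ α.length → H α v = H β v) : α = β := by
  apply List.ext_getElem hl
  intro i h1 h2
  have e1 := h i (by omega) (by omega)
  have e2 := h (i + 1 : ℕ) (by omega) (by omega)
  simp only [H, Int.toNat_natCast] at e1 e2
  rw [height_succ α i h1, height_succ β i h2, e1] at e2
  have e3 := add_left_cancel e2
  cases ha : α[i] <;> cases hb : β[i] <;> simp_all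

lemma exists_path (N : ℕ) (f : ℤ → ℤ) (h0 : f 0 = 0)
    (hs : ∀ v : ℤ, 0 ≤ v → v < N → f (v + 1) = f v + 1 ∨ f (v + 1) = f v - 1) :
    ∃ δ : Path, δ.length = N ∧ ∀ v : ℤ, 0 ≤ v → v ≤ N → H δ v = f v := by
  refine ⟨List.ofFn fun i : Fin N => decide (f ((i : ℕ) + 1) = f (i : ℕ) + 1), by simp, ?_⟩
  intro v hv hv'
  obtain ⟨i, rfl⟩ := Int.eq_ofNat_of_zero_le hv
  induction i with
  | zero => simp [H_zero, h0]
  | succ i ih =>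
    have ih := ih (by omega) (by omega)
    have hi : i < N := by omega
    simp only [H, Int.toNat_natCast] at ih ⊢
    rw [height_succ _ i (by simpa using hi), ih]
    have := hs i (by omega) (by omega)
    push_cast
    rcases this with h | h
    · simp [h]
    · simp [h]; omega

lemma below_iff {α β : Path} :
    Below α β ↔ α.length = β.length ∧ ∀ v : ℤ, 0 ≤ v → v ≤ α.length → H α v ≤ H β v := by
  unfold Below
  refine and_congr_right fun _ => ⟨fun h v h0 h1 => h _ (by omega), fun h i hi => ?_⟩
  simpa [H] using h i (by omega) (by omega)

lemma Below.le {α β : Path} (h : Below α β) {v : ℤ} (h0 : 0 ≤ v) (h1 : v ≤ α.length) :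
    H α v ≤ H β v := (below_iff.1 h).2 v h0 h1

lemma Below.refl (α : Path) : Below α α := ⟨rfl, fun _ _ => le_rfl⟩

lemma Below.trans {α β γ : Path} (h : Below α β) (h' : Below β γ) : Below α γ :=
  ⟨h.1.trans h'.1, fun i hi => (h.2 i hi).trans (h'.2 i (h.1 ▸ hi))⟩

lemma Below.antisymm {α β : Path} (h : Below α β) (h' : Below β α) : α = β :=
  path_ext h.1 fun _ h0 h1 => le_antisymm (h.le h0 h1) (h'.le h0 (h.1 ▸ h1))

lemma mem_diagram {α : Path} {s : Square} :
    s ∈ diagram α ↔ 1 ≤ s.1 ∧ s.1 ≤ α.length ∧ |s.2| < s.1 ∧ (s.1 + s.2) % 2 = 1 ∧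
      H α s.1 < s.2 := by
  unfold diagram H
  simp only [Finset.mem_filter, Finset.mem_product, Finset.mem_Icc, abs_lt, Int.even_iff]
  constructor
  · rintro ⟨⟨⟨h1, h2⟩, h3, h4⟩, ⟨h5, h6⟩, h7, h8⟩
    exact ⟨h1, h2, ⟨h5, h6⟩, by omega, h8⟩
  · rintro ⟨h1, h2, ⟨h5, h6⟩, h7, h8⟩
    exact ⟨⟨⟨h1, h2⟩, by omega, by omega⟩, ⟨h5, h6⟩, by omega, h8⟩

/-- The condition `|j| < i` drops out because the heights in column `i` lie between `-i` and `i`. A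
square has the opposite parity to both paths, so not being above `β` means being strictly below it.
-/
lemma mem_skew {α β : Path} (h : α.length = β.length) {s : Square} :
    s ∈ skew α β ↔ 1 ≤ s.1 ∧ s.1 ≤ α.length ∧ (s.1 + s.2) % 2 = 1 ∧
      H α s.1 < s.2 ∧ s.2 < H β s.1 := by
  unfold skew
  rw [Finset.mem_sdiff, mem_diagram, mem_diagram, ← h]
  constructor
  · rintro ⟨⟨h1, h2, h3, h4, h5⟩, h6⟩
    obtain ⟨c, hc0, hc1, hc⟩ := H_parity β (v := s.1) (by omega) (by omega)
    have : ¬ H β s.1 < s.2 := fun h7 => h6 ⟨h1, h2, h3, h4, h7⟩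
    exact ⟨h1, h2, h4, h5, by omega⟩
  · rintro ⟨h1, h2, h4, h5, h6⟩
    obtain ⟨c, hc0, hc1, hc⟩ := H_parity β (v := s.1) (by omega) (by omega)
    obtain ⟨d, hd0, hd1, hd⟩ := H_parity α (v := s.1) (by omega) (by omega)
    refine ⟨⟨h1, h2, ?_, h4, h5⟩, fun h7 => by omega⟩
    rw [abs_lt]; constructor <;> omega

lemma skew_self (α : Path) : skew α α = ∅ := by simp [skew]

lemma eq_of_skew_eq {α β β' : Path} (h : Below α β) (h' : Below α β')
    (e : skew α β = skew α β') : β = β' := by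
  have key : ∀ {β β' : Path}, Below α β → Below α β' → skew α β = skew α β' →
      ∀ v : ℤ, 0 ≤ v → v ≤ α.length → H β v ≤ H β' v := by
    intro β β' h h' e v h0 h1
    by_contra hc
    have ha := h.le h0 h1
    have ha' := h'.le h0 h1
    have hv : 1 ≤ v := by
      rcases h0.lt_or_eq with h2 | rfl
      · omega
      · simp [H_zero] at hc
    obtain ⟨c, hc0, hc1, hc2⟩ := H_parity β (v := v) h0 (h.1 ▸ h1)
    obtain ⟨d, hd0, hd1, hd2⟩ := H_parity β' (v := v) h0 (h'.1 ▸ h1)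
    have m : ((v, H β v - 1) : Square) ∈ skew α β := by
      rw [mem_skew h.1]; refine ⟨hv, h1, ?_, ?_, ?_⟩ <;> dsimp only <;> omega
    rw [e, mem_skew h'.1] at m
    have := m.2.2.2.2
    dsimp only at this
    omega
  refine path_ext (h.1.symm.trans h'.1) fun v h0 h1 => ?_
  rw [← h.1] at h1
  exact le_antisymm (key h h' e v h0 h1) (key h' h e.symm v h0 h1)

end BallotStrip

/-! ### Ballot strips and configurations. -/

namespace BallotStrip

/-- The set `D` consists of the vertices `(v, h v)`, `a ≤ v ≤ b`, of a ballot path. -/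
structure Ballot (D : Finset Square) (a b : ℤ) (h : ℤ → ℤ) : Prop where
  le : a ≤ b
  step : ∀ v, a ≤ v → v < b → h (v + 1) = h v + 1 ∨ h (v + 1) = h v - 1
  low : ∀ v, a ≤ v → v ≤ b → h a ≤ h v
  mem : ∀ s : Square, s ∈ D ↔ a ≤ s.1 ∧ s.1 ≤ b ∧ s.2 = h s.1

namespace Ballot

variable {D : Finset Square} {a b a' b' : ℤ} {h h' : ℤ → ℤ}

lemma mem_of (H : Ballot D a b h) {v : ℤ} (h0 : a ≤ v) (h1 : v ≤ b) : ((v, h v) : Square) ∈ D :=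
  (H.mem _).2 ⟨h0, h1, rfl⟩

lemma parity (H : Ballot D a b h) {v : ℤ} (h0 : a ≤ v) (h1 : v ≤ b) :
    ∃ c, 0 ≤ c ∧ h v = h a + (v - a) - 2 * c := by
  obtain ⟨i, hi⟩ := Int.le.dest h0
  induction i generalizing v with
  | zero => exact ⟨0, le_rfl, by simp at hi; subst hi; ring⟩
  | succ i ih =>
    push_cast at hi
    obtain ⟨c, hc0, hc⟩ := ih (v := v - 1) (by omega) (by omega) (by omega)
    rcases H.step (v - 1) (by omega) (by omega) with h2 | h2 <;>
      rw [sub_add_cancel] at h2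
    · exact ⟨c, hc0, by omega⟩
    · exact ⟨c + 1, by omega, by omega⟩

/-- The set of squares recovers the abscissas and heights, so the length `(l, l')` of a strip is
well defined. -/
lemma unique (H : Ballot D a b h) (H' : Ballot D a' b' h') :
    a = a' ∧ b = b' ∧ ∀ v, a ≤ v → v ≤ b → h v = h' v := by
  have k1 := (H'.mem _).1 (H.mem_of le_rfl H.le)
  have k2 := (H'.mem _).1 (H.mem_of H.le le_rfl)
  have k3 := (H.mem _).1 (H'.mem_of le_rfl H'.le)
  have k4 := (H.mem _).1 (H'.mem_of H'.le le_rfl)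
  exact ⟨le_antisymm k3.1 k1.1, le_antisymm k2.2.1 k4.2.1, fun v h0 h1 =>
    ((H'.mem _).1 (H.mem_of h0 h1)).2.2⟩

end Ballot

lemma HasLength.ballot {D : Finset Square} {l l' : ℕ} (hD : HasLength D l l') :
    ∃ a b h, Ballot D a b h ∧ h b = h a + l' ∧ b - a = 2 * l + l' := by
  obtain ⟨x, h, h1, h2, h3, rfl⟩ := hD
  refine ⟨x, x + (2 * l + l' : ℕ), fun v => h (v - x).toNat, ⟨by omega, ?_, ?_, ?_⟩, ?_, by
    push_cast; ring⟩
  · intro v h4 h5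
    have e : (v + 1 - x).toNat = (v - x).toNat + 1 := by omega
    rw [e]
    exact h1 _ (by omega)
  · intro v h4 h5
    simpa using h2 _ (by omega)
  · rintro ⟨v, j⟩
    simp only [Finset.mem_image, Finset.mem_range, Prod.mk.injEq]
    constructor
    · rintro ⟨i, hi, rfl, rfl⟩
      refine ⟨by omega, by omega, ?_⟩
      congr 1; omega
    · rintro ⟨h4, h5, rfl⟩
      exact ⟨(v - x).toNat, by omega, by omega, rfl⟩
  · have e : (2 * (l : ℤ) + l').toNat = 2 * l + l' := by omega
    simpa [e] using h3

lemma Ballot.hasLength_iff {D : Finset Square} {a b : ℤ} {h : ℤ → ℤ} (H : Ballot D a b h)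
    {l l' : ℕ} : HasLength D l l' ↔ h b = h a + l' ∧ b - a = 2 * l + l' := by
  constructor
  · intro hD
    obtain ⟨a', b', h', H', e1, e2⟩ := hD.ballot
    obtain ⟨rfl, rfl, e⟩ := H.unique H'
    rw [e _ le_rfl H.le, e _ H.le le_rfl]
    exact ⟨e1, e2⟩
  · rintro ⟨e1, e2⟩
    refine ⟨a, fun i => h (a + i), ?_, ?_, ?_, ?_⟩
    · intro i hi
      have := H.step (a + i) (by omega) (by omega)
      simpa [add_assoc] using this
    · intro i hi
      simpa using H.low (a + i) (by omega) (by omega)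
    · have : a + ((2 * l + l' : ℕ) : ℤ) = b := by push_cast; omega
      simp only [this, e1]; simp
    · ext ⟨v, j⟩
      rw [H.mem]
      simp only [Finset.mem_image, Finset.mem_range, Prod.mk.injEq]
      constructor
      · rintro ⟨h4, h5, rfl⟩
        exact ⟨(v - a).toNat, by omega, by omega, by congr 1; omega⟩
      · rintro ⟨i, hi, rfl, rfl⟩
        exact ⟨by omega, by omega, rfl⟩

lemma Ballot.exists_hasLength {D : Finset Square} {a b : ℤ} {h : ℤ → ℤ} (H : Ballot D a b h) :
    ∃ l l' : ℕ, HasLength D l l' ∧ h b = h a + l' ∧ b - a = 2 * l + l' := by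
  obtain ⟨c, hc, e⟩ := H.parity H.le le_rfl
  have := H.low b H.le le_rfl
  have e1 : h b = h a + (h b - h a).toNat := by omega
  have e2 : b - a = 2 * (c.toNat : ℤ) + (h b - h a).toNat := by omega
  exact ⟨c.toNat, (h b - h a).toNat, H.hasLength_iff.2 ⟨e1, e2⟩, e1, e2⟩

/-- A ballot strip which is allowed in the diagrams of paths with `N` steps. -/
structure Strip (N : ℕ) (D : Finset Square) (a b : ℤ) (h : ℤ → ℤ) : Prop
    extends Ballot D a b h where
  anchored : h b = h a ∨ b = N

lemma IsStrip.strip {N : ℕ} {D : Finset Square} (hD : IsStrip N D) :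
    ∃ a b h, Strip N D a b h := by
  obtain ⟨l, l', h1, h2⟩ := hD
  obtain ⟨a, b, h, H, e1, e2⟩ := h1.ballot
  refine ⟨a, b, h, H, ?_⟩
  rcases Nat.eq_zero_or_pos l' with rfl | hl
  · left; simpa using e1
  · right
    obtain ⟨s, hs, hs1, hs2⟩ := h2 hl
    have k1 := hs2 _ (H.mem_of H.le le_rfl)
    have k2 := ((H.mem _).1 hs).2.1
    have := hs1.1
    dsimp only at k1
    omega

lemma Strip.isStrip {N : ℕ} {D : Finset Square} {a b : ℤ} {h : ℤ → ℤ} (H : Strip N D a b h)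
    {α β : Path} (hN : N = α.length) (hab : α.length = β.length) (hs : D ⊆ skew α β) :
    IsStrip N D := by
  obtain ⟨l, l', hD, e1, e2⟩ := H.exists_hasLength
  refine ⟨l, l', hD, fun hl => ?_⟩
  have hb : b = N := by
    rcases H.anchored with h1 | h1
    · omega
    · exact h1
  have hm := H.mem_of H.le le_rfl
  refine ⟨_, hm, ⟨hb, ?_, ?_⟩, fun s' hs' => ((H.mem _).1 hs').2.1⟩
  · have := mem_diagram.1 (Finset.mem_sdiff.1 (hs hm)).1
    dsimp only at this ⊢
    omega
  · have := mem_diagram.1 (Finset.mem_sdiff.1 (hs hm)).1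
    dsimp only at this ⊢
    rw [Int.even_iff]
    omega

lemma mem_Conf {α β : Path} {C : Finset (Finset Square)} :
    C ∈ Conf α β ↔ (∀ D ∈ C, IsStrip α.length D) ∧
      (∀ D ∈ C, ∀ D' ∈ C, ∀ s ∈ D, s ∈ D' → D = D') ∧
      ∀ s, s ∈ skew α β ↔ ∃ D ∈ C, s ∈ D := by
  classical
  unfold Conf
  simp only [Finset.mem_filter, Finset.mem_powerset]
  constructor
  · rintro ⟨h1, h2, h3, h4⟩
    refine ⟨h2, fun D hD D' hD' s hs hs' => ?_, fun s => ?_⟩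
    · by_contra hne
      exact Finset.disjoint_left.1 (h3 D hD D' hD' hne) hs hs'
    · rw [← h4]; simp
  · rintro ⟨h2, h3, h4⟩
    refine ⟨fun D hD => ?_, h2, fun D hD D' hD' hne => ?_, ?_⟩
    · rw [Finset.mem_powerset]
      exact fun s hs => (h4 s).2 ⟨D, hD, hs⟩
    · rw [Finset.disjoint_left]
      exact fun s hs hs' => hne (h3 D hD D' hD' s hs hs')
    · ext s
      rw [h4]; simp

lemma Conf_self (α : Path) : Conf α α = {∅} := by
  ext C
  rw [Finset.mem_singleton, mem_Conf]
  constructor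
  · rintro ⟨h1, -, h3⟩
    rw [Finset.eq_empty_iff_forall_notMem]
    intro D hD
    obtain ⟨a, b, h, H⟩ := (h1 D hD).strip
    have := (h3 _).2 ⟨D, hD, H.mem_of le_rfl H.le⟩
    simp [skew_self] at this
  · rintro rfl
    simp [skew_self]

lemma Ballot.exists_even_iff {D : Finset Square} {a b : ℤ} {h : ℤ → ℤ} (H : Ballot D a b h) :
    (∃ l l' : ℕ, HasLength D l l' ∧ Even l') ↔ Even (h b - h a) := by
  constructor
  · rintro ⟨l, l', h1, h2⟩
    rw [H.hasLength_iff] at h1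
    rw [h1.1, add_sub_cancel_left]
    exact_mod_cast h2
  · intro h1
    obtain ⟨l, l', h2, e1, e2⟩ := H.exists_hasLength
    refine ⟨l, l', h2, ?_⟩
    rw [e1, add_sub_cancel_left] at h1
    exact_mod_cast h1

open LaurentPolynomial in
lemma Ballot.wtI {D : Finset Square} {a b : ℤ} {h : ℤ → ℤ} (H : Ballot D a b h) :
    wtI D = if Even (h b - h a) then T (-1) else 1 := by
  unfold BallotStrip.wtI
  simp only [H.exists_even_iff]

open LaurentPolynomial in
lemma Ballot.wtII {D : Finset Square} {a b : ℤ} {h : ℤ → ℤ} (H : Ballot D a b h) :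
    wtII ∅ D = if Even (h b - h a) then -T (-1) else 1 := by
  unfold BallotStrip.wtII
  simp only [H.exists_even_iff]
  simp

/-- The contribution of the Rule I configurations. -/
noncomputable def SI (α β : Path) : LaurentPolynomial ℤ := by
  classical exact ∑ C ∈ (Conf α β).filter RuleI, ∏ D ∈ C, wtI D

/-- The contribution of the Rule II configurations without projection domain. -/
noncomputable def SII (α β : Path) : LaurentPolynomial ℤ := by
  classical exact ∑ C ∈ (Conf α β).filter (RuleII α.length ∅), ∏ D ∈ C, wtII ∅ D

lemma ruleI_empty : RuleI ∅ := by
  unfold RuleI; simp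

lemma ruleII_empty (N : ℕ) : RuleII N ∅ ∅ := by
  unfold RuleII; simp

/-- The convention for `α = β` is no exception: an empty diagram has only the empty configuration,
with product `1`. -/
lemma QI_eq (α β : Path) : QI α β = SI α β := by
  classical
  unfold QI SI
  split_ifs with h
  · subst h
    rw [Conf_self, Finset.filter_singleton, if_pos ruleI_empty]
    simp
  · congr!

end BallotStrip

/-! ### Matching the steps of a path and flipping matched pairs. -/

namespace BallotStrip

/-- The step of `γ` at `x` is a `+` step or an unmatched one, and `v` lies on the part of `γ` from
`x` on which `γ` does not go below its ordinate at `x`. -/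
def Cov (γ : Path) (x v : ℤ) : Prop :=
  x ≤ v ∧ v ≤ γ.length ∧ ∀ u, x ≤ u → u ≤ v → H γ x ≤ H γ u

/-- The `+` steps of `γ`, represented by the abscissas of their right ends. -/
def IsPlus (γ : Path) (x : ℤ) : Prop :=
  1 ≤ x ∧ x ≤ γ.length ∧ H γ x = H γ (x - 1) + 1

open Classical in
/-- The number of unmatched `+` steps to the right of `x`, if the step at `x` is an unmatched `+`
step, and `0` if this step is matched. -/
noncomputable def lp (γ : Path) (x : ℤ) : ℤ :=
  if Cov γ x γ.length then H γ γ.length - H γ x else 0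

/-- The interval from `x` to `b` is the maximal one starting at `x` on which `γ` does not go below
its ordinate at `x`. -/
structure Ext (γ : Path) (x b : ℤ) : Prop where
  le : x ≤ b
  le_len : b ≤ γ.length
  low : ∀ u, x ≤ u → u ≤ b → H γ x ≤ H γ u
  fin : b = γ.length ∨ b < γ.length ∧ H γ (b + 1) = H γ x - 1

lemma step_cases (γ : Path) {v : ℤ} (h0 : 1 ≤ v) (h1 : v ≤ γ.length) :
    H γ v = H γ (v - 1) + 1 ∨ H γ v = H γ (v - 1) - 1 := by
  simpa using H_step γ (v := v - 1) (by omega) (by omega)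

lemma exists_ext {γ : Path} {x : ℤ} (h0 : 0 ≤ x) (h1 : x ≤ γ.length) : ∃ b, Ext γ x b := by
  obtain ⟨b, hb, hmax⟩ := Int.exists_greatest_of_bdd (P := fun v => Cov γ x v)
    ⟨γ.length, fun v hv => hv.2.1⟩
    ⟨x, le_rfl, h1, fun u hu hu' => by rw [le_antisymm hu hu']⟩
  refine ⟨b, hb.1, hb.2.1, hb.2.2, ?_⟩
  rcases hb.2.1.lt_or_eq with h2 | h2
  · right
    refine ⟨h2, ?_⟩
    have h3 : ¬ Cov γ x (b + 1) := fun h => by have := hmax _ h; omega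
    have h4 := hb.2.2 b hb.1 le_rfl
    have hb1 := hb.1
    by_contra h5
    apply h3
    refine ⟨by omega, by omega, fun u hu hu' => ?_⟩
    rcases (show u ≤ b ∨ u = b + 1 by omega) with h6 | rfl
    · exact hb.2.2 u hu h6
    · rcases H_step γ (v := b) (by omega) h2 with h7 | h7 <;> omega
  · exact Or.inl h2

namespace Ext
variable {γ : Path} {x b : ℤ}

lemma cov_iff (e : Ext γ x b) {v : ℤ} : Cov γ x v ↔ x ≤ v ∧ v ≤ b := by
  constructor
  · rintro ⟨h1, h2, h3⟩
    refine ⟨h1, ?_⟩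
    by_contra h4
    have hx := e.le
    rcases e.fin with h5 | ⟨h5, h6⟩
    · omega
    · have := h3 (b + 1) (by omega) (by omega)
      omega
  · rintro ⟨h1, h2⟩
    exact ⟨h1, h2.trans e.le_len, fun u hu hu' => e.low u hu (by omega)⟩

lemma eq_of_lt (e : Ext γ x b) (h0 : 0 ≤ x) (h : b < γ.length) : H γ b = H γ x := by
  have hx := e.le
  have h1 := e.low b e.le le_rfl
  rcases e.fin with h5 | ⟨h5, h6⟩
  · omega
  · rcases H_step γ (v := b) (by omega) h5 with h7 | h7 <;> omega

/-- A stretch that stops before the end of the path stops at its starting height. So `lp` is the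
parameter `l'` of the strip which begins at `x` and is parallel to `γ`. -/
lemma lp_eq (e : Ext γ x b) (h0 : 0 ≤ x) : lp γ x = H γ b - H γ x := by
  unfold lp
  have hb := e.le_len
  rcases hb.lt_or_eq with h | h
  · rw [if_neg, e.eq_of_lt h0 h, sub_self]
    rw [e.cov_iff]; omega
  · rw [if_pos, h]
    rw [e.cov_iff]; exact ⟨by have := e.le; omega, h.ge⟩

end Ext

lemma lp_nonneg (γ : Path) (x : ℤ) : 0 ≤ lp γ x := by
  unfold lp
  split_ifs with h
  · have := h.2.2 _ h.1 le_rfl; omega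
  · exact le_rfl

lemma cov_of_lp {γ : Path} {x : ℤ} (h : 1 ≤ lp γ x) :
    Cov γ x γ.length ∧ lp γ x = H γ γ.length - H γ x := by
  unfold lp at *
  split_ifs at * with h1
  · exact ⟨h1, rfl⟩
  · omega

lemma Cov.trans {γ : Path} {x y v : ℤ} (h : Cov γ x y) (h' : Cov γ y v) : Cov γ x v := by
  refine ⟨h.1.trans h'.1, h'.2.1, fun u hu hu' => ?_⟩
  rcases le_total u y with h1 | h1
  · exact h.2.2 u hu h1
  · exact (h.2.2 y h.1 le_rfl).trans (h'.2.2 u h1 hu')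

lemma Cov.mono {γ : Path} {x y v : ℤ} (h : Cov γ x v) (h1 : x ≤ y) (h2 : y ≤ v) : Cov γ x y :=
  ⟨h1, h2.trans h.2.1, fun u hu hu' => h.2.2 u hu (hu'.trans h2)⟩

lemma Cov.lt {γ : Path} {x y : ℤ} (h : Cov γ x y) (hy : IsPlus γ y) (hxy : x < y) :
    H γ x < H γ y := by
  have := h.2.2 (y - 1) (by omega) (by omega)
  have := hy.2.2
  omega

/-- The number of elements of `X` covering `v`. -/
noncomputable def nX (γ : Path) (X : Finset ℤ) (v : ℤ) : ℤ := by
  classical exact ((X.filter fun x => Cov γ x v).card : ℤ)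

lemma nX_nonneg (γ : Path) (X : Finset ℤ) (v : ℤ) : 0 ≤ nX γ X v := by
  unfold nX; positivity

/-- The ordinates of the path obtained from `γ` by flipping the steps in `X` and the steps matched
with them. -/
noncomputable def flipH (γ : Path) (X : Finset ℤ) (v : ℤ) : ℤ := H γ v - 2 * nX γ X v

/-- A `+` step ends no stretch, so the count can only grow, by the stretch that begins at `v`
itself. -/
lemma nX_plus {γ : Path} {X : Finset ℤ} {v : ℤ} (hv : IsPlus γ v) :
    nX γ X v = nX γ X (v - 1) + if v ∈ X then 1 else 0 := by
  classical
  have key : ∀ x ∈ X, (Cov γ x v ↔ Cov γ x (v - 1) ∨ x = v) := by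
    intro x hx
    constructor
    · intro h
      rcases h.1.lt_or_eq with h1 | h1
      · exact Or.inl (h.mono (by omega) (by omega))
      · exact Or.inr h1
    · rintro (h | rfl)
      · refine ⟨by have := h.1; omega, hv.2.1, fun u hu hu' => ?_⟩
        rcases (show u ≤ v - 1 ∨ u = v by omega) with h1 | rfl
        · exact h.2.2 u hu h1
        · have := h.2.2 (u - 1) h.1 le_rfl
          have := hv.2.2
          omega
      · exact ⟨le_rfl, hv.2.1, fun u hu hu' => by rw [le_antisymm hu hu']⟩
  have e : X.filter (fun x => Cov γ x v) =
      X.filter (fun x => Cov γ x (v - 1)) ∪ X.filter (fun x => x = v) := by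
    ext x
    simp only [Finset.mem_filter, Finset.mem_union]
    constructor
    · rintro ⟨hx, h⟩
      rcases (key x hx).1 h with h | h
      · exact Or.inl ⟨hx, h⟩
      · exact Or.inr ⟨hx, h⟩
    · rintro (⟨hx, h⟩ | ⟨hx, h⟩)
      · exact ⟨hx, (key x hx).2 (Or.inl h)⟩
      · exact ⟨hx, (key x hx).2 (Or.inr h)⟩
  unfold nX
  rw [e, Finset.card_union_of_disjoint]
  · rw [Finset.filter_eq']
    split_ifs <;> simp
  · rw [Finset.disjoint_left]
    intro x hx hx'
    simp only [Finset.mem_filter] at hx hx'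
    have := hx.2.1
    omega

/-- The stretches ended by a `-` step are those whose starting height is `H γ (v - 1)`. Two of them
would be nested, and the inner one would start strictly higher by `Cov.lt`; so at most one ends. -/
lemma nX_minus {γ : Path} {X : Finset ℤ} (hX : ∀ x ∈ X, IsPlus γ x) {v : ℤ} (hv1 : 1 ≤ v)
    (hv2 : v ≤ γ.length) (hv : H γ v = H γ (v - 1) - 1) :
    nX γ X v = nX γ X (v - 1) ∨ nX γ X v = nX γ X (v - 1) - 1 := by
  classical
  have e : X.filter (fun x => Cov γ x (v - 1)) =
      X.filter (fun x => Cov γ x v) ∪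
        X.filter (fun x => Cov γ x (v - 1) ∧ H γ x = H γ (v - 1)) := by
    ext x
    simp only [Finset.mem_filter, Finset.mem_union]
    constructor
    · rintro ⟨hx, h⟩
      by_cases h1 : H γ x = H γ (v - 1)
      · exact Or.inr ⟨hx, h, h1⟩
      · refine Or.inl ⟨hx, by have := h.1; omega, hv2, fun u hu hu' => ?_⟩
        have h3 := h.2.2 (v - 1) h.1 le_rfl
        rcases (show u ≤ v - 1 ∨ u = v by omega) with h2 | rfl
        · exact h.2.2 u hu h2
        · omega
    · rintro (⟨hx, h⟩ | ⟨hx, h, h1⟩)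
      · refine ⟨hx, h.mono ?_ (by omega)⟩
        rcases h.1.lt_or_eq with h1 | rfl
        · omega
        · have := (hX x hx).2.2
          omega
      · exact ⟨hx, h⟩
  have hd : Disjoint (X.filter (fun x => Cov γ x v))
      (X.filter (fun x => Cov γ x (v - 1) ∧ H γ x = H γ (v - 1))) := by
    rw [Finset.disjoint_left]
    intro x hx hx'
    simp only [Finset.mem_filter] at hx hx'
    have := hx.2.2.2 v hx.2.1 le_rfl
    omega
  have hc : (X.filter (fun x => Cov γ x (v - 1) ∧ H γ x = H γ (v - 1))).card ≤ 1 := by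
    rw [Finset.card_le_one]
    intro x hx y hy
    simp only [Finset.mem_filter] at hx hy
    by_contra hne
    rcases lt_or_gt_of_ne hne with h | h
    · have := (hx.2.1.mono h.le hy.2.1.1).lt (hX y hy.1) h
      omega
    · have := (hy.2.1.mono h.le hx.2.1.1).lt (hX x hx.1) h
      omega
  unfold nX
  rw [e, Finset.card_union_of_disjoint hd]
  push_cast
  omega

lemma nX_zero {γ : Path} {X : Finset ℤ} (hX : ∀ x ∈ X, IsPlus γ x) : nX γ X 0 = 0 := by
  classical
  unfold nX
  rw [Nat.cast_eq_zero, Finset.card_eq_zero, Finset.filter_eq_empty_iff]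
  intro x hx h
  have := (hX x hx).1
  have := h.1
  omega

/-- By `nX_plus` and `nX_minus`, `flipH` still moves by `±1`: a `+` step is reversed exactly when it
lies in `X`, a `-` step exactly when it ends the stretch of an element of `X`. -/
lemma exists_flip {γ : Path} {X : Finset ℤ} (hX : ∀ x ∈ X, IsPlus γ x) :
    ∃ δ : Path, δ.length = γ.length ∧ ∀ v : ℤ, 0 ≤ v → v ≤ γ.length → H δ v = flipH γ X v := by
  apply exists_path
  · simp [flipH, nX_zero hX, H_zero]
  · intro v h0 h1
    unfold flipH
    rcases H_step γ h0 h1 with h | h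
    · have := nX_plus (γ := γ) (X := X) (v := v + 1) ⟨by omega, by omega, by simpa using h⟩
      rw [add_sub_cancel_right] at this
      split_ifs at this <;> omega
    · have := nX_minus hX (v := v + 1) (by omega) (by omega) (by simpa using h)
      rw [add_sub_cancel_right] at this
      omega

/-- The sets of `+` steps of `γ` which may be flipped. -/
def Valid (γ : Path) (X : Finset ℤ) : Prop :=
  (∀ x ∈ X, IsPlus γ x) ∧
    ∀ x ∈ X, (Odd (lp γ x) → ∃ y ∈ X, lp γ y = lp γ x + 1) ∧
      (Even (lp γ x) → 1 ≤ lp γ x → ∃ y ∈ X, lp γ y = lp γ x - 1)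

open Classical in
/-- The strip of a Rule II configuration which starts at `a`. -/
noncomputable def stripOf (γ δ : Path) (a : ℤ) : Finset Square :=
  ((Finset.Icc a γ.length).filter (Cov γ a)).image
    fun v => (v, H γ v - H γ a + H δ a + 1)

lemma mem_stripOf {γ δ : Path} {a : ℤ} {s : Square} :
    s ∈ stripOf γ δ a ↔ Cov γ a s.1 ∧ s.2 = H γ s.1 - H γ a + H δ a + 1 := by
  classical
  unfold stripOf
  simp only [Finset.mem_image, Finset.mem_filter, Finset.mem_Icc]
  constructor
  · rintro ⟨v, ⟨_, h⟩, rfl⟩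
    exact ⟨h, rfl⟩
  · rintro ⟨h1, h2⟩
    exact ⟨s.1, ⟨⟨h1.1, h1.2.1⟩, h1⟩, Prod.ext rfl h2.symm⟩

lemma Ext.strip {γ δ : Path} {a b : ℤ} (e : Ext γ a b) (h0 : 0 ≤ a) :
    Strip γ.length (stripOf γ δ a) a b (fun v => H γ v - H γ a + H δ a + 1) := by
  have hb := e.le_len
  refine ⟨⟨e.le, fun v h1 h2 => ?_, fun v h1 h2 => ?_, fun s => ?_⟩, ?_⟩
  · rcases H_step γ (v := v) (by omega) (by omega) with h | h
    · left; omega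
    · right; omega
  · have := e.low v h1 h2
    omega
  · rw [mem_stripOf, e.cov_iff, and_assoc]
  · rcases hb.lt_or_eq with h | h
    · left; rw [e.eq_of_lt h0 h]
    · exact Or.inr h

/-- The Rule II configuration with starts `X`. -/
noncomputable def confOf (γ δ : Path) (X : Finset ℤ) : Finset (Finset Square) := by
  classical exact X.image (stripOf γ δ)

lemma mem_confOf {γ δ : Path} {X : Finset ℤ} {D : Finset Square} :
    D ∈ confOf γ δ X ↔ ∃ a ∈ X, stripOf γ δ a = D := by
  classical
  unfold confOf
  simp

end BallotStrip

/-! ### Rule II: the configuration attached to a valid set of flipped steps. -/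

namespace BallotStrip

section Complete

variable {γ δ : Path} {X : Finset ℤ}

lemma nX_le_of_cov {a v : ℤ} (h : Cov γ a v) : nX γ X a ≤ nX γ X v := by
  classical
  unfold nX
  refine Nat.cast_le.2 (Finset.card_le_card fun x hx => ?_)
  simp only [Finset.mem_filter] at hx ⊢
  exact ⟨hx.1, hx.2.trans h⟩

lemma nX_lt_of_cov {a a' : ℤ} (h : Cov γ a a') (hlt : a < a') (ha' : a' ∈ X) :
    nX γ X a < nX γ X a' := by
  classical
  unfold nX
  refine Nat.cast_lt.2 (Finset.card_lt_card ?_)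
  rw [Finset.ssubset_iff_of_subset]
  · refine ⟨a', ?_, ?_⟩
    · simp only [Finset.mem_filter]
      exact ⟨ha', le_rfl, h.2.1, fun u hu hu' => by rw [le_antisymm hu hu']⟩
    · simp only [Finset.mem_filter, not_and]
      intro _ h1
      have := h1.1
      omega
  · intro x hx
    simp only [Finset.mem_filter] at hx ⊢
    exact ⟨hx.1, hx.2.trans h⟩

lemma cov_self {a : ℤ} (ha : IsPlus γ a) : Cov γ a a :=
  ⟨le_rfl, ha.2.1, fun u hu hu' => by rw [le_antisymm hu hu']⟩

lemma nX_pos {a v : ℤ} (ha : a ∈ X) (h : Cov γ a v) : 1 ≤ nX γ X v := by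
  classical
  unfold nX
  have : 0 < (X.filter fun x => Cov γ x v).card :=
    Finset.card_pos.2 ⟨a, by simp [ha, h]⟩
  omega

/-- Two elements of `X` covering `v` are compared by the numbers of elements covering them. -/
lemma lt_of_nX_lt {a a' v : ℤ} (ha : a ∈ X) (h : Cov γ a v) (h' : Cov γ a' v)
    (hn : nX γ X a' < nX γ X a) : a' < a ∧ Cov γ a' a := by
  rcases lt_trichotomy a' a with h1 | rfl | h1
  · exact ⟨h1, h'.mono h1.le h.1⟩
  · omega
  · have := nX_le_of_cov (X := X) (h.mono h1.le h'.1)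
    omega

lemma eq_of_nX_eq {a a' v : ℤ} (ha : a ∈ X) (ha' : a' ∈ X) (h : Cov γ a v) (h' : Cov γ a' v)
    (hn : nX γ X a' = nX γ X a) : a' = a := by
  rcases lt_trichotomy a' a with h1 | rfl | h1
  · have := nX_lt_of_cov (X := X) (h'.mono h1.le h.1) h1 ha
    omega
  · rfl
  · have := nX_lt_of_cov (X := X) (h.mono h1.le h'.1) h1 ha'
    omega

/-- The elements of `X` covering `v` are nested, so their depths `nX` are distinct integers between
`1` and `nX γ X v`. There are `nX γ X v` of them, hence every depth occurs. -/
lemma exists_nX_eq (hX : ∀ x ∈ X, IsPlus γ x) {v c : ℤ} (h1 : 1 ≤ c) (h2 : c ≤ nX γ X v) :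
    ∃ a ∈ X, Cov γ a v ∧ nX γ X a = c := by
  classical
  have hsub : (X.filter fun x => Cov γ x v).image (nX γ X) ⊆ Finset.Icc 1 (nX γ X v) := by
    intro d hd
    simp only [Finset.mem_image, Finset.mem_filter, Finset.mem_Icc] at hd ⊢
    obtain ⟨a, ⟨ha, hv⟩, rfl⟩ := hd
    exact ⟨nX_pos ha (cov_self (hX a ha)), nX_le_of_cov hv⟩
  have hcard : ((X.filter fun x => Cov γ x v).image (nX γ X)).card =
      (X.filter fun x => Cov γ x v).card := by
    rw [Finset.card_image_iff]
    intro a ha b hb hab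
    simp only [Finset.coe_filter, Set.mem_ofPred_eq] at ha hb
    exact eq_of_nX_eq hb.1 ha.1 hb.2 ha.2 hab
  have heq := Finset.eq_of_subset_of_card_le hsub (by
    rw [hcard, Int.card_Icc]
    unfold nX
    omega)
  have hc : c ∈ Finset.Icc 1 (nX γ X v) := Finset.mem_Icc.2 ⟨h1, h2⟩
  rw [← heq] at hc
  simp only [Finset.mem_image, Finset.mem_filter] at hc
  obtain ⟨a, ⟨ha, hv⟩, he⟩ := hc
  exact ⟨a, ha, hv, he⟩

variable (hX : ∀ x ∈ X, IsPlus γ x) (hl : δ.length = γ.length)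
  (hδ : ∀ v : ℤ, 0 ≤ v → v ≤ γ.length → H δ v = flipH γ X v)

include hX hl hδ

omit hl in
-- Since `δ` lies `2 * nX` below `γ` at `a`, the strip is a piece of `γ` moved down by an amount
-- depending only on the nesting depth of `a`. Strips are compared through these depths from here
-- on.
lemma mem_stripOf_flip {a : ℤ} (ha : a ∈ X) {s : Square} :
    s ∈ stripOf γ δ a ↔ Cov γ a s.1 ∧ s.2 = H γ s.1 - 2 * nX γ X a + 1 := by
  have h1 := hX a ha
  rw [mem_stripOf, hδ a (by have := h1.1; omega) h1.2.1, flipH]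
  refine and_congr_right fun _ => ?_
  constructor <;> intro h <;> omega

omit hl in
lemma stripOf_disjoint {a a' : ℤ} (ha : a ∈ X) (ha' : a' ∈ X) {s : Square}
    (h : s ∈ stripOf γ δ a) (h' : s ∈ stripOf γ δ a') : a = a' := by
  rw [mem_stripOf_flip hX hδ ha] at h
  rw [mem_stripOf_flip hX hδ ha'] at h'
  exact eq_of_nX_eq ha' ha h'.1 h.1 (by omega)

omit hX in
lemma below_flip : Below δ γ := by
  rw [below_iff]
  refine ⟨hl, fun v h0 h1 => ?_⟩
  rw [hδ v h0 (hl ▸ h1), flipH]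
  have := nX_nonneg γ X v
  omega

/-- In column `v` the squares between the paths sit at depths `1` to `nX γ X v` below `γ`; the one
at depth `c` lies on the strip of the element of depth `c` covering `v`. -/
lemma confOf_mem_Conf : confOf γ δ X ∈ Conf δ γ := by
  have hsq : ∀ s, s ∈ skew δ γ ↔ ∃ D ∈ confOf γ δ X, s ∈ D := by
    intro s
    rw [mem_skew hl]
    constructor
    · rintro ⟨h1, h2, h3, h4, h5⟩
      rw [hδ _ (by omega) (by omega), flipH] at h4
      obtain ⟨c, hc0, hc1, hc⟩ := H_parity γ (v := s.1) (by omega) (by omega)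
      obtain ⟨a, ha, hv, he⟩ := exists_nX_eq hX (v := s.1) (c := (H γ s.1 + 1 - s.2) / 2)
        (by omega) (by omega)
      exact ⟨_, mem_confOf.2 ⟨a, ha, rfl⟩, (mem_stripOf_flip hX hδ ha).2 ⟨hv, by omega⟩⟩
    · rintro ⟨D, hD, hs⟩
      obtain ⟨a, ha, rfl⟩ := mem_confOf.1 hD
      rw [mem_stripOf_flip hX hδ ha] at hs
      have h1 := nX_le_of_cov (X := X) hs.1
      have h2 := nX_pos ha (cov_self (hX a ha))
      have h3 := (hX a ha).1
      have h4 := hs.1.1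
      have h5 := hs.1.2.1
      obtain ⟨c, hc0, hc1, hc⟩ := H_parity γ (v := s.1) (by omega) (by omega)
      refine ⟨by omega, by omega, by omega, ?_, by omega⟩
      rw [hδ _ (by omega) (by omega), flipH]
      omega
  rw [mem_Conf]
  refine ⟨fun D hD => ?_, fun D hD D' hD' s hs hs' => ?_, hsq⟩
  · obtain ⟨a, ha, rfl⟩ := mem_confOf.1 hD
    have h1 := hX a ha
    obtain ⟨b, e⟩ := exists_ext (γ := γ) (x := a) (by have := h1.1; omega) h1.2.1
    have hS := e.strip (δ := δ) (by have := h1.1; omega)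
    rw [← hl] at hS
    exact hS.isStrip rfl hl fun s hs => (hsq s).2 ⟨_, hD, hs⟩
  · obtain ⟨a, ha, rfl⟩ := mem_confOf.1 hD
    obtain ⟨a', ha', rfl⟩ := mem_confOf.1 hD'
    rw [stripOf_disjoint hX hδ ha ha' hs hs']

omit hl in
/-- If some square of the strip at `a'` is just above, NW or NE of a square of the strip at `a`,
then the strip at `a'` is the next one around the strip at `a`. -/
lemma parent_of_upper {a a' : ℤ} (ha : a ∈ X) (ha' : a' ∈ X) (hne : a ≠ a') {s u : Square}
    (hs : s ∈ stripOf γ δ a) (hu : u ∈ uppers s) (hu' : u ∈ stripOf γ δ a') :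
    a' < a ∧ Cov γ a' a ∧ nX γ X a' = nX γ X a - 1 := by
  rw [mem_stripOf_flip hX hδ ha] at hs
  rw [mem_stripOf_flip hX hδ ha'] at hu'
  obtain ⟨v, j⟩ := s
  simp only [uppers, up, Finset.mem_insert, Finset.mem_singleton] at hu
  dsimp only at hs
  obtain ⟨hs, rfl⟩ := hs
  have p1 := hX a ha
  have p1' := p1.1
  have hva := hs.1
  have hvN := hs.2.1
  rcases hu with rfl | rfl | rfl
  · dsimp only at hu'
    have hn : nX γ X a' = nX γ X a - 1 := by omega
    have := lt_of_nX_lt ha hs hu'.1 (by omega)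
    exact ⟨this.1, this.2, hn⟩
  · dsimp only at hu'
    obtain ⟨hc, hj⟩ := hu'
    have hav := hs.1
    rcases hav.lt_or_eq with h1 | h1
    · have hs' : Cov γ a (v - 1) := hs.mono (by omega) (by omega)
      rcases step_cases γ (v := v) (by omega) (by omega) with h2 | h2
      · have hn : nX γ X a' = nX γ X a - 1 := by omega
        have := lt_of_nX_lt ha hs' hc (by omega)
        exact ⟨this.1, this.2, hn⟩
      · exact absurd (eq_of_nX_eq ha' ha hc hs' (by omega)) hne
    · subst h1
      have hn : nX γ X a' = nX γ X a - 1 := by have := p1.2.2; omega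
      have h3 := hc.1
      refine ⟨by omega, ⟨by omega, hvN, fun w hw hw' => ?_⟩, hn⟩
      rcases (show w ≤ a - 1 ∨ w = a by omega) with h4 | rfl
      · exact hc.2.2 w hw h4
      · have := hc.2.2 _ hc.1 le_rfl
        have := p1.2.2
        omega
  · dsimp only at hu'
    obtain ⟨hc, hj⟩ := hu'
    have h3 := hc.2.1
    rcases H_step γ (v := v) (by omega) (by omega) with h2 | h2
    · have hs' : Cov γ a (v + 1) := by
        refine ⟨by omega, h3, fun w hw hw' => ?_⟩
        rcases (show w ≤ v ∨ w = v + 1 by omega) with h4 | rfl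
        · exact hs.2.2 w hw h4
        · have := hs.2.2 v hs.1 le_rfl
          omega
      exact absurd (eq_of_nX_eq ha' ha hc hs' (by omega)) hne
    · have hn : nX γ X a' = nX γ X a - 1 := by omega
      have h5 : a' ≤ v := by
        rcases hc.1.lt_or_eq with h5 | h5
        · omega
        · have := (hX a' ha').2.2
          rw [h5, add_sub_cancel_right] at this
          omega
      have := lt_of_nX_lt ha hs (hc.mono h5 (by omega)) (by omega)
      exact ⟨this.1, this.2, hn⟩

omit hl in
-- The two strips are pieces of `γ` at consecutive levels. A NW or NE neighbour lies on the strip's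
-- own level or on the next one, according to the direction of the step of `γ`. As `γ` is strictly
-- lower at `a'` than at `a`, the outer stretch goes past the inner one on both sides, as far as
-- there are columns.
lemma uppers_of_parent {a a' : ℤ} (ha : a ∈ X) (ha' : a' ∈ X) (hlt : a' < a)
    (hc : Cov γ a' a) (hn : nX γ X a' = nX γ X a - 1) {s u : Square}
    (hs : s ∈ stripOf γ δ a) (hu : u ∈ uppers s) (huN : u.1 ≤ γ.length) :
    u ∈ stripOf γ δ a ∨ u ∈ stripOf γ δ a' := by
  rw [mem_stripOf_flip hX hδ ha] at hs
  rw [mem_stripOf_flip hX hδ ha, mem_stripOf_flip hX hδ ha']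
  obtain ⟨v, j⟩ := s
  simp only [uppers, up, Finset.mem_insert, Finset.mem_singleton] at hu
  dsimp only at hs
  obtain ⟨hs, rfl⟩ := hs
  have p1 := hX a ha
  have p1' := p1.1
  have hva := hs.1
  have hvN := hs.2.1
  have hav : Cov γ a' v := hc.trans hs
  rcases hu with rfl | rfl | rfl
  · right
    exact ⟨hav, by dsimp only; omega⟩
  · dsimp only
    rcases step_cases γ (v := v) (by omega) (by omega) with h2 | h2
    · right
      exact ⟨hav.mono (by omega) (by omega), by omega⟩
    · left
      have : v ≠ a := by rintro rfl; have := p1.2.2; omega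
      exact ⟨hs.mono (by omega) (by omega), by omega⟩
  · dsimp only at huN ⊢
    rcases H_step γ (v := v) (by omega) (by omega) with h2 | h2
    · left
      refine ⟨⟨by omega, huN, fun w hw hw' => ?_⟩, by omega⟩
      rcases (show w ≤ v ∨ w = v + 1 by omega) with h4 | rfl
      · exact hs.2.2 w hw h4
      · have := hs.2.2 v hs.1 le_rfl
        omega
    · right
      refine ⟨⟨by omega, huN, fun w hw hw' => ?_⟩, by omega⟩
      rcases (show w ≤ v ∨ w = v + 1 by omega) with h4 | rfl
      · exact hav.2.2 w hw h4
      · have := hs.2.2 v hs.1 le_rfl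
        have := hc.lt p1 hlt
        omega

omit hl hδ in
/-- The strip at `y` is the next one around the strip at `x` if there is one unmatched `+` step
more to the right of it. -/
lemma parent_of_lp {x y : ℤ} (hx : x ∈ X) (hy : y ∈ X) (h1 : 1 ≤ lp γ x)
    (h : lp γ y = lp γ x + 1) : y < x ∧ Cov γ y x ∧ nX γ X y = nX γ X x - 1 := by
  classical
  obtain ⟨cx, ex⟩ := cov_of_lp h1
  obtain ⟨cy, ey⟩ := cov_of_lp (γ := γ) (x := y) (by omega)
  have hlt : y < x := by
    rcases lt_trichotomy y x with h2 | rfl | h2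
    · exact h2
    · omega
    · have := (cx.mono h2.le cy.1).lt (hX y hy) h2
      omega
  have hc : Cov γ y x := cy.mono hlt.le cx.1
  refine ⟨hlt, hc, ?_⟩
  have e : (X.filter fun z => Cov γ z x) = insert x (X.filter fun z => Cov γ z y) := by
    ext z
    simp only [Finset.mem_filter, Finset.mem_insert]
    constructor
    · rintro ⟨hz, hzc⟩
      rcases hzc.1.lt_or_eq with h2 | rfl
      · right
        refine ⟨hz, hzc.mono ?_ hlt.le⟩
        by_contra h3
        push Not at h3
        have k1 := (cy.mono h3.le (h2.le.trans cx.1)).lt (hX z hz) h3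
        have k2 := hzc.lt (hX x hx) h2
        omega
      · exact Or.inl rfl
    · rintro (rfl | ⟨hz, hzc⟩)
      · exact ⟨hx, cov_self (hX _ hx)⟩
      · exact ⟨hz, hzc.trans hc⟩
  unfold nX
  rw [e, Finset.card_insert_of_notMem]
  · push_cast; ring
  · simp only [Finset.mem_filter, not_and]
    intro _ h2
    have := h2.1
    omega

end Complete

/-- Condition (a) combines `parent_of_upper` and `uppers_of_parent`. Condition (b) translates the
validity of `X`: `l'` is `lp`, and elements with consecutive positive `lp` are neighbours in the
nesting. -/
lemma confOf_ruleII {γ δ : Path} {X : Finset ℤ} (hX : Valid γ X) (hl : δ.length = γ.length)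
    (hδ : ∀ v : ℤ, 0 ≤ v → v ≤ γ.length → H δ v = flipH γ X v) :
    RuleII δ.length ∅ (confOf γ δ X) := by
  have hP := hX.1
  have len : ∀ x ∈ X, ∀ l l' : ℕ, HasLength (stripOf γ δ x) l l' →
      lp γ x = l' ∧ ∃ b, Ext γ x b ∧ b - x = 2 * l + l' := by
    intro x hx l l' h
    have h1 := hP x hx
    have h0 : 0 ≤ x := by have := h1.1; omega
    obtain ⟨b, e⟩ := exists_ext (γ := γ) h0 h1.2.1
    have := ((e.strip (δ := δ) h0).hasLength_iff).1 h
    refine ⟨?_, b, e, this.2⟩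
    rw [e.lp_eq h0]
    omega
  have key : ∀ x ∈ X, ∀ y ∈ X, ∀ l l' : ℕ, HasLength (stripOf γ δ x) l l' → 1 ≤ l' →
      lp γ y = lp γ x + 1 → (∃ l'' ≥ l, HasLength (stripOf γ δ y) l'' (l' + 1)) ∧
        ∃ s ∈ stripOf γ δ x, up s ∈ stripOf γ δ y := by
    intro x hx y hy l l' hD hl' h
    obtain ⟨e1, b, eb, e2⟩ := len x hx l l' hD
    obtain ⟨hlt, hc, hn⟩ := parent_of_lp hP hx hy (by omega) h
    constructor
    · have p := hP y hy
      have h0 : 0 ≤ y := by have := p.1; omega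
      obtain ⟨c, ec⟩ := exists_ext (γ := γ) h0 p.2.1
      obtain ⟨l2, l2', hD2, f1, f2⟩ := (ec.strip (δ := δ) h0).exists_hasLength
      obtain ⟨g1, -⟩ := len y hy _ _ hD2
      -- A positive `lp` means that the stretch reaches the last column. Both strips end there and
      -- the outer one begins further left, which gives the inequality between the lengths.
      have hbN : b = γ.length := by
        rcases eb.le_len.lt_or_eq with k | k
        · have := eb.eq_of_lt (by omega) k
          have := eb.lp_eq (by omega)
          omega
        · exact k
      have hcN : c = γ.length := by
        rcases ec.le_len.lt_or_eq with k | k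
        · have := ec.eq_of_lt (by omega) k
          have := ec.lp_eq (by omega)
          omega
        · exact k
      have : l2' = l' + 1 := by omega
      subst this
      push_cast at f2
      exact ⟨l2, by omega, hD2⟩
    · refine ⟨(x, H γ x - 2 * nX γ X x + 1), ?_, ?_⟩
      · rw [mem_stripOf_flip hP hδ hx]
        exact ⟨cov_self (hP x hx), rfl⟩
      · rw [mem_stripOf_flip hP hδ hy]
        refine ⟨hc, ?_⟩
        dsimp only [up]
        omega
  refine ⟨?_, ?_, by simp, by simp⟩
  · intro D hD D' hD' hne
    obtain ⟨a, ha, rfl⟩ := mem_confOf.1 hD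
    obtain ⟨a', ha', rfl⟩ := mem_confOf.1 hD'
    rintro ⟨s, hs, u, hu, hu'⟩ t ht - w hw hwN
    rw [hl] at hwN
    obtain ⟨k1, k2, k3⟩ := parent_of_upper hP hδ ha ha' (fun e => hne (by rw [e])) hs hu hu'
    exact uppers_of_parent hP hδ ha ha' k1 k2 k3 ht hw hwN
  · intro D hD l l' hl' hL
    obtain ⟨a, ha, rfl⟩ := mem_confOf.1 hD
    obtain ⟨e1, -⟩ := len a ha l l' hL
    constructor
    · intro ho
      obtain ⟨y, hy, h⟩ := (hX.2 a ha).1 (by rw [e1]; exact_mod_cast ho)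
      obtain ⟨⟨l'', h1, h2⟩, h3⟩ := key a ha y hy l l' hL hl' h
      exact ⟨_, mem_confOf.2 ⟨y, hy, rfl⟩, l'', h1, h2, h3⟩
    · intro he
      obtain ⟨y, hy, h⟩ := (hX.2 a ha).2 (by rw [e1]; exact_mod_cast he) (by omega)
      have p := hP y hy
      have h0 : 0 ≤ y := by have := p.1; omega
      obtain ⟨c, ec⟩ := exists_ext (γ := γ) h0 p.2.1
      obtain ⟨l2, l2', hD2, f1, f2⟩ := (ec.strip (δ := δ) h0).exists_hasLength
      obtain ⟨g1, -⟩ := len y hy _ _ hD2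
      have hl2 : l2' + 1 = l' := by omega
      obtain ⟨q, hq⟩ := he
      obtain ⟨⟨l3, h1, h2⟩, s, hs, hs'⟩ := key y hy a ha l2 l2' hD2 (by omega) (by omega)
      refine ⟨_, mem_confOf.2 ⟨y, hy, rfl⟩, l2, ?_, ?_, up s, hs', ?_⟩
      · have p' := hP a ha
        have h0' : 0 ≤ a := by have := p'.1; omega
        obtain ⟨b, eb⟩ := exists_ext (γ := γ) h0' p'.2.1
        have k1 := ((eb.strip (δ := δ) h0').hasLength_iff).1 hL
        have k2 := ((eb.strip (δ := δ) h0').hasLength_iff).1 h2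
        omega
      · rwa [show l' - 1 = l2' by omega]
      · simpa [up, down] using hs

end BallotStrip

/-! ### Rule II: uniqueness of the configuration. -/

namespace BallotStrip

lemma stripOf_lp {γ δ : Path} {x : ℤ} (hx : IsPlus γ x) {l l' : ℕ}
    (h : HasLength (stripOf γ δ x) l l') : lp γ x = l' := by
  have h0 : 0 ≤ x := by have := hx.1; omega
  obtain ⟨b, e⟩ := exists_ext (γ := γ) h0 hx.2.1
  have := ((e.strip (δ := δ) h0).hasLength_iff).1 h
  rw [e.lp_eq h0]
  omega

lemma exists_stripOf_hasLength {γ : Path} (δ : Path) {x : ℤ} (hx : IsPlus γ x) :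
    ∃ l l' : ℕ, HasLength (stripOf γ δ x) l l' ∧ lp γ x = l' := by
  have h0 : 0 ≤ x := by have := hx.1; omega
  obtain ⟨b, e⟩ := exists_ext (γ := γ) h0 hx.2.1
  obtain ⟨l, l', h, -⟩ := (e.strip (δ := δ) h0).exists_hasLength
  exact ⟨l, l', h, stripOf_lp hx h⟩

lemma stripOf_inj {γ δ : Path} {x y : ℤ} (hx : IsPlus γ x) (hy : IsPlus γ y)
    (h : stripOf γ δ x = stripOf γ δ y) : x = y := by
  have h1 : ((x, H δ x + 1) : Square) ∈ stripOf γ δ x :=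
    mem_stripOf.2 ⟨cov_self hx, by ring⟩
  have h2 : ((y, H δ y + 1) : Square) ∈ stripOf γ δ y :=
    mem_stripOf.2 ⟨cov_self hy, by ring⟩
  rw [h] at h1
  rw [← h] at h2
  exact le_antisymm (mem_stripOf.1 h2).1.1 (mem_stripOf.1 h1).1.1

/-- The `+` steps of `γ` at which `δ` has a `-` step. -/
noncomputable def flipped (γ δ : Path) : Finset ℤ := by
  classical exact
    (Finset.Icc 1 (γ.length : ℤ)).filter fun x => IsPlus γ x ∧ H δ x = H δ (x - 1) - 1

lemma mem_flipped {γ δ : Path} {x : ℤ} :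
    x ∈ flipped γ δ ↔ IsPlus γ x ∧ H δ x = H δ (x - 1) - 1 := by
  unfold flipped
  simp only [Finset.mem_filter, Finset.mem_Icc]
  exact ⟨fun h => h.2, fun h => ⟨⟨h.1.1, h.1.2.1⟩, h⟩⟩

section Sound

variable {γ δ : Path} (hb : Below δ γ) {C : Finset (Finset Square)} (hC : C ∈ Conf δ γ)
  (hR : RuleII δ.length ∅ C)

include hb hC hR

omit hR in
lemma Conf.square {D : Finset Square} (hD : D ∈ C) {s : Square} (hs : s ∈ D) :
    1 ≤ s.1 ∧ s.1 ≤ δ.length ∧ (s.1 + s.2) % 2 = 1 ∧ H δ s.1 < s.2 ∧ s.2 < H γ s.1 :=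
  (mem_skew hb.1).1 (((mem_Conf.1 hC).2.2 s).2 ⟨D, hD, hs⟩)

omit hR in
lemma Conf.exists_mem {v j : ℤ} (h1 : 1 ≤ v) (h2 : v ≤ δ.length) (h3 : (v + j) % 2 = 1)
    (h4 : H δ v < j) (h5 : j < H γ v) : ∃ D ∈ C, ((v, j) : Square) ∈ D :=
  ((mem_Conf.1 hC).2.2 _).1 ((mem_skew hb.1).2 ⟨h1, h2, h3, h4, h5⟩)

/-- Condition (a) is applied to the square NW of the first square of `D`: it is to the left of `D`,
so it belongs to `D'`. -/
lemma lt_of_upper {D D' : Finset Square} (hD : D ∈ C) (hD' : D' ∈ C) (hne : D ≠ D')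
    {a b a' b' : ℤ} {h h' : ℤ → ℤ} (S : Strip δ.length D a b h) (S' : Strip δ.length D' a' b' h')
    {s u : Square} (hs : s ∈ D) (hu : u ∈ uppers s) (hu' : u ∈ D') : a' < a := by
  have h1 := (Conf.square hb hC hD (S.mem_of le_rfl S.le)).2.1
  have := hR.1 D hD D' hD' hne ⟨s, hs, u, hu, hu'⟩ _ (S.mem_of le_rfl S.le) (by simp)
    (a - 1, h a + 1) (by simp [uppers]) (by dsimp only at h1 ⊢; omega)
  rcases this with h2 | h2
  · have := ((S.mem _).1 h2).1
    dsimp only at this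
    omega
  · have := ((S'.mem _).1 h2).1
    dsimp only at this
    omega

/-- The strips of a Rule II configuration are parallel to the upper path. -/
lemma strip_parallel {D : Finset Square} (hD : D ∈ C) {a b : ℤ} {h : ℤ → ℤ}
    (S : Strip δ.length D a b h) :
    (∀ v, a ≤ v → v ≤ b → h v - h a = H γ v - H γ a) ∧ H γ a = H γ (a - 1) + 1 ∧
      (b = δ.length ∨ H γ (b + 1) = H γ b - 1) := by
  -- The induction is on the starting abscissa, because a strip touching `D` from above starts
  -- strictly further left.
  obtain ⟨n, hn⟩ : ∃ n : ℕ, a ≤ n := ⟨a.toNat, by omega⟩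
  induction n generalizing D a b h with
  | zero =>
    have := (Conf.square hb hC hD (S.mem_of le_rfl S.le)).1
    dsimp only at this
    omega
  | succ n ih =>
    have sqa := Conf.square hb hC hD (S.mem_of le_rfl S.le)
    have sqb := Conf.square hb hC hD (S.mem_of S.le le_rfl)
    dsimp only at sqa sqb
    have hab := S.le
    have hN := hb.1
    -- If another strip touches `D` from above, condition (a) makes it contain the squares above `D`
    -- and those next to its two ends, and `D` inherits its shape. Otherwise `D` runs just below
    -- `γ`.
    by_cases hx : ∃ D' ∈ C, D ≠ D' ∧ ∃ s ∈ D, ∃ u ∈ uppers s, u ∈ D'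
    · obtain ⟨D', hD', hne, hsu⟩ := hx
      obtain ⟨a', b', h', S'⟩ := ((mem_Conf.1 hC).1 D' hD').strip
      have hall := hR.1 D hD D' hD' hne hsu
      have hup : ∀ v, a ≤ v → v ≤ b → a' ≤ v ∧ v ≤ b' ∧ h v + 2 = h' v := by
        intro v h1 h2
        have := hall _ (S.mem_of h1 h2) (by simp) (v, h v + 2) (by simp [uppers, up])
          (by dsimp only; omega)
        rcases this with k | k
        · have := ((S.mem _).1 k).2.2
          dsimp only at this
          omega
        · exact (S'.mem _).1 k
      have hnw : a' ≤ a - 1 ∧ a - 1 ≤ b' ∧ h a + 1 = h' (a - 1) := by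
        have := hall _ (S.mem_of le_rfl S.le) (by simp) (a - 1, h a + 1) (by simp [uppers])
          (by dsimp only; omega)
        rcases this with k | k
        · have := ((S.mem _).1 k).1
          dsimp only at this
          omega
        · exact (S'.mem _).1 k
      obtain ⟨i1, -, -⟩ := ih hD' S' (by push_cast at hn; omega)
      refine ⟨fun v h1 h2 => ?_, ?_, ?_⟩
      · have k1 := hup v h1 h2
        have k2 := hup a le_rfl hab
        have k3 := i1 v k1.1 k1.2.1
        have k4 := i1 a k2.1 k2.2.1
        omega
      · have k2 := hup a le_rfl hab
        have k3 := i1 (a - 1) hnw.1 hnw.2.1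
        have k4 := i1 a k2.1 k2.2.1
        omega
      · rcases sqb.2.1.lt_or_eq with hbN | hbN
        · right
          have hne : a' ≤ b + 1 ∧ b + 1 ≤ b' ∧ h b + 1 = h' (b + 1) := by
            have := hall _ (S.mem_of S.le le_rfl) (by simp) (b + 1, h b + 1) (by simp [uppers])
              (by dsimp only; omega)
            rcases this with k | k
            · have := ((S.mem _).1 k).2.1
              dsimp only at this
              omega
            · exact (S'.mem _).1 k
          have k2 := hup b hab le_rfl
          have k3 := i1 (b + 1) hne.1 hne.2.1
          have k4 := i1 b k2.1 k2.2.1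
          omega
        · exact Or.inl hbN
    · have hno : ∀ s ∈ D, ∀ u ∈ uppers s, ∀ D' ∈ C, u ∈ D' → u ∈ D := by
        intro s hs u hu D' hD' hu'
        by_contra k
        exact hx ⟨D', hD', fun e => k (e ▸ hu'), s, hs, u, hu, hu'⟩
      have htop : ∀ v, a ≤ v → v ≤ b → h v = H γ v - 1 := by
        intro v h1 h2
        have sq := Conf.square hb hC hD (S.mem_of h1 h2)
        dsimp only at sq
        obtain ⟨c, hc0, hc1, hc⟩ := H_parity γ (v := v) (by omega) (by omega)
        by_contra k
        obtain ⟨D', hD', hm⟩ := Conf.exists_mem hb hC (v := v) (j := h v + 2) sq.1 sq.2.1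
          (by omega) (by omega) (by omega)
        have := ((S.mem _).1 (hno _ (S.mem_of h1 h2) _ (by simp [uppers, up]) D' hD' hm)).2.2
        dsimp only at this
        omega
      have ha := htop a le_rfl hab
      have hbt := htop b hab le_rfl
      refine ⟨fun v h1 h2 => ?_, ?_, ?_⟩
      · have := htop v h1 h2
        omega
      · rcases step_cases γ (v := a) (by omega) (by omega) with k | k
        · exact k
        · exfalso
          have ha1 : a ≠ 1 := by
            rintro rfl
            obtain ⟨c, hc0, hc1, hc⟩ := H_parity δ (v := 1) (by omega) (by omega)
            have := H_zero γ
            rw [show (1 : ℤ) - 1 = 0 by norm_num] at k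
            omega
          have hd := step_cases δ (v := a) (by omega) (by omega)
          obtain ⟨D', hD', hm⟩ := Conf.exists_mem hb hC (v := a - 1) (j := h a + 1)
            (by omega) (by omega) (by omega) (by omega) (by omega)
          have := ((S.mem _).1 (hno _ (S.mem_of le_rfl hab) _ (by simp [uppers]) D' hD' hm)).1
          dsimp only at this
          omega
      · rcases sqb.2.1.lt_or_eq with hbN | hbN
        · right
          rcases H_step γ (v := b) (by omega) (by omega) with k | k
          · exfalso
            have hd := H_step δ (v := b) (by omega) (by omega)
            obtain ⟨D', hD', hm⟩ := Conf.exists_mem hb hC (v := b + 1) (j := h b + 1)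
              (by omega) (by omega) (by omega) (by omega) (by omega)
            have := ((S.mem _).1 (hno _ (S.mem_of hab le_rfl) _ (by simp [uppers]) D' hD' hm)).2.1
            dsimp only at this
            omega
          · exact k
        · exact Or.inl hbN

/-- A square below the first one would lie on a strip starting at or before `a`, whereas
`lt_of_upper` makes that strip start after `a`. -/
lemma strip_start {D : Finset Square} (hD : D ∈ C) {a b : ℤ} {h : ℤ → ℤ}
    (S : Strip δ.length D a b h) : h a = H δ a + 1 := by
  have sq := Conf.square hb hC hD (S.mem_of le_rfl S.le)
  dsimp only at sq
  obtain ⟨c, hc0, hc1, hc⟩ := H_parity δ (v := a) (by omega) (by omega)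
  by_contra k
  obtain ⟨D', hD', hm⟩ := Conf.exists_mem hb hC (v := a) (j := h a - 2) sq.1 sq.2.1
    (by omega) (by omega) (by omega)
  obtain ⟨a', b', h', S'⟩ := ((mem_Conf.1 hC).1 D' hD').strip
  have hne : D' ≠ D := by
    rintro rfl
    have := ((S.mem _).1 hm).2.2
    dsimp only at this
    omega
  have h1 := lt_of_upper hb hC hR hD' hD hne S' S hm (u := (a, h a)) (by simp [uppers, up])
    (S.mem_of le_rfl S.le)
  have := ((S'.mem _).1 hm).1
  dsimp only at this
  omega

/-- If `δ` rose at `a`, the square SW of the first one would be in the diagram, and its strip would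
contradict `lt_of_upper`. -/
lemma strip_start_mem {D : Finset Square} (hD : D ∈ C) {a b : ℤ} {h : ℤ → ℤ}
    (S : Strip δ.length D a b h) : a ∈ flipped γ δ := by
  have sq := Conf.square hb hC hD (S.mem_of le_rfl S.le)
  dsimp only at sq
  have h1 := strip_start hb hC hR hD S
  have h2 := (strip_parallel hb hC hR hD S).2.1
  have hN := hb.1
  rw [mem_flipped]
  refine ⟨⟨sq.1, by omega, h2⟩, ?_⟩
  rcases step_cases δ (v := a) (by omega) (by omega) with k | k
  · exfalso
    have ha1 : a ≠ 1 := by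
      rintro rfl
      obtain ⟨c, hc0, hc1, hc⟩ := H_parity γ (v := 1) (by omega) (by omega)
      have := H_zero δ
      rw [show (1 : ℤ) - 1 = 0 by norm_num] at k
      omega
    obtain ⟨D', hD', hm⟩ := Conf.exists_mem hb hC (v := a - 1) (j := h a - 1)
      (by omega) (by omega) (by omega) (by omega) (by omega)
    obtain ⟨a', b', h', S'⟩ := ((mem_Conf.1 hC).1 D' hD').strip
    have hne : D' ≠ D := by
      rintro rfl
      have := ((S.mem _).1 hm).1
      dsimp only at this
      omega
    have h3 := lt_of_upper hb hC hR hD' hD hne S' S hm (u := (a, h a)) (by simp [uppers])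
      (S.mem_of le_rfl S.le)
    have := ((S'.mem _).1 hm).1
    dsimp only at this
    omega
  · exact k

/-- Being a ballot strip parallel to `γ`, `D` stays within the stretch of `γ` from `a`. It fills
this stretch: before the last column only a level strip can end, and `γ` goes down right after it.
-/
lemma strip_eq {D : Finset Square} (hD : D ∈ C) {a b : ℤ} {h : ℤ → ℤ}
    (S : Strip δ.length D a b h) : D = stripOf γ δ a := by
  have sq := Conf.square hb hC hD (S.mem_of le_rfl S.le)
  have sqb := Conf.square hb hC hD (S.mem_of S.le le_rfl)
  dsimp only at sq sqb
  have h1 := strip_start hb hC hR hD S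
  obtain ⟨h2, h3, h4⟩ := strip_parallel hb hC hR hD S
  have hN := hb.1
  have hab := S.le
  have e : Ext γ a b := by
    refine ⟨hab, by omega, fun u k1 k2 => ?_, ?_⟩
    · have := h2 u k1 k2
      have := S.low u k1 k2
      omega
    · rcases sqb.2.1.lt_or_eq with k | k
      · right
        have := h2 b hab le_rfl
        rcases S.anchored with k1 | k1 <;> omega
      · left; omega
  ext s
  rw [S.mem, mem_stripOf, e.cov_iff, and_assoc]
  refine and_congr_right fun k1 => and_congr_right fun k2 => ?_
  have := h2 s.1 k1 k2
  constructor <;> intro k <;> omega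

/-- Take the strip through the lowest square of column `a`. If it began earlier, it would follow the
up step of `γ` at `a`, and in the preceding column it would be below `δ`, which goes down at `a`. -/
lemma exists_strip_of_mem_flipped {a : ℤ} (ha : a ∈ flipped γ δ) : stripOf γ δ a ∈ C := by
  rw [mem_flipped] at ha
  obtain ⟨⟨h1, h2, h3⟩, h4⟩ := ha
  have hN := hb.1
  have h5 := hb.le (v := a - 1) (by omega) (by omega)
  obtain ⟨c, hc0, hc1, hc⟩ := H_parity δ (v := a) (by omega) (by omega)
  obtain ⟨D, hD, hm⟩ := Conf.exists_mem hb hC (v := a) (j := H δ a + 1)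
    (by omega) (by omega) (by omega) (by omega) (by omega)
  obtain ⟨a', b', h', S⟩ := ((mem_Conf.1 hC).1 D hD).strip
  obtain ⟨k1, k2, k3⟩ := (S.mem _).1 hm
  dsimp only at k1 k2 k3
  have : a' = a := by
    by_contra hne
    have p := (strip_parallel hb hC hR hD S).1
    have p1 := p a k1 k2
    have p2 := p (a - 1) (by omega) (by omega)
    have := (Conf.square hb hC hD (S.mem_of (v := a - 1) (by omega) (by omega))).2.2.2.1
    dsimp only at this
    omega
  subst this
  rwa [← strip_eq hb hC hR hD S]

lemma eq_confOf : C = confOf γ δ (flipped γ δ) := by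
  ext D
  rw [mem_confOf]
  constructor
  · intro hD
    obtain ⟨a, b, h, S⟩ := ((mem_Conf.1 hC).1 D hD).strip
    exact ⟨a, strip_start_mem hb hC hR hD S, (strip_eq hb hC hR hD S).symm⟩
  · rintro ⟨a, ha, rfl⟩
    exact exists_strip_of_mem_flipped hb hC hR ha

/-- This is condition (b), with `l'` read as `lp`. -/
lemma flipped_valid : Valid γ (flipped γ δ) := by
  have hP : ∀ x ∈ flipped γ δ, IsPlus γ x := fun x hx => (mem_flipped.1 hx).1
  refine ⟨hP, fun x hx => ?_⟩
  have hx' := exists_strip_of_mem_flipped hb hC hR hx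
  obtain ⟨l, l', h1, h2⟩ := exists_stripOf_hasLength δ (hP x hx)
  have find : ∀ D ∈ C, ∀ l l' : ℕ, HasLength D l l' → ∃ y ∈ flipped γ δ, lp γ y = l' := by
    intro D hD l l' hL
    rw [eq_confOf hb hC hR] at hD
    obtain ⟨y, hy, rfl⟩ := mem_confOf.1 hD
    exact ⟨y, hy, stripOf_lp (hP y hy) hL⟩
  rw [h2]
  constructor
  · intro ho
    have ho : Odd l' := by exact_mod_cast ho
    obtain ⟨D, hD, l'', -, hL, -⟩ := (hR.2.1 _ hx' l l' ho.pos h1).1 ho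
    exact_mod_cast find D hD _ _ hL
  · intro he hl
    have he : Even l' := by exact_mod_cast he
    have hl : 1 ≤ l' := by exact_mod_cast hl
    obtain ⟨D, hD, l'', -, hL, -⟩ := (hR.2.1 _ hx' l l' hl h1).2 he
    obtain ⟨y, hy, e⟩ := find D hD _ _ hL
    exact ⟨y, hy, by omega⟩

/-- Each square of column `v` lies on exactly one strip, and the strips meeting that column are
those of the flipped steps covering `v`. The bijection sends a flipped step to the depth of its
strip below `γ`. -/
lemma H_eq_flipH {v : ℤ} (h0 : 0 ≤ v) (h1 : v ≤ γ.length) :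
    H δ v = flipH γ (flipped γ δ) v := by
  classical
  have hN := hb.1
  have hle := hb.le h0 (by omega)
  have hP : ∀ x ∈ flipped γ δ, IsPlus γ x := fun x hx => (mem_flipped.1 hx).1
  have par : ∀ x : ℤ, 0 ≤ x → x ≤ γ.length → (H γ x - H δ x) % 2 = 0 := by
    intro x k1 k2
    obtain ⟨c, hc0, hc1, hc⟩ := H_parity γ (v := x) k1 k2
    obtain ⟨d, hd0, hd1, hd⟩ := H_parity δ (v := x) k1 (by omega)
    omega
  have hsq : ∀ a ∈ flipped γ δ, Cov γ a v →
      ((v, H γ v - H γ a + H δ a + 1) : Square) ∈ stripOf γ δ a :=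
    fun a ha hv => mem_stripOf.2 ⟨hv, rfl⟩
  have card : ((flipped γ δ).filter fun x => Cov γ x v).card =
      (Finset.Icc 1 ((H γ v - H δ v) / 2)).card := by
    apply Finset.card_bij (fun a _ => (H γ a - H δ a) / 2)
    · intro a ha
      simp only [Finset.mem_filter] at ha
      have p := hP a ha.1
      have q := par a (by have := p.1; omega) p.2.1
      have := Conf.square hb hC (exists_strip_of_mem_flipped hb hC hR ha.1) (hsq a ha.1 ha.2)
      dsimp only at this
      rw [Finset.mem_Icc]
      omega
    · intro a ha a' ha' he
      simp only [Finset.mem_filter] at ha ha'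
      have p := hP a ha.1
      have q := par a (by have := p.1; omega) p.2.1
      have p' := hP a' ha'.1
      have q' := par a' (by have := p'.1; omega) p'.2.1
      have m := hsq a ha.1 ha.2
      have m' := hsq a' ha'.1 ha'.2
      have he' : H γ v - H γ a' + H δ a' + 1 = H γ v - H γ a + H δ a + 1 := by omega
      rw [he'] at m'
      exact stripOf_inj p p' ((mem_Conf.1 hC).2.1 _ (exists_strip_of_mem_flipped hb hC hR ha.1) _
        (exists_strip_of_mem_flipped hb hC hR ha'.1) _ m m')
    · intro c hc
      rw [Finset.mem_Icc] at hc
      have hv : v ≠ 0 := by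
        rintro rfl
        rw [H_zero, H_zero] at hc
        omega
      obtain ⟨d, hd0, hd1, hd⟩ := H_parity γ (v := v) h0 h1
      obtain ⟨D, hD, hm⟩ := Conf.exists_mem hb hC (v := v) (j := H γ v - 2 * c + 1)
        (by omega) (by omega) (by omega) (by omega) (by omega)
      rw [eq_confOf hb hC hR] at hD
      obtain ⟨a, ha, rfl⟩ := mem_confOf.1 hD
      rw [mem_stripOf] at hm
      dsimp only at hm
      exact ⟨a, by simp [ha, hm.1], by omega⟩
  have := par v h0 h1
  unfold flipH nX
  rw [card, Int.card_Icc]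
  omega

end Sound

open LaurentPolynomial in
/-- The weight of a flipped step. -/
noncomputable def wtX (γ : Path) (x : ℤ) : LaurentPolynomial ℤ :=
  if Even (lp γ x) then -T (-1) else 1

lemma prod_confOf {γ δ : Path} {X : Finset ℤ} (hX : ∀ x ∈ X, IsPlus γ x) :
    ∏ D ∈ confOf γ δ X, wtII ∅ D = ∏ x ∈ X, wtX γ x := by
  classical
  unfold confOf
  rw [Finset.prod_image fun x hx y hy e => stripOf_inj (hX x hx) (hX y hy) e]
  refine Finset.prod_congr rfl fun x hx => ?_
  have h0 : 0 ≤ x := by have := (hX x hx).1; omega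
  obtain ⟨b, e⟩ := exists_ext (γ := γ) h0 (hX x hx).2.1
  rw [(e.strip (δ := δ) h0).wtII, wtX, e.lp_eq h0]
  congr 2
  rw [show H γ b - H γ x + H δ x + 1 - (H γ x - H γ x + H δ x + 1) = H γ b - H γ x by ring]

lemma flipped_flip {γ δ : Path} {X : Finset ℤ} (hX : ∀ x ∈ X, IsPlus γ x)
    (hδ : ∀ v : ℤ, 0 ≤ v → v ≤ γ.length → H δ v = flipH γ X v) : flipped γ δ = X := by
  have key : ∀ x, IsPlus γ x → (H δ x = H δ (x - 1) - 1 ↔ x ∈ X) := by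
    intro x hx
    have h1 := hx.1
    have h2 := hx.2.2
    rw [hδ x (by omega) hx.2.1, hδ (x - 1) (by omega) (by have := hx.2.1; omega), flipH, flipH,
      nX_plus hx]
    split_ifs with h <;> simp only [h, iff_true, iff_false] <;> omega
  ext x
  rw [mem_flipped]
  constructor
  · rintro ⟨h1, h2⟩
    exact (key x h1).1 h2
  · intro hx
    exact ⟨hX x hx, (key x (hX x hx)).2 hx⟩

lemma SII_flip {γ δ : Path} {X : Finset ℤ} (hX : Valid γ X) (hl : δ.length = γ.length)
    (hδ : ∀ v : ℤ, 0 ≤ v → v ≤ γ.length → H δ v = flipH γ X v) :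
    SII δ γ = ∏ x ∈ X, wtX γ x := by
  classical
  have hb := below_flip hl hδ
  unfold SII
  have : (Conf δ γ).filter (RuleII δ.length ∅) = {confOf γ δ X} := by
    ext C
    rw [Finset.mem_filter, Finset.mem_singleton]
    constructor
    · rintro ⟨h1, h2⟩
      rw [eq_confOf hb h1 h2, flipped_flip hX.1 hδ]
    · rintro rfl
      exact ⟨confOf_mem_Conf hX.1 hl hδ, confOf_ruleII hX hl hδ⟩
  rw [← prod_confOf (δ := δ) hX.1]
  exact (Finset.sum_congr (by convert this) fun _ _ => rfl).trans (Finset.sum_singleton _ _)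

/-- If the contribution of Rule II does not vanish, then the lower path is obtained by flipping
steps of the upper one. -/
lemma flip_of_SII_ne_zero {γ δ : Path} (hb : Below δ γ) (h : SII δ γ ≠ 0) :
    Valid γ (flipped γ δ) ∧
      ∀ v : ℤ, 0 ≤ v → v ≤ γ.length → H δ v = flipH γ (flipped γ δ) v := by
  classical
  unfold SII at h
  obtain ⟨C, hC, -⟩ := Finset.exists_ne_zero_of_sum_ne_zero h
  rw [Finset.mem_filter] at hC
  exact ⟨flipped_valid hb hC.1 hC.2, fun v h0 h1 => H_eq_flipH hb hC.1 hC.2 h0 h1⟩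

end BallotStrip

/-! ### Rule I: the strips just below the upper path. -/

namespace BallotStrip

open Classical in
/-- The squares in the columns between `a` and `b` which are just below the path `δ` moved down by
`2 * c`. -/
noncomputable def seg (δ : Path) (a b c : ℤ) : Finset Square :=
  (Finset.Icc a b).image fun v => (v, H δ v - 1 - 2 * c)

lemma mem_seg {δ : Path} {a b c : ℤ} {s : Square} :
    s ∈ seg δ a b c ↔ a ≤ s.1 ∧ s.1 ≤ b ∧ s.2 = H δ s.1 - 1 - 2 * c := by
  classical
  unfold seg
  simp only [Finset.mem_image, Finset.mem_Icc]
  constructor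
  · rintro ⟨v, ⟨h1, h2⟩, rfl⟩
    exact ⟨h1, h2, rfl⟩
  · rintro ⟨h1, h2, h3⟩
    exact ⟨s.1, ⟨h1, h2⟩, Prod.ext rfl h3.symm⟩

lemma Ballot.eq_seg {δ : Path} {D : Finset Square} {a b c : ℤ} {h : ℤ → ℤ} (S : Ballot D a b h)
    (hD : ∀ v, a ≤ v → v ≤ b → ((v, H δ v - 1 - 2 * c) : Square) ∈ D) : D = seg δ a b c := by
  ext s
  rw [S.mem, mem_seg]
  refine and_congr_right fun h1 => and_congr_right fun h2 => ?_
  have := ((S.mem _).1 (hD s.1 h1 h2)).2.2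
  dsimp only at this
  rw [this]

/-- The strips which contain a square just below `δ` in the columns between `a` and `b` follow `δ`
there. -/
def Flat (δ : Path) (C : Finset (Finset Square)) (a b : ℤ) : Prop :=
  ∀ D ∈ C, ∀ v, a ≤ v → v ≤ b → ((v, H δ v - 1) : Square) ∈ D →
    ∀ w, a ≤ w → w ≤ b → ((w, H δ w - 1) : Square) ∈ D

/-- The strip or the strips at the group of `+` steps of `γ` which begins at `z` occur in `C`. -/
def Rem (γ δ : Path) (C : Finset (Finset Square)) (z : ℤ) : Prop :=
  (lp γ z = 0 ∧ ∃ b, Ext γ z b ∧ seg δ z b 0 ∈ C) ∨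
    (2 ≤ lp γ z ∧ ∃ y, IsPlus γ y ∧ lp γ y + 1 = lp γ z ∧ seg δ z (y - 1) 0 ∈ C ∧
      seg δ y γ.length 0 ∈ C ∧ seg δ y γ.length 1 ∈ C)

section RuleI

variable {α δ : Path} (hb : Below α δ) {C : Finset (Finset Square)} (hC : C ∈ Conf α δ)
  (hR : RuleI C)

include hC in
lemma Conf.eq_of_mem {D D' : Finset Square} (hD : D ∈ C) (hD' : D' ∈ C) {s : Square}
    (hs : s ∈ D) (hs' : s ∈ D') : D = D' := (mem_Conf.1 hC).2.1 D hD D' hD' s hs hs'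

include hR in
lemma RuleI.down {D D' : Finset Square} (hD : D ∈ C) (hD' : D' ∈ C) {v j w i : ℤ}
    (h1 : ((v, j) : Square) ∈ D') (h2 : ((v, j - 2) : Square) ∈ D)
    (h3 : ((w, i) : Square) ∈ D') : ((w, i - 2) : Square) ∈ D :=
  hR.1 D hD D' hD' ⟨_, h1, h2⟩ _ h3

include hR in
lemma RuleI.parity {N : ℕ} {D : Finset Square} (hD : D ∈ C) {a b : ℤ} {h : ℤ → ℤ}
    (S : Strip N D a b h) (h1 : h b ≠ h a) : Odd (h b - h a) := by
  classical
  obtain ⟨l, l', hL, e1, e2⟩ := S.exists_hasLength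
  have hl : 1 ≤ l' := by omega
  by_contra ho
  have he : Even l' := by
    rw [Int.not_odd_iff_even, e1, add_sub_cancel_left] at ho
    exact_mod_cast ho
  have := (hR.2 l l' hl).2 he
  rw [Finset.card_eq_zero, Finset.filter_eq_empty_iff] at this
  exact this hD hL

include hC hR in
-- The strips of a given length with odd `l'` are even in number. A second one is anchored too, so
-- it ends in the same column and therefore also begins in the same column.
lemma RuleI.exists_other {D : Finset Square} (hD : D ∈ C) {a b : ℤ} {h : ℤ → ℤ}
    (S : Strip α.length D a b h) (h1 : h b ≠ h a) :
    ∃ D' ∈ C, D' ≠ D ∧ ∃ h', Strip α.length D' a b h' := by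
  classical
  obtain ⟨l, l', hL, e1, e2⟩ := S.exists_hasLength
  have hl : 1 ≤ l' := by omega
  have ho : Odd l' := by
    have := hR.parity hD S h1
    rw [e1, add_sub_cancel_left] at this
    exact_mod_cast this
  have hcard := (hR.2 l l' hl).1 ho
  have hm : D ∈ C.filter fun D => HasLength D l l' := by simp [hD, hL]
  have : 1 < (C.filter fun D => HasLength D l l').card := by
    have : 0 < (C.filter fun D => HasLength D l l').card := Finset.card_pos.2 ⟨D, hm⟩
    obtain ⟨c, hc⟩ := hcard
    have hc' : (C.filter fun D => HasLength D l l').card = c + c := by convert hc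
    omega
  obtain ⟨D', hD', hne⟩ := Finset.exists_mem_ne this D
  rw [Finset.mem_filter] at hD'
  obtain ⟨a', b', h', S'⟩ := ((mem_Conf.1 hC).1 D' hD'.1).strip
  have := (S'.hasLength_iff).1 hD'.2
  have k1 := S.anchored
  have k2 := S'.anchored
  have hb' : b' = b := by omega
  have ha' : a' = a := by omega
  subst hb' ha'
  exact ⟨D', hD'.1, hne, h', S'⟩

include hb hC hR

/-- Lower strips reach at least as far as higher ones. -/
lemma RuleI.chain {D D' : Finset Square} (hD : D ∈ C) (hD' : D' ∈ C) {v j w i : ℤ} (n : ℕ)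
    (h1 : ((v, j) : Square) ∈ D) (h2 : ((v, j - 2 * n) : Square) ∈ D')
    (h3 : ((w, i) : Square) ∈ D) : ((w, i - 2 * n) : Square) ∈ D' := by
  induction n generalizing D j i with
  | zero =>
    simp only [Nat.cast_zero, mul_zero, sub_zero] at *
    rwa [← Conf.eq_of_mem hC hD hD' h1 h2]
  | succ n ih =>
    push_cast at h2
    have k1 := Conf.square hb hC hD h1
    have k2 := Conf.square hb hC hD' h2
    dsimp only at k1 k2
    obtain ⟨E, hE, hm⟩ := Conf.exists_mem hb hC (v := v) (j := j - 2) k1.1 k1.2.1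
      (by omega) (by omega) (by omega)
    have k3 := hR.down hE hD h1 hm h3
    have := ih hE hm (by convert h2 using 2; ring) k3
    convert this using 2
    push_cast; ring

/-- The strip at the top of the column follows `δ`, and by `RuleI.chain` a lower strip reaches at
least as far. -/
lemma Flat.level {a b : ℤ} (hF : Flat δ C a b) (c : ℕ) {D : Finset Square} (hD : D ∈ C) {v : ℤ}
    (h1 : a ≤ v) (h2 : v ≤ b) (h : ((v, H δ v - 1 - 2 * c) : Square) ∈ D) {w : ℤ} (h3 : a ≤ w)
    (h4 : w ≤ b) : ((w, H δ w - 1 - 2 * c) : Square) ∈ D := by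
  have k := Conf.square hb hC hD h
  dsimp only at k
  obtain ⟨E, hE, hm⟩ := Conf.exists_mem hb hC (v := v) (j := H δ v - 1) k.1 k.2.1
    (by omega) (by omega) (by omega)
  exact hR.chain hb hC hE hD c hm h (hF E hE v h1 h2 hm w h3 h4)

omit hb hR in
lemma flat_of_all {a b : ℤ} {D : Finset Square} (hD : D ∈ C)
    (h : ∀ v, a ≤ v → v ≤ b → ((v, H δ v - 1) : Square) ∈ D) : Flat δ C a b := by
  intro E hE v h1 h2 hm w h3 h4
  rw [Conf.eq_of_mem hC hE hD hm (h v h1 h2)]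
  exact h w h3 h4

omit hb hC hR in
lemma flat_of_none {a b : ℤ}
    (h : ∀ v, a ≤ v → v ≤ b → ∀ D ∈ C, ((v, H δ v - 1) : Square) ∉ D) : Flat δ C a b :=
  fun E hE v h1 h2 hm => absurd hm (h v h1 h2 E hE)

omit hR in
/-- A strip just below `δ` in column `z`, where `δ` has a `+` step, stays just below `δ` in the
preceding column. -/
lemma extend_left {D : Finset Square} (hD : D ∈ C) {a b z : ℤ} {h : ℤ → ℤ}
    (S : Strip α.length D a b h) (hz : H δ (z - 1) = H δ z - 1) (hm : ((z, H δ z - 1) : Square) ∈ D)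
    (ha : a < z) : h (z - 1) = H δ (z - 1) - 1 ∧ ((z - 1, H δ (z - 1) - 1) : Square) ∈ D := by
  obtain ⟨k1, k2, k3⟩ := (S.mem _).1 hm
  dsimp only at k1 k2 k3
  have m := S.mem_of (v := z - 1) (by omega) (by omega)
  have sq := Conf.square hb hC hD m
  dsimp only at sq
  have st := S.step (z - 1) (by omega) (by omega)
  rw [sub_add_cancel] at st
  have e : h (z - 1) = H δ (z - 1) - 1 := by omega
  rw [e] at m
  exact ⟨e, m⟩

omit hR in
lemma extend_right {D : Finset Square} (hD : D ∈ C) {a b z : ℤ} {h : ℤ → ℤ}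
    (S : Strip α.length D a b h) (hz : H δ (z + 1) = H δ z - 1) (hm : ((z, H δ z - 1) : Square) ∈ D)
    (hb' : z < b) : h (z + 1) = H δ (z + 1) - 1 ∧ ((z + 1, H δ (z + 1) - 1) : Square) ∈ D := by
  obtain ⟨k1, k2, k3⟩ := (S.mem _).1 hm
  dsimp only at k1 k2 k3
  have m := S.mem_of (v := z + 1) (by omega) (by omega)
  have sq := Conf.square hb hC hD m
  dsimp only at sq
  have st := S.step z (by omega) (by omega)
  have e : h (z + 1) = H δ (z + 1) - 1 := by omega
  rw [e] at m
  exact ⟨e, m⟩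

omit hR in
lemma square_right_of_plus {z : ℤ} (h0 : 1 ≤ z) (h1 : z ≤ α.length)
    (hz : H δ (z - 1) = H δ z - 1) {D : Finset Square} (hD : D ∈ C)
    (hm : ((z - 1, H δ (z - 1) - 1) : Square) ∈ D) : ∃ E ∈ C, ((z, H δ z - 1) : Square) ∈ E := by
  have sq := Conf.square hb hC hD hm
  dsimp only at sq
  have st := step_cases α h0 h1
  exact Conf.exists_mem hb hC h0 h1 (by omega) (by omega) (by omega)

omit hR in
lemma square_left_of_minus {z : ℤ} (h0 : 1 ≤ z) (h1 : z < α.length)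
    (hz : H δ (z + 1) = H δ z - 1) {D : Finset Square} (hD : D ∈ C)
    (hm : ((z + 1, H δ (z + 1) - 1) : Square) ∈ D) : ∃ E ∈ C, ((z, H δ z - 1) : Square) ∈ E := by
  have sq := Conf.square hb hC hD hm
  dsimp only at sq
  have st := H_step α (v := z) (by omega) h1
  exact Conf.exists_mem hb hC h0 (by omega) (by omega) (by omega) (by omega)

omit hR in
-- A strip along `δ` on `[z, e]` that began at `z` would have to stop at `e`, on pain of going below
-- its start, and would be the excluded segment. So it begins earlier and is lower at `z - 1`. It is
-- then not level at `e`, and as `e` is not the last column, it goes on to `e + 1`.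
lemma flat_matched {z e : ℤ} (h0 : 1 ≤ z) (hze : z ≤ e) (heN : e < α.length)
    (hF : Flat δ C z e) (hz : H δ (z - 1) = H δ z - 1) (he : H δ (e + 1) = H δ e - 1)
    (hee : H δ e = H δ z) (hs : seg δ z e 0 ∉ C) : Flat δ C (z - 1) (e + 1) := by
  by_cases ht : ∃ D ∈ C, ((z, H δ z - 1) : Square) ∈ D
  · obtain ⟨D, hD, hm⟩ := ht
    have hall := hF D hD z le_rfl hze hm
    have hme := hall e hze le_rfl
    obtain ⟨a, b, h, S⟩ := ((mem_Conf.1 hC).1 D hD).strip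
    obtain ⟨k1, -, k3⟩ := (S.mem _).1 hm
    obtain ⟨-, q2, q3⟩ := (S.mem _).1 hme
    dsimp only at k1 k3 q2 q3
    have haz : a < z := by
      rcases k1.lt_or_eq with h1 | rfl
      · exact h1
      · exfalso
        rcases q2.lt_or_eq with h2 | rfl
        · have := (extend_right hb hC hD S he hme h2).1
          have := S.low (e + 1) (by omega) (by omega)
          omega
        · exact hs (S.eq_seg (c := 0) (by simpa using hall) ▸ hD)
    have hl := extend_left hb hC hD S hz hm haz
    have heb : e < b := by
      rcases q2.lt_or_eq with h2 | rfl
      · exact h2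
      · have := S.low (z - 1) (by omega) (by omega)
        rcases S.anchored with h3 | h3 <;> omega
    have hr := extend_right hb hC hD S he hme heb
    refine flat_of_all hC hD fun v h1 h2 => ?_
    rcases (show v = z - 1 ∨ v = e + 1 ∨ (z ≤ v ∧ v ≤ e) by omega) with rfl | rfl | ⟨h3, h4⟩
    · exact hl.2
    · exact hr.2
    · exact hall v h3 h4
  · refine flat_of_none fun v h1 h2 D hD hm => ht ?_
    rcases (show v = z - 1 ∨ v = e + 1 ∨ (z ≤ v ∧ v ≤ e) by omega) with rfl | rfl | ⟨h3, h4⟩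
    · exact square_right_of_plus hb hC h0 (by omega) hz hD hm
    · obtain ⟨E, hE, hm'⟩ := square_left_of_minus hb hC (by omega) heN he hD hm
      exact ⟨E, hE, hF E hE e hze le_rfl hm' z le_rfl hze⟩
    · exact ⟨D, hD, hF D hD v h3 h4 hm z le_rfl hze⟩

omit hR in
-- As in `flat_matched`, but the strip reaches the last column and only its left end matters.
lemma flat_last {z : ℤ} (h0 : 1 ≤ z) (hzN : z ≤ α.length)
    (hF : Flat δ C z α.length) (hz : H δ (z - 1) = H δ z - 1)
    (hs : seg δ z α.length 0 ∉ C) : Flat δ C (z - 1) α.length := by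
  by_cases ht : ∃ D ∈ C, ((z, H δ z - 1) : Square) ∈ D
  · obtain ⟨D, hD, hm⟩ := ht
    have hall := hF D hD z le_rfl hzN hm
    have hme := hall _ hzN le_rfl
    obtain ⟨a, b, h, S⟩ := ((mem_Conf.1 hC).1 D hD).strip
    obtain ⟨k1, -, k3⟩ := (S.mem _).1 hm
    obtain ⟨-, q2, q3⟩ := (S.mem _).1 hme
    have sqb := (Conf.square hb hC hD (S.mem_of S.le le_rfl)).2.1
    dsimp only at k1 k3 q2 q3 sqb
    have haz : a < z := by
      rcases k1.lt_or_eq with h1 | rfl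
      · exact h1
      · have : b = α.length := by omega
        subst this
        exact absurd (S.eq_seg (c := 0) (by simpa using hall) ▸ hD) hs
    have hl := extend_left hb hC hD S hz hm haz
    refine flat_of_all hC hD fun v h1 h2 => ?_
    rcases (show v = z - 1 ∨ z ≤ v by omega) with rfl | h3
    · exact hl.2
    · exact hall v h3 h2
  · refine flat_of_none fun v h1 h2 D hD hm => ht ?_
    rcases (show v = z - 1 ∨ z ≤ v by omega) with rfl | h3
    · exact square_right_of_plus hb hC h0 (by omega) hz hD hm
    · exact ⟨D, hD, hF D hD v h3 h2 hm z le_rfl hzN⟩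

/-- Let `U` be the strip just below `δ` in column `y`. If it begins before `y`, it contains the
squares on `[z, y - 1]`, and the parity of `l'` prevents it from beginning at `z`. If it begins at
`y`, its odd `l'` requires a twin below it, and the strip `V` directly under `U` must then begin at
`y` as well. The strip along `δ` on `[z, y - 1]` can therefore neither continue to `y` nor begin
before `z`, and the three excluded strips occur. -/
lemma flat_pair {z y : ℤ} (h0 : 1 ≤ z) (hzy : z < y) (hyN : y ≤ α.length)
    (hF : Flat δ C z (y - 1)) (hF' : Flat δ C y α.length) (hz : H δ (z - 1) = H δ z - 1)
    (hy : H δ (y - 1) = H δ y - 1) (hzy' : H δ (y - 1) = H δ z)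
    (hodd : Odd (H δ α.length - H δ y)) (hlow : H δ y ≤ H δ α.length)
    (hs : ¬ (seg δ z (y - 1) 0 ∈ C ∧ seg δ y α.length 0 ∈ C ∧ seg δ y α.length 1 ∈ C)) :
    Flat δ C (z - 1) α.length := by
  have hzy1 : z ≤ y - 1 := by omega
  by_cases ht : ∃ U ∈ C, ((y, H δ y - 1) : Square) ∈ U
  · obtain ⟨U, hU, hm⟩ := ht
    have hall := hF' U hU y le_rfl hyN hm
    have hme := hall _ hyN le_rfl
    obtain ⟨a, b, h, S⟩ := ((mem_Conf.1 hC).1 U hU).strip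
    obtain ⟨k1, -, k3⟩ := (S.mem _).1 hm
    obtain ⟨-, q2, q3⟩ := (S.mem _).1 hme
    have sqb := (Conf.square hb hC hU (S.mem_of S.le le_rfl)).2.1
    dsimp only at k1 k3 q2 q3 sqb
    have hbN : b = α.length := by omega
    subst hbN
    rcases k1.lt_or_eq with hay | rfl
    · have hl := extend_left hb hC hU S hy hm hay
      have hall' := hF U hU (y - 1) hzy1 le_rfl hl.2
      have hmz := hall' z le_rfl hzy1
      obtain ⟨r1, -, r3⟩ := (S.mem _).1 hmz
      dsimp only at r1 r3
      have haz : a < z := by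
        rcases r1.lt_or_eq with h1 | rfl
        · exact h1
        · have := hR.parity hU S (by omega)
          rw [Int.odd_iff] at this hodd
          omega
      have hl' := extend_left hb hC hU S hz hmz haz
      refine flat_of_all hC hU fun v h1 h2 => ?_
      rcases (show v = z - 1 ∨ (z ≤ v ∧ v ≤ y - 1) ∨ y ≤ v by omega) with rfl | ⟨h3, h4⟩ | h3
      · exact hl'.2
      · exact hall' v h3 h4
      · exact hall v h3 h2
    · exfalso
      have hUs : seg δ a α.length 0 ∈ C := S.eq_seg (c := 0) (by simpa using hall) ▸ hU
      have hne : h α.length ≠ h a := by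
        rw [Int.odd_iff] at hodd
        omega
      obtain ⟨U', hU', hU'U, h', S'⟩ := hR.exists_other hC hU S hne
      have hm' := S'.mem_of le_rfl hyN
      have sq' := Conf.square hb hC hU' hm'
      have sq := Conf.square hb hC hU hm
      dsimp only at sq' sq
      have hlt : h' a ≠ H δ a - 1 := by
        intro e
        rw [e] at hm'
        exact hU'U (Conf.eq_of_mem hC hU' hU hm' hm)
      obtain ⟨V, hV, hmV⟩ := Conf.exists_mem hb hC (v := a) (j := H δ a - 1 - 2 * (1 : ℕ))
        sq.1 sq.2.1 (by push_cast; omega) (by push_cast; omega) (by push_cast; omega)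
      have hallV := fun w h1 h2 => hF'.level hb hC hR 1 hV le_rfl hyN hmV (w := w) h1 h2
      obtain ⟨a1, b1, h1, S1⟩ := ((mem_Conf.1 hC).1 V hV).strip
      obtain ⟨r1, -, r3⟩ := (S1.mem _).1 hmV
      obtain ⟨-, r2, -⟩ := (S1.mem _).1 (hallV _ hyN le_rfl)
      have sqb1 := (Conf.square hb hC hV (S1.mem_of S1.le le_rfl)).2.1
      dsimp only at r1 r2 sqb1
      have hb1 : b1 = α.length := by omega
      subst hb1
      -- By `RuleI.chain` the twin `U'`, which is at or below the level of `V`, would extend as far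
      -- to the left as `V`; but it begins at `a`.
      have ha1 : a1 = a := by
        by_contra hne1
        have m := S1.mem_of (v := a - 1) (by omega) (by omega)
        have := hR.chain hb hC hV hU' (n := ((H δ a - 3 - h' a) / 2).toNat) hmV
          (by convert hm' using 2; push_cast; omega) m
        have := ((S'.mem _).1 this).1
        dsimp only at this
        omega
      subst ha1
      have hVs : seg δ a1 α.length 1 ∈ C :=
        S1.eq_seg (c := 1) (by simpa using hallV) ▸ hV
      have sqV := Conf.square hb hC hV hmV
      have stα := step_cases α (v := a1) (by omega) (by omega)
      dsimp only at sqV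
      push_cast at sqV
      obtain ⟨D, hD, hmD⟩ := Conf.exists_mem hb hC (v := a1 - 1) (j := H δ (a1 - 1) - 1)
        (by omega) (by omega) (by omega) (by omega) (by omega)
      have hallD := hF D hD (a1 - 1) hzy1 le_rfl hmD
      have hmz := hallD z le_rfl hzy1
      obtain ⟨a2, b2, h2, S2⟩ := ((mem_Conf.1 hC).1 D hD).strip
      obtain ⟨-, t2, t3⟩ := (S2.mem _).1 hmD
      obtain ⟨u1, -, u3⟩ := (S2.mem _).1 hmz
      dsimp only at t2 t3 u1 u3
      have hb2 : b2 = a1 - 1 := by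
        by_contra hne2
        have m := S2.mem_of (v := a1) (by omega) (by omega)
        have st := S2.step (a1 - 1) (by omega) (by omega)
        rw [sub_add_cancel] at st
        rcases st with st | st
        · rw [show h2 a1 = H δ a1 - 1 by omega] at m
          rw [Conf.eq_of_mem hC hD hU m hm] at hmD
          have := ((S.mem _).1 hmD).1
          dsimp only at this
          omega
        · rw [show h2 a1 = H δ a1 - 1 - 2 * (1 : ℕ) by push_cast; omega] at m
          rw [Conf.eq_of_mem hC hD hV m hmV] at hmD
          have := ((S1.mem _).1 hmD).1
          dsimp only at this
          omega
      subst hb2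
      have ha2 : a2 = z := by
        rcases u1.lt_or_eq with h5 | h5
        · have := (extend_left hb hC hD S2 hz hmz h5).1
          have := S2.low (z - 1) (by omega) (by omega)
          rcases S2.anchored with h6 | h6 <;> omega
        · exact h5
      subst ha2
      exact hs ⟨S2.eq_seg (c := 0) (by simpa using hallD) ▸ hD, hUs, hVs⟩
  · refine flat_of_none fun v h1 h2 D hD hm => ht ?_
    have hy1 : ∀ D ∈ C, ((y - 1, H δ (y - 1) - 1) : Square) ∈ D →
        ∃ U ∈ C, ((y, H δ y - 1) : Square) ∈ U := fun D hD hm =>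
      square_right_of_plus hb hC (by omega) hyN hy hD hm
    rcases (show v = z - 1 ∨ (z ≤ v ∧ v ≤ y - 1) ∨ y ≤ v by omega) with rfl | ⟨h3, h4⟩ | h3
    · obtain ⟨E, hE, hm'⟩ := square_right_of_plus hb hC h0 (by omega) hz hD hm
      exact hy1 E hE (hF E hE z le_rfl hzy1 hm' _ hzy1 le_rfl)
    · exact hy1 D hD (hF D hD v h3 h4 hm _ hzy1 le_rfl)
    · exact ⟨D, hD, hF' D hD v h3 h2 hm y le_rfl hyN⟩

end RuleI

end BallotStrip

/-! ### Rule I: existence of a removable group. -/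

namespace BallotStrip

/-- The partner of an unmatched `+` step: the next unmatched `+` step to the right. -/
lemma exists_partner {γ : Path} {z : ℤ} (hz : IsPlus γ z) (h1 : 1 ≤ lp γ z) :
    ∃ y, z < y ∧ IsPlus γ y ∧ lp γ y + 1 = lp γ z ∧ H γ (y - 1) = H γ z ∧
      ∀ u, y ≤ u → u ≤ γ.length → H γ y ≤ H γ u := by
  obtain ⟨hc, e⟩ := cov_of_lp h1
  obtain ⟨p, ⟨p1, p2, p3⟩, hmax⟩ := Int.exists_greatest_of_bdd
    (P := fun v => z ≤ v ∧ v ≤ γ.length ∧ H γ v = H γ z) ⟨γ.length, fun v hv => hv.2.1⟩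
    ⟨z, le_rfl, hz.2.1, rfl⟩
  have z1 := hz.1
  have pN : p < γ.length := by
    rcases p2.lt_or_eq with h | h
    · exact h
    · rw [h] at p3; omega
  have hup : ∀ u, p + 1 ≤ u → u ≤ γ.length → H γ z + 1 ≤ H γ u := by
    intro u k1 k2
    have k3 := hc.2.2 u (by omega) k2
    have k4 : H γ u ≠ H γ z := fun k => by
      have := hmax u ⟨by omega, k2, k⟩
      omega
    omega
  have k1 := hup (p + 1) le_rfl (by omega)
  have k2 := H_step γ (v := p) (by omega) pN
  have hy : H γ (p + 1) = H γ z + 1 := by omega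
  have hcy : Cov γ (p + 1) γ.length :=
    ⟨by omega, le_rfl, fun u k1 k2 => by have := hup u k1 k2; omega⟩
  refine ⟨p + 1, by omega, ⟨by omega, by omega, by rw [add_sub_cancel_right]; omega⟩, ?_,
    by rw [add_sub_cancel_right]; exact p3, hcy.2.2⟩
  have : lp γ (p + 1) = H γ γ.length - H γ (p + 1) := by
    unfold lp
    rw [if_pos hcy]
  omega

/-- Of two unmatched `+` steps the one further right ends strictly higher, so a positive `lp`
identifies the step. -/
lemma partner_unique {γ : Path} {y y' : ℤ} (hy : IsPlus γ y) (hy' : IsPlus γ y')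
    (h : lp γ y = lp γ y') (h1 : 1 ≤ lp γ y) : y = y' := by
  obtain ⟨c, e⟩ := cov_of_lp h1
  obtain ⟨c', e'⟩ := cov_of_lp (h ▸ h1 : 1 ≤ lp γ y')
  by_contra hne
  rcases lt_or_gt_of_ne hne with k | k
  · have := (c.mono k.le c'.1).lt hy' k
    omega
  · have := (c'.mono k.le c.1).lt hy k
    omega

/-- The strips of a Rule I configuration follow the upper path `δ` below the parts of it which are
parallel to ballot paths of `γ` without removable groups of steps. -/
lemma flat_of {α δ γ : Path} (hb : Below α δ) (hγ : γ.length = δ.length)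
    {C : Finset (Finset Square)} (hC : C ∈ Conf α δ) (hR : RuleI C) (k : ℤ) {x b : ℤ} (hx : 0 ≤ x)
    (hxb : x ≤ b) (hbN : b ≤ γ.length) (hlow : ∀ v, x ≤ v → v ≤ b → H γ x ≤ H γ v)
    (hpar : ∀ v, x ≤ v → v ≤ b → H δ v = H γ v - k)
    (hfin : H γ b = H γ x ∨ b = γ.length ∧ Odd (H γ γ.length - H γ x))
    (hrem : ∀ z, x < z → z ≤ b → IsPlus γ z → Even (lp γ z) → ¬ Rem γ δ C z) :
    Flat δ C x b := by
  obtain ⟨n, hn⟩ : ∃ n : ℕ, b - x ≤ n := ⟨(b - x).toNat, by omega⟩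
  have hN := hb.1
  induction n generalizing x b with
  | zero =>
    have : b = x := by push_cast at hn; omega
    subst this
    intro D hD v h1 h2 hm w h3 h4
    rwa [show w = v by omega]
  | succ n ih =>
    push_cast at hn
    rcases hxb.lt_or_eq with hlt | rfl
    swap
    · intro D hD v h1 h2 hm w h3 h4
      rwa [show w = v by omega]
    have st := H_step γ (v := x) hx (by omega)
    have l1 := hlow (x + 1) (by omega) (by omega)
    have up1 : H γ (x + 1) = H γ x + 1 := by omega
    have hz : IsPlus γ (x + 1) := ⟨by omega, by omega, by rw [add_sub_cancel_right, up1]⟩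
    obtain ⟨e, he⟩ := exists_ext (γ := γ) (x := x + 1) (by omega) (by omega)
    have hle := he.le
    have pz := hpar (x + 1) (by omega) (by omega)
    have px := hpar x le_rfl hxb
    have dz : H δ (x + 1 - 1) = H δ (x + 1) - 1 := by rw [add_sub_cancel_right]; omega
    -- First-return decomposition. Either the match `e + 1` of the first step is at most `b`, and
    -- two shorter stretches are glued along column `e + 1`; or the first step has no match up to
    -- `b`, which forces `b` to be the last column.
    by_cases heb : e < b
    · have h1 := he.eq_of_lt (by omega) (by omega)
      have h2 : H γ (e + 1) = H γ (x + 1) - 1 := by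
        rcases he.fin with h | h
        · omega
        · exact h.2
      have hlp : lp γ (x + 1) = 0 := by rw [he.lp_eq (by omega)]; omega
      have pe := hpar e (by omega) (by omega)
      have pe1 := hpar (e + 1) (by omega) (by omega)
      have F1 : Flat δ C (x + 1) e :=
        ih (by omega) hle (by omega) (fun v k1 k2 => he.low v k1 k2)
          (fun v k1 k2 => hpar v (by omega) (by omega)) (Or.inl h1)
          (fun z k1 k2 => hrem z (by omega) (by omega)) (by omega)
      have F2 : Flat δ C (e + 1) b :=
        ih (by omega) (by omega) hbN
          (fun v k1 k2 => by have := hlow v (by omega) k2; omega)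
          (fun v k1 k2 => hpar v (by omega) (by omega))
          (by rw [show H γ (e + 1) = H γ x by omega]; exact hfin)
          (fun z k1 k2 => hrem z (by omega) (by omega)) (by omega)
      have hs : seg δ (x + 1) e 0 ∉ C := fun hs =>
        hrem (x + 1) (by omega) (by omega) hz (by simp [hlp]) (Or.inl ⟨hlp, e, he, hs⟩)
      have F3 := flat_matched hb hC (by omega) hle (by omega) F1 dz (by omega) (by omega) hs
      rw [add_sub_cancel_right] at F3
      intro D hD v k1 k2 hm w k3 k4
      have hme : ((e + 1, H δ (e + 1) - 1) : Square) ∈ D := by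
        rcases le_total v (e + 1) with k5 | k5
        · exact F3 D hD v k1 k5 hm (e + 1) (by omega) le_rfl
        · exact F2 D hD v k5 k2 hm (e + 1) le_rfl (by omega)
      rcases le_total w (e + 1) with k5 | k5
      · exact F3 D hD (e + 1) (by omega) le_rfl hme w k3 k5
      · exact F2 D hD (e + 1) le_rfl (by omega) hme w k5 k4
    · have hb1 := he.low b (by omega) (by omega)
      obtain ⟨rfl, hodd⟩ : b = γ.length ∧ Odd (H γ γ.length - H γ x) := by
        rcases hfin with h | h
        · omega
        · exact h
      have heN : e = γ.length := by have := he.le_len; omega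
      subst heN
      have hlp := he.lp_eq (by omega)
      have heven : Even (lp γ (x + 1)) := by
        rw [Int.odd_iff] at hodd
        rw [Int.even_iff]
        omega
      have hnr := hrem (x + 1) (by omega) (by omega) hz heven
      have hα : (γ.length : ℤ) = α.length := by omega
      rcases (lp_nonneg γ (x + 1)).lt_or_eq with hpos | h0
      · have hodd' : 2 ≤ lp γ (x + 1) := by
          rw [Int.even_iff] at heven
          omega
        obtain ⟨y, hzy, hy, hy1, hy2, hy3⟩ := exists_partner hz (by omega)
        have y3 := hy.2.2
        have yN := hy.2.1
        have py := hpar y (by omega) yN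
        have py' := hpar (y - 1) (by omega) (by omega)
        have pN := hpar γ.length (by omega) le_rfl
        have hlow' := hy3 γ.length (by omega) le_rfl
        have hoddy : Odd (H γ γ.length - H γ y) := by
          rw [Int.odd_iff] at *
          omega
        have F1 : Flat δ C (x + 1) (y - 1) :=
          ih (by omega) (by omega) (by omega) (fun v k1 k2 => he.low v k1 (by omega))
            (fun v k1 k2 => hpar v (by omega) (by omega)) (Or.inl hy2)
            (fun z k1 k2 => hrem z (by omega) (by omega)) (by omega)
        have F2 : Flat δ C y γ.length :=
          ih (by omega) (by omega) le_rfl hy3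
            (fun v k1 k2 => hpar v (by omega) (by omega)) (Or.inr ⟨rfl, hoddy⟩)
            (fun z k1 k2 => hrem z (by omega) (by omega)) (by omega)
        have hs : ¬ (seg δ (x + 1) (y - 1) 0 ∈ C ∧ seg δ y γ.length 0 ∈ C ∧
            seg δ y γ.length 1 ∈ C) := fun ⟨s1, s2, s3⟩ =>
          hnr (Or.inr ⟨hodd', y, hy, hy1, s1, s2, s3⟩)
        rw [hα] at F2 hs pN hoddy hlow'
        have := flat_pair hb hC hR (by omega) hzy (by omega) F1 F2 dz (by omega) (by omega)
          (by rw [pN, py]; rw [Int.odd_iff] at hoddy ⊢; omega) (by omega) hs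
        rw [add_sub_cancel_right] at this
        rw [hα]
        exact this
      · have F1 : Flat δ C (x + 1) γ.length :=
          ih (by omega) hle le_rfl (fun v k1 k2 => he.low v k1 k2)
            (fun v k1 k2 => hpar v (by omega) (by omega)) (Or.inl (by omega))
            (fun z k1 k2 => hrem z (by omega) (by omega)) (by omega)
        have hs : seg δ (x + 1) γ.length 0 ∉ C := fun hs =>
          hnr (Or.inl ⟨h0.symm, γ.length, he, hs⟩)
        rw [hα] at F1 hs
        have := flat_last hb hC (by omega) (by omega) F1 dz hs
        rw [add_sub_cancel_right] at this
        rw [hα]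
        exact this

/-- In the first column `v` where the paths differ there is one square, just below `γ`, and column
`v - 1` is empty. Without removable groups, `flat_of` would push a strip into column `v - 1` if `lp
γ v` is even. If it is odd, there is a strip from `v` to the last column with odd `l'`, whose twin
would need a second square in column `v`. -/
lemma exists_rem {α γ : Path} (hb : Below α γ) (hne : α ≠ γ) {C : Finset (Finset Square)}
    (hC : C ∈ Conf α γ) (hR : RuleI C) : ∃ z, IsPlus γ z ∧ Even (lp γ z) ∧ Rem γ γ C z := by
  by_contra hno
  push Not at hno
  have hN := hb.1
  obtain ⟨v, ⟨v0, v1, v2⟩, hmin⟩ := Int.exists_least_of_bdd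
    (P := fun v => 0 ≤ v ∧ v ≤ γ.length ∧ H α v ≠ H γ v) ⟨0, fun v hv => hv.1⟩ (by
      by_contra h
      push Not at h
      exact hne (path_ext hN fun v k1 k2 => h v k1 (by omega)))
  have hv : 1 ≤ v := by
    rcases v0.lt_or_eq with h | rfl
    · omega
    · simp [H_zero] at v2
  have hprev : H α (v - 1) = H γ (v - 1) := by
    by_contra h
    have := hmin (v - 1) ⟨by omega, by omega, h⟩
    omega
  have hle := hb.le v0 (by omega)
  have s1 := step_cases γ hv v1
  have s2 := step_cases α hv (by omega)
  have up : H γ v = H γ (v - 1) + 1 := by omega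
  have hvP : IsPlus γ v := ⟨hv, v1, up⟩
  obtain ⟨c, hc0, hc1, hc⟩ := H_parity γ (v := v) v0 v1
  obtain ⟨D, hD, hm⟩ := Conf.exists_mem hb hC (v := v) (j := H γ v - 1) hv (by omega)
    (by omega) (by omega) (by omega)
  have hcol : ∀ D ∈ C, ∀ j, ((v - 1, j) : Square) ∉ D := by
    intro D hD j hj
    have := Conf.square hb hC hD hj
    dsimp only at this
    omega
  obtain ⟨e, he⟩ := exists_ext (γ := γ) v0 v1
  have hlp := he.lp_eq v0
  have hve := he.le
  have heN := he.le_len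
  rcases Int.even_or_odd (lp γ v) with hev | hod
  · have key : ∀ b, v ≤ b → b ≤ γ.length →
        (H γ b = H γ (v - 1) ∨ b = γ.length ∧ Odd (H γ γ.length - H γ (v - 1))) →
        (∀ u, v ≤ u → u ≤ b → H γ (v - 1) ≤ H γ u) → False := by
      intro b k1 k2 k3 k4
      have F := flat_of hb rfl hC hR 0 (x := v - 1) (b := b) (by omega) (by omega) k2
        (fun u q1 q2 => by
          rcases (show u = v - 1 ∨ v ≤ u by omega) with rfl | q3
          · exact le_rfl
          · exact k4 u q3 q2)
        (fun u _ _ => by simp) k3 (fun z _ _ q1 q2 => hno z q1 q2)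
      exact hcol D hD _ (F D hD v (by omega) k1 hm (v - 1) le_rfl (by omega))
    rcases he.fin with h | ⟨h, h'⟩
    · refine key e hve heN (Or.inr ⟨h, ?_⟩) fun u k1 k2 => ?_
      · rw [← h]
        rw [Int.even_iff] at hev
        rw [Int.odd_iff]
        omega
      · have := he.low u k1 k2
        omega
    · refine key (e + 1) (by omega) (by omega) (Or.inl (by omega)) fun u k1 k2 => ?_
      rcases (show u ≤ e ∨ u = e + 1 by omega) with k3 | rfl
      · have := he.low u k1 k3
        omega
      · omega
  · have hpos : 1 ≤ lp γ v := by
      have := lp_nonneg γ v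
      rw [Int.odd_iff] at hod
      omega
    obtain ⟨hcov, hlp'⟩ := cov_of_lp hpos
    have F := flat_of hb rfl hC hR 0 v0 v1 le_rfl hcov.2.2 (fun u _ _ => by simp)
      (Or.inr ⟨rfl, hlp' ▸ hod⟩) (fun z _ _ q1 q2 => hno z q1 q2)
    have hmN := F D hD v le_rfl v1 hm γ.length v1 le_rfl
    obtain ⟨a, b, h, S⟩ := ((mem_Conf.1 hC).1 D hD).strip
    obtain ⟨k1, -, k3⟩ := (S.mem _).1 hm
    obtain ⟨-, q2, q3⟩ := (S.mem _).1 hmN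
    have sqb := (Conf.square hb hC hD (S.mem_of S.le le_rfl)).2.1
    dsimp only at k1 k3 q2 q3 sqb
    have ha : a = v := by
      by_contra hne'
      exact hcol D hD _ (S.mem_of (v := v - 1) (by omega) (by omega))
    have hbN : b = γ.length := by omega
    subst ha hbN
    obtain ⟨D', hD', hD'D, h', S'⟩ := hR.exists_other hC hD S (by omega)
    have hm' := S'.mem_of le_rfl hcov.1
    have sq := Conf.square hb hC hD' hm'
    dsimp only at sq
    rw [show h' a = H γ a - 1 by omega] at hm'
    exact hD'D (Conf.eq_of_mem hC hD' hD hm' hm)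

end BallotStrip

/-! ### Adding and removing strips at the upper rim of a Rule I configuration. -/

namespace BallotStrip

open LaurentPolynomial

/-- The number of strips of each length satisfies the parity condition of Rule I. -/
def Balanced (C : Finset (Finset Square)) : Prop := by
  classical exact ∀ l l' : ℕ, 1 ≤ l' →
    (Odd l' → Even (C.filter fun D => HasLength D l l').card) ∧
    (Even l' → (C.filter fun D => HasLength D l l').card = 0)

/-- If some square of `D` is just below a square of `D'`, then all squares just below `D'` belong
to `D`. -/
def Under (D D' : Finset Square) : Prop := (∃ s ∈ D', down s ∈ D) → ∀ s ∈ D', down s ∈ D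

lemma ruleI_iff {C : Finset (Finset Square)} :
    RuleI C ↔ (∀ D ∈ C, ∀ D' ∈ C, Under D D') ∧ Balanced C := by
  unfold RuleI Balanced Under
  exact Iff.rfl

lemma Balanced.union {C E : Finset (Finset Square)} [DecidableEq (Finset Square)]
    (hC : Balanced C) (hE : Balanced E) (h : Disjoint C E) : Balanced (C ∪ E) := by
  classical
  intro l l' hl
  have e : ((C ∪ E).filter fun D => HasLength D l l').card =
      (C.filter fun D => HasLength D l l').card + (E.filter fun D => HasLength D l l').card := by
    rw [Finset.filter_union]
    exact Finset.card_union_of_disjoint (Finset.disjoint_filter_filter h)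
  constructor
  · intro ho
    have : Even ((C ∪ E).filter fun D => HasLength D l l').card := by
      rw [e]
      exact Even.add (by convert (hC l l' hl).1 ho) (by convert (hE l l' hl).1 ho)
    convert this
  · intro he
    have h1 := (hC l l' hl).2 he
    have h2 := (hE l l' hl).2 he
    have : (C.filter fun D => HasLength D l l').card + (E.filter fun D => HasLength D l l').card
      = 0 := by rw [show (C.filter fun D => HasLength D l l').card = 0 by convert h1,
        show (E.filter fun D => HasLength D l l').card = 0 by convert h2]
    convert e.trans this

lemma Balanced.sdiff {C E : Finset (Finset Square)} [DecidableEq (Finset Square)]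
    (hC : Balanced C) (hE : Balanced E) (h : E ⊆ C) : Balanced (C \ E) := by
  classical
  intro l l' hl
  have e : ((C \ E).filter fun D => HasLength D l l').card +
      (E.filter fun D => HasLength D l l').card = (C.filter fun D => HasLength D l l').card := by
    rw [← Finset.card_union_of_disjoint (Finset.disjoint_filter_filter Finset.sdiff_disjoint),
      ← Finset.filter_union, Finset.sdiff_union_of_subset h]
  constructor
  · intro ho
    have h1 := (hC l l' hl).1 ho
    have h2 := (hE l l' hl).1 ho
    rw [Nat.even_iff] at *
    have h1' : (C.filter fun D => HasLength D l l').card % 2 = 0 := by convert h1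
    have h2' : (E.filter fun D => HasLength D l l').card % 2 = 0 := by convert h2
    have : ((C \ E).filter fun D => HasLength D l l').card % 2 = 0 := by omega
    convert this
  · intro he
    have h1 := (hC l l' hl).2 he
    have h1' : (C.filter fun D => HasLength D l l').card = 0 := by convert h1
    have : ((C \ E).filter fun D => HasLength D l l').card = 0 := by omega
    convert this

/-- The strips in `E` fill the region between the paths `δ` and `δ'`. -/
structure NewStrips (N : ℕ) (δ δ' : Path) (E : Finset (Finset Square)) : Prop where
  len : δ.length = N
  len' : δ'.length = N
  le : ∀ v : ℤ, 0 ≤ v → v ≤ N → H δ v ≤ H δ' v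
  strip : ∀ D ∈ E, ∃ a b h, Strip N D a b h
  disj : ∀ D ∈ E, ∀ D' ∈ E, ∀ s ∈ D, s ∈ D' → D = D'
  mem : ∀ D ∈ E, ∀ s ∈ D, 1 ≤ s.1 ∧ s.1 ≤ N ∧ (s.1 + s.2) % 2 = 1 ∧ H δ s.1 < s.2 ∧ s.2 < H δ' s.1
  cover : ∀ s : Square, 1 ≤ s.1 → s.1 ≤ N → (s.1 + s.2) % 2 = 1 → H δ s.1 < s.2 →
    s.2 < H δ' s.1 → ∃ D ∈ E, s ∈ D
  under : ∀ D ∈ E, ∀ D' ∈ E, Under D D'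
  bal : Balanced E
  wt : ∏ D ∈ E, wtI D = T (-1)

namespace NewStrips

variable {N : ℕ} {α δ δ' : Path} {C E : Finset (Finset Square)}

lemma below (hE : NewStrips N δ δ' E) : Below δ δ' := by
  rw [below_iff]
  exact ⟨hE.len.trans hE.len'.symm, fun v h0 h1 => hE.le v h0 (by have := hE.len; omega)⟩

/-- Where `α` exceeded `δ`, the square just above `δ` would lie on a strip of `E`, hence of `C`,
without being above `α`. -/
lemma below_of_subset (hE : NewStrips N δ δ' E) (hb : Below α δ') (hC : C ∈ Conf α δ')
    (h : E ⊆ C) : Below α δ := by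
  have h1 := hE.len
  have h2 := hE.len'
  have h3 := hb.1
  rw [below_iff]
  refine ⟨by omega, fun v h0 hN => ?_⟩
  have k1 := hb.le h0 hN
  by_contra k
  push Not at k
  have hv : v ≠ 0 := by
    rintro rfl
    simp [H_zero] at k
  obtain ⟨c, hc0, hc1, hc⟩ := H_parity δ (v := v) h0 (by omega)
  obtain ⟨d, hd0, hd1, hd⟩ := H_parity δ' (v := v) h0 (by omega)
  obtain ⟨D, hD, hm⟩ := hE.cover (v, H δ v + 1) (by dsimp only; omega) (by dsimp only; omega)
    (by dsimp only; omega) (by dsimp only; omega) (by dsimp only; omega)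
  have := Conf.square hb hC (h hD) hm
  dsimp only at this
  omega

lemma mem_skew_iff (hE : NewStrips N δ δ' E) (hb : Below α δ) {s : Square} :
    s ∈ skew α δ' ↔ s ∈ skew α δ ∨ ∃ D ∈ E, s ∈ D := by
  have h1 := hE.len
  have h2 := hE.len'
  have h3 := hb.1
  rw [mem_skew hb.1, mem_skew (hb.trans hE.below).1]
  constructor
  · rintro ⟨k1, k2, k3, k4, k5⟩
    obtain ⟨c, hc0, hc1, hc⟩ := H_parity δ (v := s.1) (by omega) (by omega)
    by_cases k : s.2 < H δ s.1
    · exact Or.inl ⟨k1, k2, k3, k4, k⟩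
    · exact Or.inr (hE.cover s k1 (by omega) k3 (by omega) k5)
  · rintro (⟨k1, k2, k3, k4, k5⟩ | ⟨D, hD, hs⟩)
    · have := hE.le s.1 (by omega) (by omega)
      exact ⟨k1, k2, k3, k4, by omega⟩
    · obtain ⟨k1, k2, k3, k4, k5⟩ := hE.mem D hD s hs
      have := hb.le (v := s.1) (by omega) (by omega)
      exact ⟨k1, by omega, k3, by omega, k5⟩

lemma notMem_skew (hE : NewStrips N δ δ' E) (hb : Below α δ) {D : Finset Square} (hD : D ∈ E)
    {s : Square} (hs : s ∈ D) : s ∉ skew α δ := by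
  rw [mem_skew hb.1]
  have := hE.mem D hD s hs
  rintro ⟨k1, k2, k3, k4, k5⟩
  omega

lemma disjoint (hE : NewStrips N δ δ' E) (hb : Below α δ) (hC : C ∈ Conf α δ) :
    Disjoint C E := by
  rw [Finset.disjoint_left]
  intro D hD hD'
  obtain ⟨a, b, h, S⟩ := hE.strip D hD'
  have hm := S.mem_of le_rfl S.le
  exact hE.notMem_skew hb hD' hm (((mem_Conf.1 hC).2.2 _).2 ⟨D, hD, hm⟩)

lemma union_mem_Conf [DecidableEq (Finset Square)] (hE : NewStrips N δ δ' E) (hb : Below α δ)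
    (hC : C ∈ Conf α δ) : C ∪ E ∈ Conf α δ' := by
  obtain ⟨c1, c2, c3⟩ := mem_Conf.1 hC
  have h1 := hE.len
  have h3 := hb.1
  rw [mem_Conf]
  refine ⟨fun D hD => ?_, fun D hD D' hD' s hs hs' => ?_, fun s => ?_⟩
  · rcases Finset.mem_union.1 hD with hD | hD
    · exact c1 D hD
    · obtain ⟨a, b, h, S⟩ := hE.strip D hD
      have hN : α.length = N := by omega
      rw [hN]
      exact S.isStrip (α := α) (β := δ') hN.symm (hb.trans hE.below).1 fun s hs =>
        (hE.mem_skew_iff hb).2 (Or.inr ⟨D, hD, hs⟩)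
  · rcases Finset.mem_union.1 hD with hD | hD <;> rcases Finset.mem_union.1 hD' with hD' | hD'
    · exact c2 D hD D' hD' s hs hs'
    · exact absurd ((c3 s).2 ⟨D, hD, hs⟩) (hE.notMem_skew hb hD' hs')
    · exact absurd ((c3 s).2 ⟨D', hD', hs'⟩) (hE.notMem_skew hb hD hs)
    · exact hE.disj D hD D' hD' s hs hs'
  · rw [hE.mem_skew_iff hb, c3 s]
    simp only [Finset.mem_union]
    constructor
    · rintro (⟨D, hD, hs⟩ | ⟨D, hD, hs⟩)
      · exact ⟨D, Or.inl hD, hs⟩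
      · exact ⟨D, Or.inr hD, hs⟩
    · rintro ⟨D, hD | hD, hs⟩
      · exact Or.inl ⟨D, hD, hs⟩
      · exact Or.inr ⟨D, hD, hs⟩

lemma sdiff_mem_Conf [DecidableEq (Finset Square)] (hE : NewStrips N δ δ' E) (hb : Below α δ)
    (hC : C ∈ Conf α δ') (h : E ⊆ C) : C \ E ∈ Conf α δ := by
  obtain ⟨c1, c2, c3⟩ := mem_Conf.1 hC
  rw [mem_Conf]
  refine ⟨fun D hD => c1 D (Finset.mem_sdiff.1 hD).1, fun D hD D' hD' s hs hs' =>
    c2 D (Finset.mem_sdiff.1 hD).1 D' (Finset.mem_sdiff.1 hD').1 s hs hs', fun s => ?_⟩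
  constructor
  · intro hs
    obtain ⟨D, hD, hsD⟩ := (c3 s).1 ((hE.mem_skew_iff hb).2 (Or.inl hs))
    refine ⟨D, Finset.mem_sdiff.2 ⟨hD, fun hDE => ?_⟩, hsD⟩
    exact hE.notMem_skew hb hDE hsD hs
  · rintro ⟨D, hD, hs⟩
    rw [Finset.mem_sdiff] at hD
    rcases (hE.mem_skew_iff hb).1 ((c3 s).2 ⟨D, hD.1, hs⟩) with k | ⟨D', hD', hs'⟩
    · exact k
    · exact absurd (c2 D hD.1 D' (h hD') s hs hs' ▸ hD') hD.2

/-- New strips are above `δ` and old ones below it, so a new strip is never just below an old one.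
The only interaction is the one in `hcross`. -/
lemma union_ruleI [DecidableEq (Finset Square)] (hE : NewStrips N δ δ' E) (hb : Below α δ)
    (hC : C ∈ Conf α δ) (hR : RuleI C) (hcross : ∀ D ∈ C, ∀ D' ∈ E, Under D D') :
    RuleI (C ∪ E) := by
  rw [ruleI_iff] at hR ⊢
  refine ⟨fun D hD D' hD' => ?_, hR.2.union hE.bal (hE.disjoint hb hC)⟩
  rcases Finset.mem_union.1 hD with hD | hD <;> rcases Finset.mem_union.1 hD' with hD' | hD'
  · exact hR.1 D hD D' hD'
  · exact hcross D hD D' hD'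
  · rintro ⟨s, hs, hs'⟩
    have k1 := Conf.square hb hC hD' hs
    have k2 := hE.mem D hD _ hs'
    dsimp only [down] at k2
    omega
  · exact hE.under D hD D' hD'

lemma sdiff_ruleI [DecidableEq (Finset Square)] (hE : NewStrips N δ δ' E)
    (hR : RuleI C) (h : E ⊆ C) : RuleI (C \ E) := by
  rw [ruleI_iff] at hR ⊢
  exact ⟨fun D hD D' hD' => hR.1 D (Finset.mem_sdiff.1 hD).1 D' (Finset.mem_sdiff.1 hD').1,
    hR.2.sdiff hE.bal h⟩

lemma prod_union [DecidableEq (Finset Square)] (hE : NewStrips N δ δ' E) (hb : Below α δ)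
    (hC : C ∈ Conf α δ) : ∏ D ∈ C ∪ E, wtI D = T (-1) * ∏ D ∈ C, wtI D := by
  rw [Finset.prod_union (hE.disjoint hb hC), hE.wt, mul_comm]

end NewStrips

end BallotStrip

/-! ### The strips attached to a group of steps. -/

namespace BallotStrip

open LaurentPolynomial

/-- The strips which correspond, in Rule I configurations, to the group of `+` steps of `γ` which
begins at `z`. -/
def IsNew (γ δ : Path) (z : ℤ) (E : Finset (Finset Square)) : Prop :=
  (lp γ z = 0 ∧ ∃ b, Ext γ z b ∧ E = {seg δ z b 0}) ∨
    (2 ≤ lp γ z ∧ ∃ y, IsPlus γ y ∧ lp γ y + 1 = lp γ z ∧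
      E = {seg δ z (y - 1) 0, seg δ y γ.length 0, seg δ y γ.length 1})

lemma rem_iff {γ δ : Path} {C : Finset (Finset Square)} {z : ℤ} :
    Rem γ δ C z ↔ ∃ E, IsNew γ δ z E ∧ E ⊆ C := by
  constructor
  · rintro (⟨h, b, hb, hs⟩ | ⟨h, y, hy, hy', h1, h2, h3⟩)
    · exact ⟨_, Or.inl ⟨h, b, hb, rfl⟩, by simpa using hs⟩
    · refine ⟨_, Or.inr ⟨h, y, hy, hy', rfl⟩, ?_⟩
      simp [Finset.insert_subset_iff, h1, h2, h3]
  · rintro ⟨E, ⟨h, b, hb, rfl⟩ | ⟨h, y, hy, hy', rfl⟩, hs⟩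
    · exact Or.inl ⟨h, b, hb, by simpa using hs⟩
    · simp only [Finset.insert_subset_iff, Finset.singleton_subset_iff] at hs
      exact Or.inr ⟨h, y, hy, hy', hs⟩

lemma exists_isNew {γ : Path} (δ : Path) {z : ℤ} (hz : IsPlus γ z) (he : Even (lp γ z)) :
    ∃ E, IsNew γ δ z E := by
  have := lp_nonneg γ z
  rcases this.lt_or_eq with h | h
  · obtain ⟨y, -, hy, hy', -⟩ := exists_partner hz (by omega)
    rw [Int.even_iff] at he
    exact ⟨_, Or.inr ⟨by omega, y, hy, hy', rfl⟩⟩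
  · obtain ⟨b, hb⟩ := exists_ext (γ := γ) (x := z) (by have := hz.1; omega) hz.2.1
    exact ⟨_, Or.inl ⟨h.symm, b, hb, rfl⟩⟩

lemma IsNew.unique {γ δ : Path} {z : ℤ} {E E' : Finset (Finset Square)} (h : IsNew γ δ z E)
    (h' : IsNew γ δ z E') : E = E' := by
  rcases h with ⟨h, b, hb, rfl⟩ | ⟨h, y, hy, hy', rfl⟩ <;>
    rcases h' with ⟨k, c, hc, rfl⟩ | ⟨k, x, hx, hx', rfl⟩
  · have h1 := (hc.cov_iff).1 ((hb.cov_iff).2 ⟨hb.le, le_rfl⟩)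
    have h2 := (hb.cov_iff).1 ((hc.cov_iff).2 ⟨hc.le, le_rfl⟩)
    rw [le_antisymm h1.2 h2.2]
  · omega
  · omega
  · rw [partner_unique hy hx (by omega) (by omega)]

lemma IsNew.congr {γ δ δ' : Path} {z : ℤ} {E : Finset (Finset Square)} (h : IsNew γ δ z E)
    (hd : ∀ v : ℤ, z ≤ v → v ≤ γ.length → H δ v = H δ' v) : IsNew γ δ' z E := by
  have key : ∀ a b c : ℤ, z ≤ a → b ≤ γ.length → seg δ a b c = seg δ' a b c := by
    intro a b c h1 h2
    ext s
    rw [mem_seg, mem_seg]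
    refine and_congr_right fun h3 => and_congr_right fun h4 => ?_
    rw [hd s.1 (by omega) (by omega)]
  rcases h with ⟨h, b, hb, rfl⟩ | ⟨h, y, hy, hy', rfl⟩
  · exact Or.inl ⟨h, b, hb, by rw [key _ _ _ le_rfl hb.le_len]⟩
  · have hy2 := hy.2.1
    have hzy : z ≤ y := by
      obtain ⟨c1, e1⟩ := cov_of_lp (γ := γ) (x := z) (by omega)
      obtain ⟨c2, e2⟩ := cov_of_lp (γ := γ) (x := y) (by omega)
      by_contra k
      push Not at k
      have := c2.2.2 z k.le c1.1
      omega
    exact Or.inr ⟨h, y, hy, hy', by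
      rw [key z _ _ le_rfl (by omega), key y _ _ hzy le_rfl, key y _ _ hzy le_rfl]⟩

lemma partner_props {γ : Path} {z y : ℤ} (hz : IsPlus γ z) (h : 2 ≤ lp γ z) (hy : IsPlus γ y)
    (hy' : lp γ y + 1 = lp γ z) : z < y ∧ H γ (y - 1) = H γ z ∧
      ∀ u, y ≤ u → u ≤ γ.length → H γ y ≤ H γ u := by
  obtain ⟨x, h1, h2, h3, h4, h5⟩ := exists_partner hz (by omega)
  rw [partner_unique hy h2 (by omega) (by omega)]
  exact ⟨h1, h4, h5⟩

/-- The group of `+` steps of `γ` which begins at `z`. -/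
noncomputable def grp (γ : Path) (z : ℤ) : Finset ℤ := by
  classical exact
    (Finset.Icc 1 (γ.length : ℤ)).filter fun x =>
      IsPlus γ x ∧ (x = z ∨ 1 ≤ lp γ x ∧ lp γ x + 1 = lp γ z)

lemma mem_grp {γ : Path} {z x : ℤ} :
    x ∈ grp γ z ↔ IsPlus γ x ∧ (x = z ∨ 1 ≤ lp γ x ∧ lp γ x + 1 = lp γ z) := by
  unfold grp
  simp only [Finset.mem_filter, Finset.mem_Icc]
  exact ⟨fun h => h.2, fun h => ⟨⟨h.1.1, h.1.2.1⟩, h⟩⟩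

lemma self_mem_grp {γ : Path} {z : ℤ} (hz : IsPlus γ z) : z ∈ grp γ z :=
  mem_grp.2 ⟨hz, Or.inl rfl⟩

lemma grp_matched {γ : Path} {z : ℤ} (hz : IsPlus γ z) (h : lp γ z = 0) : grp γ z = {z} := by
  ext x
  rw [mem_grp, Finset.mem_singleton]
  constructor
  · rintro ⟨h1, h2 | h2⟩
    · exact h2
    · omega
  · rintro rfl
    exact ⟨hz, Or.inl rfl⟩

lemma grp_pair {γ : Path} {z y : ℤ} (hz : IsPlus γ z) (h : 2 ≤ lp γ z) (hy : IsPlus γ y)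
    (hy' : lp γ y + 1 = lp γ z) : grp γ z = {z, y} := by
  ext x
  rw [mem_grp, Finset.mem_insert, Finset.mem_singleton]
  constructor
  · rintro ⟨h1, h2 | h2⟩
    · exact Or.inl h2
    · exact Or.inr (partner_unique h1 hy (by omega) h2.1)
  · rintro (rfl | rfl)
    · exact ⟨hz, Or.inl rfl⟩
    · exact ⟨hy, Or.inr ⟨by omega, hy'⟩⟩

open Classical in
lemma nX_matched {γ : Path} {z : ℤ} (hz : IsPlus γ z) (h : lp γ z = 0) (v : ℤ) :
    nX γ (grp γ z) v = if Cov γ z v then 1 else 0 := by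
  rw [grp_matched hz h]
  unfold nX
  rw [Finset.filter_singleton]
  split_ifs <;> simp

open Classical in
lemma nX_pair {γ : Path} {z y : ℤ} (hz : IsPlus γ z) (h : 2 ≤ lp γ z) (hy : IsPlus γ y)
    (hy' : lp γ y + 1 = lp γ z) {v : ℤ} (hv : v ≤ γ.length) :
    nX γ (grp γ z) v = (if z ≤ v then 1 else 0) + if y ≤ v then 1 else 0 := by
  obtain ⟨k1, k2, k3⟩ := partner_props hz h hy hy'
  obtain ⟨c1, -⟩ := cov_of_lp (γ := γ) (x := z) (by omega)
  obtain ⟨c2, -⟩ := cov_of_lp (γ := γ) (x := y) (by omega)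
  have e1 : Cov γ z v ↔ z ≤ v := ⟨fun h => h.1, fun h => c1.mono h hv⟩
  have e2 : Cov γ y v ↔ y ≤ v := ⟨fun h => h.1, fun h => c2.mono h hv⟩
  rw [grp_pair hz h hy hy']
  unfold nX
  rw [Finset.filter_insert, Finset.filter_singleton]
  simp only [e1, e2]
  split_ifs <;> simp [k1.ne]

lemma seg_strip {N : ℕ} {δ : Path} (hN : δ.length = N) {a b c : ℤ} (h0 : 0 ≤ a) (hab : a ≤ b)
    (hb : b ≤ N) (hlow : ∀ v, a ≤ v → v ≤ b → H δ a ≤ H δ v) (hfin : H δ b = H δ a ∨ b = N) :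
    Strip N (seg δ a b c) a b (fun v => H δ v - 1 - 2 * c) := by
  refine ⟨⟨hab, fun v h1 h2 => ?_, fun v h1 h2 => ?_, fun s => mem_seg⟩, ?_⟩
  · rcases H_step δ (v := v) (by omega) (by omega) with h | h
    · left; omega
    · right; omega
  · have := hlow v h1 h2
    omega
  · rcases hfin with h | h
    · left; omega
    · exact Or.inr h

lemma seg_left {δ : Path} {a b c a' b' c' : ℤ} (h : a ≤ b) (h' : a' ≤ b')
    (e : seg δ a b c = seg δ a' b' c') : a = a' := by
  have h1 : ((a, H δ a - 1 - 2 * c) : Square) ∈ seg δ a b c := mem_seg.2 ⟨le_rfl, h, rfl⟩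
  have h2 : ((a', H δ a' - 1 - 2 * c') : Square) ∈ seg δ a' b' c' := mem_seg.2 ⟨le_rfl, h', rfl⟩
  rw [e] at h1
  rw [← e] at h2
  exact le_antisymm (mem_seg.1 h2).1 (mem_seg.1 h1).1

lemma not_under_self {δ : Path} {a b c : ℤ} : ∀ s ∈ seg δ a b c, down s ∉ seg δ a b c := by
  intro s hs hs'
  rw [mem_seg] at hs hs'
  dsimp only [down] at hs'
  omega

lemma newStrips_matched {N : ℕ} {δ δ' : Path} (hl : δ.length = N) (hl' : δ'.length = N) {z b : ℤ}
    (hz : 1 ≤ z) (hzb : z ≤ b) (hbN : b ≤ N)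
    (hlow : ∀ v, z ≤ v → v ≤ b → H δ' z ≤ H δ' v) (hfin : H δ' b = H δ' z)
    (hin : ∀ v, z ≤ v → v ≤ b → H δ v = H δ' v - 2)
    (hout : ∀ v : ℤ, 0 ≤ v → v ≤ N → ¬ (z ≤ v ∧ v ≤ b) → H δ v = H δ' v) :
    NewStrips N δ δ' {seg δ' z b 0} := by
  classical
  have S := seg_strip (c := 0) hl' (by omega) hzb hbN hlow (Or.inl hfin)
  refine ⟨hl, hl', fun v h0 h1 => ?_, ?_, ?_, ?_, ?_, ?_, ?_, ?_⟩
  · by_cases h : z ≤ v ∧ v ≤ b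
    · have := hin v h.1 h.2
      omega
    · exact (hout v h0 h1 h).le
  · intro D hD
    rw [Finset.mem_singleton] at hD
    subst hD
    exact ⟨_, _, _, S⟩
  · intro D hD D' hD' _ _ _
    rw [Finset.mem_singleton] at hD hD'
    rw [hD, hD']
  · intro D hD s hs
    rw [Finset.mem_singleton] at hD
    subst hD
    rw [mem_seg] at hs
    have := hin s.1 hs.1 hs.2.1
    obtain ⟨c, hc0, hc1, hc⟩ := H_parity δ' (v := s.1) (by omega) (by omega)
    exact ⟨by omega, by omega, by omega, by omega, by omega⟩
  · intro s h1 h2 h3 h4 h5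
    refine ⟨_, Finset.mem_singleton_self _, mem_seg.2 ?_⟩
    by_cases h : z ≤ s.1 ∧ s.1 ≤ b
    · have := hin s.1 h.1 h.2
      exact ⟨h.1, h.2, by omega⟩
    · have := hout s.1 (by omega) h2 h
      omega
  · intro D hD D' hD'
    rw [Finset.mem_singleton] at hD hD'
    subst hD hD'
    rintro ⟨s, hs, hs'⟩
    exact absurd hs' (not_under_self s hs)
  · intro l l' hl1
    have : ((({seg δ' z b 0} : Finset (Finset Square))).filter fun D => HasLength D l l') = ∅ := by
      rw [Finset.filter_eq_empty_iff]
      intro D hD hL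
      rw [Finset.mem_singleton] at hD
      subst hD
      have := (S.hasLength_iff).1 hL
      omega
    have h0 : ((({seg δ' z b 0} : Finset (Finset Square))).filter fun D => HasLength D l l').card
      = 0 := by rw [this]; rfl
    exact ⟨fun _ => by rw [Nat.even_iff]; convert congrArg (· % 2) h0, fun _ => by convert h0⟩
  · rw [Finset.prod_singleton, S.wtI, if_pos]
    rw [hfin]; simp

/-- The two strips from `y` to the last column have the same length with odd `l'`. They satisfy the
parity condition of Rule I together, and the upper one has exactly the lower one beneath it. The
three weights are `T (-1)`, `1` and `1`. -/
lemma newStrips_pair {N : ℕ} {δ δ' : Path} (hl : δ.length = N) (hl' : δ'.length = N) {z y : ℤ}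
    (hz : 1 ≤ z) (hzy : z < y) (hyN : y ≤ N)
    (hlow : ∀ v, z ≤ v → v ≤ y - 1 → H δ' z ≤ H δ' v) (hfin : H δ' (y - 1) = H δ' z)
    (hlow' : ∀ v : ℤ, y ≤ v → v ≤ N → H δ' y ≤ H δ' v) (hodd : Odd (H δ' N - H δ' y))
    (hout : ∀ v : ℤ, 0 ≤ v → v < z → H δ v = H δ' v)
    (hin : ∀ v, z ≤ v → v ≤ y - 1 → H δ v = H δ' v - 2)
    (hin' : ∀ v : ℤ, y ≤ v → v ≤ N → H δ v = H δ' v - 4) :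
    NewStrips N δ δ' {seg δ' z (y - 1) 0, seg δ' y N 0, seg δ' y N 1} := by
  classical
  have S1 := seg_strip (c := 0) hl' (by omega) (by omega) (by omega) hlow (Or.inl hfin)
  have S2 := seg_strip (c := 0) hl' (by omega) hyN le_rfl hlow' (Or.inr rfl)
  have S3 := seg_strip (c := 1) hl' (by omega) hyN le_rfl hlow' (Or.inr rfl)
  have n12 : seg δ' z (y - 1) 0 ≠ seg δ' y N 0 := fun e => by
    have := seg_left (by omega) hyN e
    omega
  have n13 : seg δ' z (y - 1) 0 ≠ seg δ' y N 1 := fun e => by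
    have := seg_left (by omega) hyN e
    omega
  have n23 : seg δ' y N 0 ≠ seg δ' y N 1 := fun e => by
    have h : ((y, H δ' y - 1 - 2 * 0) : Square) ∈ seg δ' y N 0 := mem_seg.2 ⟨le_rfl, hyN, rfl⟩
    rw [e] at h
    have := (mem_seg.1 h).2.2
    dsimp only at this
    omega
  have hmem : ∀ D : Finset Square,
      D ∈ ({seg δ' z (y - 1) 0, seg δ' y N 0, seg δ' y N 1} : Finset (Finset Square)) ↔
        D = seg δ' z (y - 1) 0 ∨ D = seg δ' y N 0 ∨ D = seg δ' y N 1 := by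
    intro D; simp
  refine ⟨hl, hl', fun v h0 h1 => ?_, ?_, ?_, ?_, ?_, ?_, ?_, ?_⟩
  · rcases (show v < z ∨ (z ≤ v ∧ v ≤ y - 1) ∨ y ≤ v by omega) with h | h | h
    · exact (hout v h0 h).le
    · have := hin v h.1 h.2
      omega
    · have := hin' v h h1
      omega
  · intro D hD
    rcases (hmem D).1 hD with rfl | rfl | rfl
    · exact ⟨_, _, _, S1⟩
    · exact ⟨_, _, _, S2⟩
    · exact ⟨_, _, _, S3⟩
  · intro D hD D' hD' s hs hs'
    rcases (hmem D).1 hD with rfl | rfl | rfl <;> rcases (hmem D').1 hD' with rfl | rfl | rfl <;>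
      first
      | rfl
      | (rw [mem_seg] at hs hs'; omega)
  · intro D hD s hs
    rcases (hmem D).1 hD with rfl | rfl | rfl <;> rw [mem_seg] at hs <;>
      obtain ⟨c, hc0, hc1, hc⟩ := H_parity δ' (v := s.1) (by omega) (by omega)
    · have := hin s.1 hs.1 hs.2.1
      exact ⟨by omega, by omega, by omega, by omega, by omega⟩
    · have := hin' s.1 hs.1 hs.2.1
      exact ⟨by omega, by omega, by omega, by omega, by omega⟩
    · have := hin' s.1 hs.1 hs.2.1
      exact ⟨by omega, by omega, by omega, by omega, by omega⟩
  · intro s h1 h2 h3 h4 h5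
    obtain ⟨c, hc0, hc1, hc⟩ := H_parity δ' (v := s.1) (by omega) (by omega)
    rcases (show s.1 < z ∨ (z ≤ s.1 ∧ s.1 ≤ y - 1) ∨ y ≤ s.1 by omega) with h | h | h
    · have := hout s.1 (by omega) h
      omega
    · have := hin s.1 h.1 h.2
      exact ⟨_, (hmem _).2 (Or.inl rfl), mem_seg.2 ⟨h.1, h.2, by omega⟩⟩
    · have := hin' s.1 h h2
      rcases (show s.2 = H δ' s.1 - 1 - 2 * 0 ∨ s.2 = H δ' s.1 - 1 - 2 * 1 by omega) with k | k
      · exact ⟨_, (hmem _).2 (Or.inr (Or.inl rfl)), mem_seg.2 ⟨h, h2, k⟩⟩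
      · exact ⟨_, (hmem _).2 (Or.inr (Or.inr rfl)), mem_seg.2 ⟨h, h2, k⟩⟩
  · intro D hD D' hD'
    rintro ⟨s, hs, hs'⟩ t ht
    rcases (hmem D).1 hD with rfl | rfl | rfl <;> rcases (hmem D').1 hD' with rfl | rfl | rfl <;>
      rw [mem_seg] at hs hs' ht ⊢ <;> dsimp only [down] at hs' ⊢ <;>
      first
      | (exfalso; omega)
      | exact ⟨by omega, by omega, by omega⟩
  · intro l l' hl1
    have e1 : ¬ HasLength (seg δ' z (y - 1) 0) l l' := fun hL => by
      have := (S1.hasLength_iff).1 hL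
      omega
    have e23 : HasLength (seg δ' y N 1) l l' ↔ HasLength (seg δ' y N 0) l l' := by
      rw [S2.hasLength_iff, S3.hasLength_iff]
      constructor <;> rintro ⟨k1, k2⟩ <;> exact ⟨by omega, k2⟩
    by_cases hL : HasLength (seg δ' y N 0) l l'
    · have ho : Odd l' := by
        have := ((S2.hasLength_iff).1 hL).1
        rw [Int.odd_iff] at hodd
        rw [Nat.odd_iff]
        omega
      have h2 : ((({seg δ' z (y - 1) 0, seg δ' y N 0, seg δ' y N 1} :
          Finset (Finset Square))).filter fun D => HasLength D l l').card = 2 := by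
        rw [Finset.filter_insert, if_neg e1, Finset.filter_insert, if_pos hL,
          Finset.filter_singleton, if_pos (e23.2 hL), Finset.card_pair n23]
      refine ⟨fun _ => ⟨1, by convert h2⟩, fun he => ?_⟩
      exact absurd he (Nat.not_even_iff_odd.2 ho)
    · have h0 : ((({seg δ' z (y - 1) 0, seg δ' y N 0, seg δ' y N 1} :
          Finset (Finset Square))).filter fun D => HasLength D l l').card = 0 := by
        rw [Finset.filter_insert, if_neg e1, Finset.filter_insert, if_neg hL,
          Finset.filter_singleton, if_neg (fun k => hL (e23.1 k)), Finset.card_empty]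
      exact ⟨fun _ => ⟨0, by convert h0⟩, fun _ => by convert h0⟩
  · have k2 : ¬ Even (H δ' N - 1 - 2 * 0 - (H δ' y - 1 - 2 * 0)) := by
      rw [Int.not_even_iff_odd, show H δ' N - 1 - 2 * 0 - (H δ' y - 1 - 2 * 0) = H δ' N - H δ' y
        by ring]
      exact hodd
    have k3 : ¬ Even (H δ' N - 1 - 2 * 1 - (H δ' y - 1 - 2 * 1)) := by
      rw [Int.not_even_iff_odd, show H δ' N - 1 - 2 * 1 - (H δ' y - 1 - 2 * 1) = H δ' N - H δ' y
        by ring]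
      exact hodd
    have k1 : Even (H δ' (y - 1) - 1 - 2 * 0 - (H δ' z - 1 - 2 * 0)) := by
      rw [hfin]; simp
    rw [Finset.prod_insert (by simp [n12, n13]), Finset.prod_pair n23, S1.wtI, S2.wtI, S3.wtI,
      if_pos k1, if_neg k2, if_neg k3]
    simp

end BallotStrip

/-! ### Toggling one group of steps. -/

namespace BallotStrip

lemma nX_union {γ : Path} {X Y : Finset ℤ} (h : Disjoint X Y) (v : ℤ) :
    nX γ (X ∪ Y) v = nX γ X v + nX γ Y v := by
  classical
  unfold nX
  rw [Finset.filter_union, Finset.card_union_of_disjoint (Finset.disjoint_filter_filter h)]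
  push_cast
  rfl

/-- The step that validity demands of an unmatched `+` step lies in its own group, so removing a
whole group harms no other. -/
lemma Valid.sdiff_grp {γ : Path} {X : Finset ℤ} (hX : Valid γ X) {z : ℤ} (hz : IsPlus γ z)
    (he : Even (lp γ z)) : Valid γ (X \ grp γ z) := by
  refine ⟨fun x hx => hX.1 x (Finset.mem_sdiff.1 hx).1, fun x hx => ?_⟩
  rw [Finset.mem_sdiff, mem_grp] at hx
  obtain ⟨hx, hxg⟩ := hx
  have px := hX.1 x hx
  have hxg' : x ≠ z ∧ ¬ (1 ≤ lp γ x ∧ lp γ x + 1 = lp γ z) :=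
    ⟨fun h => hxg ⟨px, Or.inl h⟩, fun h => hxg ⟨px, Or.inr h⟩⟩
  have nn := lp_nonneg γ x
  rw [Int.even_iff] at he
  constructor
  · intro ho
    obtain ⟨y, hy, e⟩ := (hX.2 x hx).1 ho
    rw [Int.odd_iff] at ho
    refine ⟨y, Finset.mem_sdiff.2 ⟨hy, fun hyg => ?_⟩, e⟩
    rcases (mem_grp.1 hyg).2 with rfl | h
    · exact hxg'.2 ⟨by omega, e.symm⟩
    · omega
  · intro hev h1
    obtain ⟨y, hy, e⟩ := (hX.2 x hx).2 hev h1
    rw [Int.even_iff] at hev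
    refine ⟨y, Finset.mem_sdiff.2 ⟨hy, fun hyg => ?_⟩, e⟩
    rcases (mem_grp.1 hyg).2 with rfl | h
    · omega
    · exact hxg'.1 (partner_unique px hz (by omega) h1)

/-- The second step of a pair has odd `lp`, so a valid set containing it would contain `z` too. -/
lemma Valid.disjoint_grp {γ : Path} {Y : Finset ℤ} (hY : Valid γ Y) {z : ℤ} (hz : IsPlus γ z)
    (he : Even (lp γ z)) (hzY : z ∉ Y) : Disjoint Y (grp γ z) := by
  rw [Finset.disjoint_left]
  intro x hx hxg
  rcases (mem_grp.1 hxg).2 with rfl | ⟨h1, h2⟩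
  · exact hzY hx
  · obtain ⟨y, hy, e⟩ := (hY.2 x hx).1 (by
      rw [Int.even_iff] at he
      rw [Int.odd_iff]
      omega)
    rw [partner_unique (hY.1 y hy) hz (by omega) (by omega)] at hy
    exact hzY hy

lemma Valid.union_grp {γ : Path} {Y : Finset ℤ} (hY : Valid γ Y) {z : ℤ} (hz : IsPlus γ z)
    (he : Even (lp γ z)) : Valid γ (Y ∪ grp γ z) := by
  refine ⟨fun x hx => ?_, fun x hx => ?_⟩
  · rcases Finset.mem_union.1 hx with h | h
    · exact hY.1 x h
    · exact (mem_grp.1 h).1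
  · rcases Finset.mem_union.1 hx with h | h
    · refine ⟨fun ho => ?_, fun hev h1 => ?_⟩
      · obtain ⟨y, hy, e⟩ := (hY.2 x h).1 ho
        exact ⟨y, Finset.mem_union_left _ hy, e⟩
      · obtain ⟨y, hy, e⟩ := (hY.2 x h).2 hev h1
        exact ⟨y, Finset.mem_union_left _ hy, e⟩
    · have hzg : z ∈ Y ∪ grp γ z := Finset.mem_union_right _ (self_mem_grp hz)
      rcases (mem_grp.1 h).2 with rfl | ⟨h1, h2⟩
      · refine ⟨fun ho => absurd he (Int.not_even_iff_odd.2 ho), fun hev h1 => ?_⟩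
        obtain ⟨y, -, hy, hy', -⟩ := exists_partner hz h1
        rw [Int.even_iff] at he
        exact ⟨y, Finset.mem_union_right _ (mem_grp.2 ⟨hy, Or.inr ⟨by omega, hy'⟩⟩), by omega⟩
      · refine ⟨fun _ => ⟨z, hzg, h2.symm⟩, fun hev _ => ?_⟩
        rw [Int.even_iff] at he hev
        omega

/-- The flipped path is parallel to `γ` along the strip which starts at `z`, if no group of steps
beginning to the right of `z` is flipped. -/
lemma nX_const {γ : Path} {Y : Finset ℤ} (hY : Valid γ Y) {z : ℤ} (hz : IsPlus γ z)
    (hzY : z ∉ Y) (hmax : ∀ x ∈ Y, z < x → ¬ Even (lp γ x)) {v : ℤ} (hv : Cov γ z v) :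
    nX γ Y v = nX γ Y z := by
  classical
  unfold nX
  congr 2
  refine Finset.filter_congr fun x hx => ?_
  rcases lt_trichotomy x z with h | rfl | h
  · exact ⟨fun k => k.mono h.le hv.1, fun k => k.trans hv⟩
  · exact absurd hx hzY
  · refine ⟨fun k => ?_, fun k => absurd k.1 (by omega)⟩
    -- Such an `x` has odd `lp`, so its partner `y` lies in `Y`, and to the left of `z` by `hmax`.
    -- Then `H γ (x - 1) = H γ y < H γ z`, against `Cov γ z v`.
    exfalso
    have ho := Int.not_even_iff_odd.1 (hmax x hx h)
    have px := hY.1 x hx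
    have := lp_nonneg γ x
    have h1 : 1 ≤ lp γ x := by rw [Int.odd_iff] at ho; omega
    obtain ⟨y, hy, e⟩ := (hY.2 x hx).1 ho
    have hev : Even (lp γ y) := by
      rw [Int.odd_iff] at ho
      rw [Int.even_iff]
      omega
    obtain ⟨c1, e1⟩ := cov_of_lp h1
    obtain ⟨c2, e2⟩ := cov_of_lp (γ := γ) (x := y) (by omega)
    have hyz : y < z := by
      rcases lt_trichotomy y z with k | rfl | k
      · exact k
      · exact absurd hy hzY
      · exact absurd hev (hmax y hy k)
    have l1 := (c2.mono hyz.le hz.2.1).lt hz hyz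
    have l2 := hv.2.2 (x - 1) (by omega) (by have := k.1; omega)
    have := px.2.2
    omega

/-- The paths `δ` and `δ'` are obtained from `γ` by flipping steps, the group of steps beginning
at `z` being flipped in `δ` but not in `δ'`, and no group beginning to the right of `z` being
flipped. -/
structure Toggle (γ δ δ' : Path) (z : ℤ) : Prop where
  isPlus : IsPlus γ z
  even : Even (lp γ z)
  len : δ.length = γ.length
  len' : δ'.length = γ.length
  par : ∃ k, ∀ v, Cov γ z v → H δ' v = H γ v - k
  diff : ∀ v : ℤ, 0 ≤ v → v ≤ γ.length → H δ v = H δ' v - 2 * nX γ (grp γ z) v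

lemma toggle_of_valid {γ δ δ' : Path} {Y : Finset ℤ} (hY : Valid γ Y) {z : ℤ} (hz : IsPlus γ z)
    (he : Even (lp γ z)) (hzY : z ∉ Y) (hmax : ∀ x ∈ Y, z < x → ¬ Even (lp γ x))
    (hl : δ.length = γ.length) (hl' : δ'.length = γ.length)
    (hδ : ∀ v : ℤ, 0 ≤ v → v ≤ γ.length → H δ v = flipH γ (Y ∪ grp γ z) v)
    (hδ' : ∀ v : ℤ, 0 ≤ v → v ≤ γ.length → H δ' v = flipH γ Y v) : Toggle γ δ δ' z := by
  refine ⟨hz, he, hl, hl', ⟨2 * nX γ Y z, fun v hv => ?_⟩, fun v h0 h1 => ?_⟩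
  · rw [hδ' v (by have := hv.1; have := hz.1; omega) hv.2.1, flipH, nX_const hY hz hzY hmax hv]
  · rw [hδ v h0 h1, hδ' v h0 h1, flipH, flipH, nX_union (hY.disjoint_grp hz he hzY)]
    ring

namespace Toggle

variable {α γ δ δ' : Path} {z : ℤ} {C E : Finset (Finset Square)}

lemma diff_matched (hT : Toggle γ δ δ' z) (h : lp γ z = 0) {b : ℤ} (hb : Ext γ z b) :
    (∀ v, z ≤ v → v ≤ b → H δ v = H δ' v - 2) ∧
      ∀ v : ℤ, 0 ≤ v → v ≤ γ.length → ¬ (z ≤ v ∧ v ≤ b) → H δ v = H δ' v := by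
  have h1 := hT.isPlus.1
  have h2 := hb.le_len
  constructor
  · intro v k1 k2
    rw [hT.diff v (by omega) (by omega), nX_matched hT.isPlus h, if_pos (hb.cov_iff.2 ⟨k1, k2⟩)]
    ring
  · intro v k1 k2 k3
    rw [hT.diff v k1 k2, nX_matched hT.isPlus h, if_neg (fun k => k3 (hb.cov_iff.1 k))]
    ring

lemma diff_pair (hT : Toggle γ δ δ' z) (h : 2 ≤ lp γ z) {y : ℤ} (hy : IsPlus γ y)
    (hy' : lp γ y + 1 = lp γ z) :
    (∀ v : ℤ, 0 ≤ v → v < z → H δ v = H δ' v) ∧ (∀ v, z ≤ v → v ≤ y - 1 → H δ v = H δ' v - 2) ∧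
      ∀ v : ℤ, y ≤ v → v ≤ γ.length → H δ v = H δ' v - 4 := by
  have h1 := hT.isPlus
  have h2 := h1.1
  have h3 := hy.2.1
  have h4 := h1.2.1
  obtain ⟨k, -⟩ := partner_props hT.isPlus h hy hy'
  refine ⟨fun v k1 k2 => ?_, fun v k1 k2 => ?_, fun v k1 k2 => ?_⟩ <;>
    rw [hT.diff v (by omega) (by omega), nX_pair h1 h hy hy' (by omega)]
  · rw [if_neg (by omega), if_neg (by omega)]; ring
  · rw [if_pos (by omega), if_neg (by omega)]; ring
  · rw [if_pos (by omega), if_pos (by omega)]; ring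

lemma newStrips (hT : Toggle γ δ δ' z) (hE : IsNew γ δ' z E) :
    NewStrips γ.length δ δ' E := by
  obtain ⟨k, hk⟩ := hT.par
  have z1 := hT.isPlus.1
  have zN := hT.isPlus.2.1
  rcases hE with ⟨h, b, hb, rfl⟩ | ⟨h, y, hy, hy', rfl⟩
  · obtain ⟨d1, d2⟩ := hT.diff_matched h hb
    have hlp := hb.lp_eq (by omega)
    have e : ∀ v, z ≤ v → v ≤ b → H δ' v = H γ v - k := fun v k1 k2 =>
      hk v (hb.cov_iff.2 ⟨k1, k2⟩)
    have ez := e z le_rfl hb.le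
    have eb := e b hb.le le_rfl
    refine newStrips_matched hT.len hT.len' z1 hb.le hb.le_len (fun v k1 k2 => ?_) (by omega)
      d1 d2
    have := e v k1 k2
    have := hb.low v k1 k2
    omega
  · obtain ⟨d1, d2, d3⟩ := hT.diff_pair h hy hy'
    obtain ⟨p1, p2, p3⟩ := partner_props hT.isPlus h hy hy'
    obtain ⟨c1, -⟩ := cov_of_lp (γ := γ) (x := z) (by omega)
    obtain ⟨c2, e2⟩ := cov_of_lp (γ := γ) (x := y) (by have := hT.even; omega)
    have yN := hy.2.1
    have e : ∀ v : ℤ, z ≤ v → v ≤ γ.length → H δ' v = H γ v - k := fun v k1 k2 =>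
      hk v (c1.mono k1 k2)
    have ez := e z le_rfl zN
    have ey := e y p1.le yN
    have ey' := e (y - 1) (by omega) (by omega)
    have eN := e γ.length zN le_rfl
    refine newStrips_pair hT.len hT.len' z1 p1 yN (fun v k1 k2 => ?_) (by omega)
      (fun v k1 k2 => ?_) ?_ d1 d2 d3
    · have := e v k1 (by omega)
      have := c1.2.2 v k1 (by omega)
      omega
    · have := e v (by omega) k2
      have := p3 v k1 k2
      omega
    · have he := hT.even
      rw [Int.even_iff] at he
      rw [Int.odd_iff]
      omega

lemma under_of_flat {a b c : ℤ} (hF : Flat δ C a b)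
    (hd : ∀ v, a ≤ v → v ≤ b → H δ v = H δ' v - 2 * c - 2) {D : Finset Square} (hD : D ∈ C) :
    Under D (seg δ' a b c) := by
  have key : ∀ s ∈ seg δ' a b c, down s = (s.1, H δ s.1 - 1) := by
    intro s hs
    rw [mem_seg] at hs
    have := hd s.1 hs.1 hs.2.1
    rw [down, Prod.mk.injEq]
    exact ⟨rfl, by omega⟩
  rintro ⟨s, hs, hs'⟩ t ht
  rw [key s hs] at hs'
  rw [key t ht]
  rw [mem_seg] at hs ht
  exact hF D hD s.1 hs.1 hs.2.1 hs' t.1 ht.1 ht.2.1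

/-- Squares of `C` just below a new strip lie just below `δ`, which is parallel there to a ballot
stretch of `γ`. As no group beginning to the right of `z` is removable, `flat_of` applies. In a
pair, the upper of the two strips from `y` rests on the lower one, so no strip of `C` is just below
it. -/
lemma cross (hT : Toggle γ δ δ' z) (hE : IsNew γ δ' z E) (hb : Below α δ) (hC : C ∈ Conf α δ)
    (hR : RuleI C) (hrem : ∀ x, z < x → IsPlus γ x → Even (lp γ x) → ¬ Rem γ δ C x) :
    ∀ D ∈ C, ∀ D' ∈ E, Under D D' := by
  intro D hD D' hD'
  obtain ⟨k, hk⟩ := hT.par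
  have z1 := hT.isPlus.1
  have zN := hT.isPlus.2.1
  have len := hT.len
  rcases hE with ⟨h, b, hb', rfl⟩ | ⟨h, y, hy, hy', rfl⟩
  · obtain ⟨d1, d2⟩ := hT.diff_matched h hb'
    have hlp := hb'.lp_eq (by omega)
    have e : ∀ v, z ≤ v → v ≤ b → H δ' v = H γ v - k := fun v k1 k2 =>
      hk v (hb'.cov_iff.2 ⟨k1, k2⟩)
    rw [Finset.mem_singleton] at hD'
    subst hD'
    have F := flat_of hb len.symm hC hR (k + 2) (by omega) hb'.le hb'.le_len hb'.low
      (fun v k1 k2 => by rw [d1 v k1 k2, e v k1 k2]; ring) (Or.inl (by omega))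
      (fun x k1 _ => hrem x k1)
    exact under_of_flat F (fun v k1 k2 => by rw [d1 v k1 k2]; ring) hD
  · obtain ⟨d1, d2, d3⟩ := hT.diff_pair h hy hy'
    obtain ⟨p1, p2, p3⟩ := partner_props hT.isPlus h hy hy'
    obtain ⟨c1, -⟩ := cov_of_lp (γ := γ) (x := z) (by omega)
    obtain ⟨c2, e2⟩ := cov_of_lp (γ := γ) (x := y) (by have := hT.even; omega)
    have yN := hy.2.1
    have e : ∀ v : ℤ, z ≤ v → v ≤ γ.length → H δ' v = H γ v - k := fun v k1 k2 =>
      hk v (c1.mono k1 k2)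
    have hodd : Odd (H γ γ.length - H γ y) := by
      have he := hT.even
      rw [Int.even_iff] at he
      rw [Int.odd_iff]
      omega
    simp only [Finset.mem_insert, Finset.mem_singleton] at hD'
    rcases hD' with rfl | rfl | rfl
    · have F := flat_of hb len.symm hC hR (k + 2) (x := z) (b := y - 1) (by omega) (by omega)
        (by omega) (fun v k1 k2 => c1.2.2 v k1 (by omega))
        (fun v k1 k2 => by rw [d2 v k1 k2, e v k1 (by omega)]; ring) (Or.inl p2)
        (fun x k1 _ => hrem x k1)
      exact under_of_flat F (fun v k1 k2 => by rw [d2 v k1 k2]; ring) hD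
    · rintro ⟨s, hs, hs'⟩
      rw [mem_seg] at hs
      have k1 := d3 s.1 hs.1 hs.2.1
      have k2 := Conf.square hb hC hD hs'
      dsimp only [down] at k2
      omega
    · have F := flat_of hb len.symm hC hR (k + 4) (x := y) (b := γ.length) (by omega) yN le_rfl
        p3 (fun v k1 k2 => by rw [d3 v k1 k2, e v (by omega) k2]; ring) (Or.inr ⟨rfl, hodd⟩)
        (fun x k1 _ => hrem x (by omega))
      exact under_of_flat F (fun v k1 k2 => by rw [d3 v k1 k2]; ring) hD

end Toggle

lemma IsNew.first {γ δ : Path} {z : ℤ} {E : Finset (Finset Square)} (hz : IsPlus γ z)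
    (hE : IsNew γ δ z E) : (∃ b, z ≤ b ∧ b ≤ γ.length ∧ seg δ z b 0 ∈ E) ∧
      ∀ D ∈ E, ∀ s ∈ D, z ≤ s.1 := by
  have zN := hz.2.1
  rcases hE with ⟨h, b, hb', rfl⟩ | ⟨h, y, hy, hy', rfl⟩
  · refine ⟨⟨b, hb'.le, hb'.le_len, by simp⟩, fun D hD s hs => ?_⟩
    rw [Finset.mem_singleton] at hD
    subst hD
    exact (mem_seg.1 hs).1
  · obtain ⟨p1, -⟩ := partner_props hz h hy hy'
    have yN := hy.2.1
    refine ⟨⟨y - 1, by omega, by omega, by simp⟩, fun D hD s hs => ?_⟩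
    simp only [Finset.mem_insert, Finset.mem_singleton] at hD
    rcases hD with rfl | rfl | rfl
    · exact (mem_seg.1 hs).1
    · have := (mem_seg.1 hs).1
      omega
    · have := (mem_seg.1 hs).1
      omega

lemma IsNew.start {γ δ : Path} {z : ℤ} {E : Finset (Finset Square)} (hz : IsPlus γ z)
    (he : Even (lp γ z)) (hE : IsNew γ δ z E) {a b c : ℤ} (hab : a ≤ b) (h : seg δ a b c ∈ E) :
    a = z ∨ ¬ Even (lp γ a) := by
  rcases hE with ⟨k, b', hb', rfl⟩ | ⟨k, y, hy, hy', rfl⟩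
  · rw [Finset.mem_singleton] at h
    exact Or.inl (seg_left hab hb'.le h)
  · obtain ⟨p1, -⟩ := partner_props hz k hy hy'
    have yN := hy.2.1
    simp only [Finset.mem_insert, Finset.mem_singleton] at h
    have hodd : ¬ Even (lp γ y) := by
      rw [Int.even_iff] at he ⊢
      omega
    rcases h with h | h | h
    · exact Or.inl (seg_left hab (by omega) h)
    · right
      rwa [seg_left hab yN h]
    · right
      rwa [seg_left hab yN h]

namespace Toggle

variable {α γ δ δ' : Path} {z : ℤ} {C E : Finset (Finset Square)}

/-- To the right of the strip beginning at `z`, the two paths agree. -/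
lemma eq_right (hT : Toggle γ δ δ' z) {x : ℤ} (hzx : z < x) (hxN : x ≤ γ.length)
    (hx : ¬ Cov γ z x) :
    lp γ z = 0 ∧ ∀ v : ℤ, x ≤ v → v ≤ γ.length → H δ v = H δ' v := by
  have h0 : lp γ z = 0 := by
    by_contra h
    have := lp_nonneg γ z
    exact hx ((cov_of_lp (γ := γ) (x := z) (by omega)).1.mono hzx.le hxN)
  refine ⟨h0, fun v h1 h2 => ?_⟩
  have := hT.isPlus.1
  rw [hT.diff v (by omega) h2, nX_matched hT.isPlus h0, if_neg]
  · ring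
  · exact fun k => hx (k.mono hzx.le h1)

/-- If `x` were covered by `z`, its first strip would run just below `δ'`. It would not be in `C`,
which is below `δ`, nor in `E`, where a strip beginning after `z` begins at a step with odd `lp`. So
`x` is beyond the group, where the two paths agree. -/
lemma rem_union (hT : Toggle γ δ δ' z) (hE : IsNew γ δ' z E) (hb : Below α δ)
    (hC : C ∈ Conf α δ) {x : ℤ} (hzx : z < x) (hx : IsPlus γ x) (hxe : Even (lp γ x))
    (h : Rem γ δ' (C ∪ E) x) : Rem γ δ C x := by
  obtain ⟨E', hE', hsub⟩ := rem_iff.1 h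
  obtain ⟨⟨b, hxb, hbN, hs⟩, hcol⟩ := hE'.first hx
  have hN := hT.newStrips hE
  have x1 := hx.1
  have xN := hx.2.1
  have hcov : ¬ Cov γ z x := by
    intro hc
    have hm : ((x, H δ' x - 1 - 2 * 0) : Square) ∈ seg δ' x b 0 := mem_seg.2 ⟨le_rfl, hxb, rfl⟩
    rcases Finset.mem_union.1 (hsub hs) with k | k
    · have sq := Conf.square hb hC k hm
      dsimp only at sq
      have d := hT.diff x (by omega) xN
      have := nX_pos (X := grp γ z) (self_mem_grp hT.isPlus) hc
      omega
    · rcases hE.start hT.isPlus hT.even hxb k with k | k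
      · omega
      · exact k hxe
  obtain ⟨h0, heq⟩ := hT.eq_right hzx xN hcov
  refine rem_iff.2 ⟨E', hE'.congr fun v k1 k2 => (heq v k1 k2).symm, fun D hD => ?_⟩
  rcases Finset.mem_union.1 (hsub hD) with k | k
  · exact k
  · exfalso
    rcases hE with ⟨q, b', hb', rfl⟩ | ⟨q, y, hy, hy', rfl⟩
    · rw [Finset.mem_singleton] at k
      have := hcol D hD (z, H δ' z - 1 - 2 * 0) (by
        rw [k]
        exact mem_seg.2 ⟨le_rfl, hb'.le, rfl⟩)
      dsimp only at this
      omega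
    · omega

/-- If `x` were covered by `z`, its first strip would lie just below a strip of `E` beginning before
`x`, and Rule I (a) would make it extend to the left of `x`. The parity of `lp` excludes `x = y`. -/
lemma rem_sdiff (hT : Toggle γ δ δ' z) (hE : IsNew γ δ' z E) (hR : RuleI C) (hEC : E ⊆ C)
    {x : ℤ} (hzx : z < x) (hx : IsPlus γ x) (hxe : Even (lp γ x))
    (h : Rem γ δ (C \ E) x) : Rem γ δ' C x := by
  obtain ⟨E', hE', hsub⟩ := rem_iff.1 h
  obtain ⟨⟨b, hxb, hbN, hs⟩, -⟩ := hE'.first hx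
  have hs' := (Finset.mem_sdiff.1 (hsub hs)).1
  have x1 := hx.1
  have xN := hx.2.1
  have hcov : ¬ Cov γ z x := by
    intro hc
    have hm : ((x, H δ x - 1 - 2 * 0) : Square) ∈ seg δ x b 0 := mem_seg.2 ⟨le_rfl, hxb, rfl⟩
    have key : ∀ a e c : ℤ, a < x → x ≤ e → seg δ' a e c ∈ C → H δ x = H δ' x - 2 * c - 2 →
        False := by
      intro a e c k1 k2 k3 k4
      have m1 : ((x, H δ' x - 1 - 2 * c) : Square) ∈ seg δ' a e c := mem_seg.2 ⟨k1.le, k2, rfl⟩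
      have m2 : ((a, H δ' a - 1 - 2 * c) : Square) ∈ seg δ' a e c :=
        mem_seg.2 ⟨le_rfl, by dsimp only; omega, rfl⟩
      have := hR.down hs' k3 m1 (by convert hm using 2; omega) m2
      have := (mem_seg.1 this).1
      dsimp only at this
      omega
    rcases hE with ⟨q, b', hb', rfl⟩ | ⟨q, y, hy, hy', rfl⟩
    · have k := hb'.cov_iff.1 hc
      exact key z b' 0 hzx k.2 (hEC (by simp))
        (by rw [(hT.diff_matched q hb').1 x k.1 k.2]; ring)
    · obtain ⟨d1, d2, d3⟩ := hT.diff_pair q hy hy'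
      rcases lt_trichotomy x y with k | rfl | k
      · exact key z (y - 1) 0 hzx (by omega) (hEC (by simp))
          (by rw [d2 x hzx.le (by omega)]; ring)
      · have := hT.even
        rw [Int.even_iff] at this hxe
        omega
      · exact key y γ.length 1 k xN (hEC (by simp)) (by rw [d3 x k.le xN]; ring)
  obtain ⟨h0, heq⟩ := hT.eq_right hzx xN hcov
  exact rem_iff.2 ⟨E', hE'.congr heq, hsub.trans Finset.sdiff_subset⟩

end Toggle

end BallotStrip

/-! ### The sign-reversing involution. -/

namespace BallotStrip

open LaurentPolynomial

open Classical in
/-- The path obtained from `γ` by flipping the steps in `X` and the steps matched with them. -/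
noncomputable def flipPath (γ : Path) (X : Finset ℤ) : Path :=
  if h : ∀ x ∈ X, IsPlus γ x then (exists_flip h).choose else γ

lemma flipPath_spec {γ : Path} {X : Finset ℤ} (h : ∀ x ∈ X, IsPlus γ x) :
    (flipPath γ X).length = γ.length ∧
      ∀ v : ℤ, 0 ≤ v → v ≤ γ.length → H (flipPath γ X) v = flipH γ X v := by
  unfold flipPath
  rw [dif_pos h]
  exact (exists_flip h).choose_spec

lemma flipPath_empty (γ : Path) : flipPath γ ∅ = γ := by
  obtain ⟨h1, h2⟩ := flipPath_spec (γ := γ) (X := ∅) (by simp)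
  refine path_ext h1 fun v k1 k2 => ?_
  rw [h2 v k1 (by omega), flipH, nX]
  simp

lemma flipPath_below {γ : Path} {X : Finset ℤ} (h : ∀ x ∈ X, IsPlus γ x) :
    Below (flipPath γ X) γ :=
  below_flip (flipPath_spec h).1 (flipPath_spec h).2

open Classical in
/-- The strips which correspond, in Rule I configurations, to the group of `+` steps of `γ` which
begins at `z`. -/
noncomputable def newOf (γ δ : Path) (z : ℤ) : Finset (Finset Square) :=
  if h : ∃ E, IsNew γ δ z E then h.choose else ∅

lemma isNew_newOf {γ : Path} (δ : Path) {z : ℤ} (hz : IsPlus γ z) (he : Even (lp γ z)) :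
    IsNew γ δ z (newOf γ δ z) := by
  unfold newOf
  rw [dif_pos (exists_isNew δ hz he)]
  exact (exists_isNew δ hz he).choose_spec

/-- A Rule I configuration below a path obtained from `γ` by flipping steps. -/
structure IsState (α γ : Path) (X : Finset ℤ) (C : Finset (Finset Square)) : Prop where
  valid : Valid γ X
  below : Below α (flipPath γ X)
  conf : C ∈ Conf α (flipPath γ X)
  ruleI : RuleI C

/-- The beginnings of the groups of steps which are flipped or may be flipped. -/
noncomputable def cand (γ : Path) (X : Finset ℤ) (C : Finset (Finset Square)) : Finset ℤ := by
  classical exact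
    (Finset.Icc 1 (γ.length : ℤ)).filter fun z =>
      IsPlus γ z ∧ Even (lp γ z) ∧ (z ∈ X ∨ Rem γ (flipPath γ X) C z)

lemma mem_cand {γ : Path} {X : Finset ℤ} {C : Finset (Finset Square)} {z : ℤ} :
    z ∈ cand γ X C ↔
      IsPlus γ z ∧ Even (lp γ z) ∧ (z ∈ X ∨ Rem γ (flipPath γ X) C z) := by
  unfold cand
  simp only [Finset.mem_filter, Finset.mem_Icc]
  exact ⟨fun h => h.2, fun h => ⟨⟨h.1.1, h.1.2.1⟩, h⟩⟩

/-- The last of the groups of steps which are flipped or may be flipped begins at `z`. -/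
def Top (γ : Path) (X : Finset ℤ) (C : Finset (Finset Square)) (z : ℤ) : Prop :=
  z ∈ cand γ X C ∧ ∀ x ∈ cand γ X C, x ≤ z

lemma Top.isPlus {γ : Path} {X : Finset ℤ} {C : Finset (Finset Square)} {z : ℤ}
    (h : Top γ X C z) : IsPlus γ z := (mem_cand.1 h.1).1

lemma Top.even {γ : Path} {X : Finset ℤ} {C : Finset (Finset Square)} {z : ℤ}
    (h : Top γ X C z) : Even (lp γ z) := (mem_cand.1 h.1).2.1

lemma Top.notMem {γ : Path} {X : Finset ℤ} {C : Finset (Finset Square)} {z x : ℤ}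
    (h : Top γ X C z) (hX : Valid γ X) (hx : x ∈ X) (hzx : z < x) : ¬ Even (lp γ x) := fun he => by
  have := h.2 x (mem_cand.2 ⟨hX.1 x hx, he, Or.inl hx⟩)
  omega

lemma Top.not_rem {γ : Path} {X : Finset ℤ} {C : Finset (Finset Square)} {z x : ℤ}
    (h : Top γ X C z) (hzx : z < x) (hx : IsPlus γ x) (he : Even (lp γ x)) :
    ¬ Rem γ (flipPath γ X) C x := fun hr => by
  have := h.2 x (mem_cand.2 ⟨hx, he, Or.inr hr⟩)
  omega

lemma Valid.grp_subset {γ : Path} {X : Finset ℤ} (hX : Valid γ X) {z : ℤ} (hz : z ∈ X)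
    (he : Even (lp γ z)) : grp γ z ⊆ X := by
  intro x hx
  rcases (mem_grp.1 hx).2 with rfl | ⟨h1, h2⟩
  · exact hz
  · obtain ⟨y, hy, e⟩ := (hX.2 z hz).2 he (by omega)
    rwa [partner_unique (mem_grp.1 hx).1 (hX.1 y hy) (by omega) h1]

/-- The second step of a pair has odd `lp` and weight `1`, so a pair weighs as much as a single
step. -/
lemma prod_grp {γ : Path} {z : ℤ} (hz : IsPlus γ z) (he : Even (lp γ z)) :
    ∏ x ∈ grp γ z, wtX γ x = -T (-1) := by
  have := lp_nonneg γ z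
  rcases this.lt_or_eq with h | h
  · obtain ⟨y, hzy, hy, hy', -⟩ := exists_partner hz (by omega)
    have hodd : ¬ Even (lp γ y) := by
      rw [Int.even_iff] at he ⊢
      omega
    rw [grp_pair hz (by rw [Int.even_iff] at he; omega) hy hy', Finset.prod_pair hzy.ne,
      wtX, wtX, if_pos he, if_neg hodd, mul_one]
  · rw [grp_matched hz h.symm, Finset.prod_singleton, wtX, if_pos he]

section Step

variable {α γ : Path} {X : Finset ℤ} {C : Finset (Finset Square)} {z : ℤ}

lemma toggle_down (hS : IsState α γ X C) (hz : Top γ X C z) (hzX : z ∈ X) :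
    Toggle γ (flipPath γ X) (flipPath γ (X \ grp γ z)) z := by
  have hY := hS.valid.sdiff_grp hz.isPlus hz.even
  have hs := hS.valid.grp_subset hzX hz.even
  have s1 := flipPath_spec hS.valid.1
  have s2 := flipPath_spec hY.1
  refine toggle_of_valid hY hz.isPlus hz.even ?_ ?_ s1.1 s2.1 ?_ s2.2
  · simp [self_mem_grp hz.isPlus]
  · intro x hx hzx
    exact hz.notMem hS.valid (Finset.mem_sdiff.1 hx).1 hzx
  · rw [Finset.sdiff_union_of_subset hs]
    exact s1.2

lemma toggle_up (hS : IsState α γ X C) (hz : Top γ X C z) (hzX : z ∉ X) :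
    Toggle γ (flipPath γ (X ∪ grp γ z)) (flipPath γ X) z := by
  have hY := hS.valid.union_grp hz.isPlus hz.even
  have s1 := flipPath_spec hS.valid.1
  have s2 := flipPath_spec hY.1
  exact toggle_of_valid hS.valid hz.isPlus hz.even hzX
    (fun x hx hzx => hz.notMem hS.valid hx hzx) s2.1 s1.1 s2.2 s1.2

/-- Beyond `z` no group is flipped or removable beforehand. This gives Rule I through
`Toggle.cross`, and by `Toggle.rem_union` no such group becomes removable, so `z` stays on top. -/
lemma state_down (hS : IsState α γ X C) (hz : Top γ X C z) (hzX : z ∈ X) :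
    IsState α γ (X \ grp γ z) (C ∪ newOf γ (flipPath γ (X \ grp γ z)) z) ∧
      Top γ (X \ grp γ z) (C ∪ newOf γ (flipPath γ (X \ grp γ z)) z) z := by
  have hT := toggle_down hS hz hzX
  have hE := isNew_newOf (flipPath γ (X \ grp γ z)) hz.isPlus hz.even
  have hN := hT.newStrips hE
  have hY := hS.valid.sdiff_grp hz.isPlus hz.even
  refine ⟨⟨hY, hS.below.trans hN.below, hN.union_mem_Conf hS.below hS.conf,
    hN.union_ruleI hS.below hS.conf hS.ruleI (hT.cross hE hS.below hS.conf hS.ruleI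
      fun x h1 h2 h3 => hz.not_rem h1 h2 h3)⟩, ?_, ?_⟩
  · exact mem_cand.2 ⟨hz.isPlus, hz.even, Or.inr (rem_iff.2 ⟨_, hE, Finset.subset_union_right⟩)⟩
  · intro x hx
    obtain ⟨h1, h2, h3⟩ := mem_cand.1 hx
    by_contra h
    push Not at h
    rcases h3 with h3 | h3
    · exact hz.notMem hS.valid (Finset.mem_sdiff.1 h3).1 h h2
    · exact hz.not_rem h h1 h2 (hT.rem_union hE hS.below hS.conf h h1 h2 h3)

lemma newOf_subset (hz : Top γ X C z) (hzX : z ∉ X) : newOf γ (flipPath γ X) z ⊆ C := by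
  obtain ⟨E, hE, hEC⟩ := rem_iff.1 ((mem_cand.1 hz.1).2.2.resolve_left hzX)
  rwa [(isNew_newOf _ hz.isPlus hz.even).unique hE]

lemma state_up (hS : IsState α γ X C) (hz : Top γ X C z) (hzX : z ∉ X) :
    IsState α γ (X ∪ grp γ z) (C \ newOf γ (flipPath γ X) z) ∧
      Top γ (X ∪ grp γ z) (C \ newOf γ (flipPath γ X) z) z := by
  have hT := toggle_up hS hz hzX
  have hE := isNew_newOf (flipPath γ X) hz.isPlus hz.even
  have hN := hT.newStrips hE
  have hEC := newOf_subset hz hzX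
  have hb := hN.below_of_subset hS.below hS.conf hEC
  refine ⟨⟨hS.valid.union_grp hz.isPlus hz.even, hb, hN.sdiff_mem_Conf hb hS.conf hEC,
    hN.sdiff_ruleI hS.ruleI hEC⟩, ?_, ?_⟩
  · exact mem_cand.2 ⟨hz.isPlus, hz.even,
      Or.inl (Finset.mem_union_right _ (self_mem_grp hz.isPlus))⟩
  · intro x hx
    obtain ⟨h1, h2, h3⟩ := mem_cand.1 hx
    by_contra h
    push Not at h
    rcases h3 with h3 | h3
    · rcases Finset.mem_union.1 h3 with h3 | h3
      · exact hz.notMem hS.valid h3 h h2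
      · have he := hz.even
        rw [Int.even_iff] at he h2
        rcases (mem_grp.1 h3).2 with rfl | ⟨-, h4⟩ <;> omega
    · exact hz.not_rem h h1 h2 (hT.rem_sdiff hE hS.ruleI hEC h h1 h2 h3)

lemma weight_down (hS : IsState α γ X C) (hz : Top γ X C z) (hzX : z ∈ X) :
    (∏ x ∈ X, wtX γ x) * ∏ D ∈ C, wtI D =
      -((∏ x ∈ X \ grp γ z, wtX γ x) *
        ∏ D ∈ C ∪ newOf γ (flipPath γ (X \ grp γ z)) z, wtI D) := by
  have hT := toggle_down hS hz hzX
  have hN := hT.newStrips (isNew_newOf (flipPath γ (X \ grp γ z)) hz.isPlus hz.even)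
  rw [hN.prod_union hS.below hS.conf,
    ← Finset.prod_sdiff (hS.valid.grp_subset hzX hz.even), prod_grp hz.isPlus hz.even]
  ring

end Step

open Classical in
/-- The sets of steps of `γ` which may be flipped, the flipped path being above `α`. -/
noncomputable def flips (α γ : Path) : Finset (Finset ℤ) :=
  (Finset.Icc 1 (γ.length : ℤ)).powerset.filter fun X => Valid γ X ∧ Below α (flipPath γ X)

lemma mem_flips {α γ : Path} {X : Finset ℤ} :
    X ∈ flips α γ ↔ Valid γ X ∧ Below α (flipPath γ X) := by
  unfold flips
  simp only [Finset.mem_filter, Finset.mem_powerset]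
  refine ⟨fun h => h.2, fun h => ⟨fun x hx => ?_, h⟩⟩
  have := h.1.1 x hx
  exact Finset.mem_Icc.2 ⟨this.1, this.2.1⟩

open Classical in
/-- The Rule I configurations below the paths obtained from `γ` by flipping steps. -/
noncomputable def states (α γ : Path) : Finset (Σ _ : Finset ℤ, Finset (Finset Square)) :=
  (flips α γ).sigma fun X => (Conf α (flipPath γ X)).filter RuleI

lemma mem_states {α γ : Path} {s : Σ _ : Finset ℤ, Finset (Finset Square)} :
    s ∈ states α γ ↔ IsState α γ s.1 s.2 := by
  unfold states
  simp only [Finset.mem_sigma, mem_flips, Finset.mem_filter]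
  exact ⟨fun h => ⟨h.1.1, h.1.2, h.2.1, h.2.2⟩,
    fun h => ⟨⟨h.valid, h.below⟩, h.conf, h.ruleI⟩⟩

/-- If something is flipped, an element with odd `lp` brings along the one with even `lp` in its
group. If nothing is flipped, the configuration lies below `γ` itself and `exists_rem` applies. -/
lemma exists_top {α γ : Path} (hne : α ≠ γ) {X : Finset ℤ} {C : Finset (Finset Square)}
    (hS : IsState α γ X C) : ∃ z, Top γ X C z := by
  have hc : (cand γ X C).Nonempty := by
    rcases X.eq_empty_or_nonempty with rfl | ⟨x, hx⟩
    · have e := flipPath_empty γ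
      have hb := hS.below
      have hC := hS.conf
      rw [e] at hb hC
      obtain ⟨z, h1, h2, h3⟩ := exists_rem hb hne hC hS.ruleI
      exact ⟨z, mem_cand.2 ⟨h1, h2, Or.inr (by rwa [e])⟩⟩
    · have px := hS.valid.1 x hx
      rcases Int.even_or_odd (lp γ x) with h | h
      · exact ⟨x, mem_cand.2 ⟨px, h, Or.inl hx⟩⟩
      · obtain ⟨y, hy, e⟩ := (hS.valid.2 x hx).1 h
        refine ⟨y, mem_cand.2 ⟨hS.valid.1 y hy, ?_, Or.inl hy⟩⟩
        rw [e]
        exact h.add_one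
  exact ⟨_, Finset.max'_mem _ hc, fun x hx => Finset.le_max' _ x hx⟩

lemma Top.unique {γ : Path} {X : Finset ℤ} {C : Finset (Finset Square)} {z x : ℤ}
    (h : Top γ X C z) (h' : Top γ X C x) : z = x :=
  le_antisymm (h'.2 _ h.1) (h.2 _ h'.1)

/-- Among the states with the same top `z`, those with `z` flipped cancel those with `z` not
flipped: unflipping the group trades the factor `-T (-1)` for strips of weight `T (-1)`. -/
lemma sum_states {α γ : Path} (hne : α ≠ γ) :
    ∑ s ∈ states α γ, (∏ x ∈ s.1, wtX γ x) * ∏ D ∈ s.2, wtI D = 0 := by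
  classical
  -- Every state has a top, so the default value `0` plays no role on `states α γ`.
  let g : (Σ _ : Finset ℤ, Finset (Finset Square)) → ℤ := fun s =>
    if h : ∃ z, Top γ s.1 s.2 z then h.choose else 0
  have hg : ∀ s ∈ states α γ, ∀ z, g s = z ↔ Top γ s.1 s.2 z := by
    intro s hs z
    have h := exists_top hne (mem_states.1 hs)
    have e : g s = h.choose := dif_pos h
    rw [e]
    constructor
    · rintro rfl
      exact h.choose_spec
    · exact fun h' => h.choose_spec.unique h'
  rw [← Finset.sum_fiberwise_of_maps_to (s := states α γ) (t := (states α γ).image g) (g := g)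
    (fun s hs => Finset.mem_image_of_mem _ hs)]
  refine Finset.sum_eq_zero fun z _ => ?_
  rw [← Finset.sum_filter_add_sum_filter_not _ (fun s => z ∈ s.1), ← eq_neg_iff_add_eq_zero,
    ← Finset.sum_neg_distrib]
  have hm : ∀ s, s ∈ (states α γ).filter (fun s => g s = z) ↔
      IsState α γ s.1 s.2 ∧ Top γ s.1 s.2 z := by
    intro s
    rw [Finset.mem_filter]
    constructor
    · rintro ⟨h1, h2⟩
      exact ⟨mem_states.1 h1, (hg s h1 z).1 h2⟩
    · rintro ⟨h1, h2⟩
      exact ⟨mem_states.2 h1, (hg s (mem_states.2 h1) z).2 h2⟩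
  refine Finset.sum_bij' (fun s _ => ⟨s.1 \ grp γ z, s.2 ∪ newOf γ (flipPath γ (s.1 \ grp γ z)) z⟩)
    (fun s _ => ⟨s.1 ∪ grp γ z, s.2 \ newOf γ (flipPath γ s.1) z⟩) ?_ ?_ ?_ ?_ ?_
  · intro s hs
    rw [Finset.mem_filter, hm] at hs
    rw [Finset.mem_filter, hm]
    exact ⟨state_down hs.1.1 hs.1.2 hs.2, by simp [self_mem_grp hs.1.2.isPlus]⟩
  · intro s hs
    rw [Finset.mem_filter, hm] at hs
    rw [Finset.mem_filter, hm]
    exact ⟨state_up hs.1.1 hs.1.2 hs.2, by simp [self_mem_grp hs.1.2.isPlus]⟩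
  · intro s hs
    rw [Finset.mem_filter, hm] at hs
    obtain ⟨⟨hS, hz⟩, hzX⟩ := hs
    have hT := toggle_down hS hz hzX
    have hN := hT.newStrips (isNew_newOf (flipPath γ (s.1 \ grp γ z)) hz.isPlus hz.even)
    refine Sigma.ext ?_ (heq_of_eq ?_)
    · exact Finset.sdiff_union_of_subset (hS.valid.grp_subset hzX hz.even)
    · exact Finset.union_sdiff_cancel_right (hN.disjoint hS.below hS.conf)
  · intro s hs
    rw [Finset.mem_filter, hm] at hs
    obtain ⟨⟨hS, hz⟩, hzX⟩ := hs
    have e : (s.1 ∪ grp γ z) \ grp γ z = s.1 :=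
      Finset.union_sdiff_cancel_right (hS.valid.disjoint_grp hz.isPlus hz.even hzX)
    refine Sigma.ext e (heq_of_eq ?_)
    dsimp only
    rw [e]
    exact Finset.sdiff_union_of_subset (newOf_subset hz hzX)
  · intro s hs
    rw [Finset.mem_filter, hm] at hs
    exact weight_down hs.1.1 hs.1.2 hs.2

/-- For `α = γ` only the empty set remains: a flipped path above `γ` is `γ`, and the path determines
the set of flipped steps. -/
lemma sum_flips (α γ : Path) :
    ∑ X ∈ flips α γ, SI α (flipPath γ X) * ∏ x ∈ X, wtX γ x = if α = γ then 1 else 0 := by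
  classical
  have e0 := flipPath_empty γ
  split_ifs with h
  · subst h
    have : flips α α = {∅} := by
      ext X
      rw [mem_flips, Finset.mem_singleton]
      constructor
      · rintro ⟨h1, h2⟩
        have e := (flipPath_below h1.1).antisymm h2
        have f1 := flipped_flip h1.1 (flipPath_spec h1.1).2
        have f2 := flipped_flip (γ := α) (X := ∅) (by simp) (flipPath_spec (by simp)).2
        rw [e] at f1
        rw [e0] at f2
        rw [← f1, f2]
      · rintro rfl
        exact ⟨⟨by simp, by simp⟩, e0.symm ▸ Below.refl α⟩
    rw [this, Finset.sum_singleton, e0, Finset.prod_empty, mul_one, ← QI_eq, QI, if_pos rfl]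
  · rw [← sum_states h]
    unfold states SI
    rw [Finset.sum_sigma]
    refine Finset.sum_congr rfl fun X _ => ?_
    rw [mul_comm, Finset.mul_sum]

/-- The contributions of Rule I and of Rule II without projection domains are inverse to each
other. -/
theorem sum_SI_mul_SII (α γ : Path) (S : Finset Path)
    (hS : ∀ δ, δ ∈ S ↔ Below α δ ∧ Below δ γ) :
    ∑ δ ∈ S, SI α δ * SII δ γ = if α = γ then 1 else 0 := by
  rw [← sum_flips α γ]
  symm
  refine Finset.sum_of_injOn (flipPath γ) ?_ ?_ ?_ ?_
  · intro X hX Y hY e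
    rw [Finset.mem_coe, mem_flips] at hX hY
    rw [← flipped_flip hX.1.1 (flipPath_spec hX.1.1).2,
      ← flipped_flip hY.1.1 (flipPath_spec hY.1.1).2, e]
  · intro X hX
    rw [Finset.mem_coe, mem_flips] at hX
    rw [Finset.mem_coe, hS]
    exact ⟨hX.2, flipPath_below hX.1.1⟩
  · intro δ hδ hδ'
    rw [hS] at hδ
    by_contra h
    obtain ⟨h1, h2⟩ := flip_of_SII_ne_zero hδ.2 (right_ne_zero_of_mul h)
    have e : flipPath γ (flipped γ δ) = δ := by
      obtain ⟨k1, k2⟩ := flipPath_spec h1.1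
      refine path_ext (k1.trans hδ.2.1.symm) fun v q1 q2 => ?_
      rw [k2 v q1 (by omega), h2 v q1 (by omega)]
    refine hδ' ⟨flipped γ δ, ?_, e⟩
    rw [Finset.mem_coe, mem_flips, e]
    exact ⟨h1, hδ.1⟩
  · intro X hX
    rw [mem_flips] at hX
    rw [SII_flip hX.1 (flipPath_spec hX.1.1).1 (flipPath_spec hX.1.1).2]

end BallotStrip

/-! ### Rule I: lowering the peaks of the upper path. -/

namespace BallotStrip

open LaurentPolynomial

/-- The path `α` has no peak (for `ε = 1`) or valley (for `ε = -1`) at interior points outside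
`B`. -/
def NoTurn (ε : ℤ) (B : Set ℤ) (α : Path) : Prop :=
  ∀ v : ℤ, 0 < v → v < α.length → v ∉ B →
    ¬ (ε * (H α v - H α (v - 1)) = 1 ∧ ε * (H α (v + 1) - H α v) = -1)

/-- Otherwise `flat_matched` makes the strips flat on `[v - 1, v + 1]`, including the one through
the lowest square of column `v`. That strip goes down on both sides and stays above `α`, so `α` has
a peak at `v`. If the column is empty, `α` touches `δ` at its peak and has one as well. -/
lemma seg_peak_mem {α δ : Path} (hb : Below α δ) {C : Finset (Finset Square)} (hC : C ∈ Conf α δ)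
    (hR : RuleI C) {v : ℤ} (h0 : 1 ≤ v) (hN : v < α.length) (h1 : H δ (v - 1) = H δ v - 1)
    (h2 : H δ (v + 1) = H δ v - 1)
    (hα : ¬ (H α (v - 1) = H α v - 1 ∧ H α (v + 1) = H α v - 1)) : seg δ v v 0 ∈ C := by
  by_contra hs
  have F0 : Flat δ C v v := by
    intro D hD u k1 k2 hm w k3 k4
    rwa [show w = u by omega]
  have F := flat_matched hb hC h0 le_rfl hN F0 h1 h2 rfl hs
  have b0 := hb.le (v := v) (by omega) (by omega)
  have b1 := hb.le (v := v - 1) (by omega) (by omega)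
  have b2 := hb.le (v := v + 1) (by omega) (by omega)
  have s1 := step_cases α h0 (by omega)
  have s2 := H_step α (v := v) (by omega) hN
  obtain ⟨c, hc0, hc1, hc⟩ := H_parity α (v := v) (by omega) (by omega)
  obtain ⟨d, hd0, hd1, hd⟩ := H_parity δ (v := v) (by omega) (by have := hb.1; omega)
  rcases b0.lt_or_eq with hlt | heq
  -- The level `c - d - 1` below `δ` is that of the square just above `α`.
  · obtain ⟨D, hD, hm⟩ := Conf.exists_mem hb hC (v := v)
      (j := H δ v - 1 - 2 * (c - d - 1).toNat) h0 (by omega) (by omega) (by omega) (by omega)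
    have m1 := F.level hb hC hR _ hD (by omega) (by omega) hm (w := v - 1) (by omega) (by omega)
    have m2 := F.level hb hC hR _ hD (by omega) (by omega) hm (w := v + 1) (by omega) (by omega)
    have q1 := Conf.square hb hC hD m1
    have q2 := Conf.square hb hC hD m2
    dsimp only at q1 q2
    exact hα ⟨by omega, by omega⟩
  · exact hα ⟨by omega, by omega⟩

/-- Flipping a peak of the upper path at which the lower path has no peak. -/
lemma SI_peak {α δ δ' : Path} (hb : Below α δ) (hl : δ'.length = δ.length) {v : ℤ} (h0 : 1 ≤ v)
    (hN : v < α.length) (h1 : H δ (v - 1) = H δ v - 1) (h2 : H δ (v + 1) = H δ v - 1)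
    (hα : ¬ (H α (v - 1) = H α v - 1 ∧ H α (v + 1) = H α v - 1)) (hin : H δ' v = H δ v - 2)
    (hout : ∀ u : ℤ, 0 ≤ u → u ≤ δ.length → u ≠ v → H δ' u = H δ u) :
    SI α δ = T (-1) * SI α δ' := by
  classical
  have hlen := hb.1
  have hE : NewStrips δ.length δ' δ {seg δ v v 0} := by
    refine newStrips_matched hl rfl h0 le_rfl (by omega) (fun u k1 k2 => ?_) rfl
      (fun u k1 k2 => ?_) (fun u k1 k2 k3 => hout u k1 k2 (fun e => k3 (by omega)))
    · rw [le_antisymm k1 k2]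
    · rw [le_antisymm k2 k1, hin]
  have hb' : Below α δ' := by
    rw [below_iff]
    refine ⟨by omega, fun u k1 k2 => ?_⟩
    by_cases hu : u = v
    · subst hu
      have b0 := hb.le (v := u) (by omega) (by omega)
      have b1 := hb.le (v := u - 1) (by omega) (by omega)
      have b2 := hb.le (v := u + 1) (by omega) (by omega)
      have s1 := step_cases α h0 (by omega)
      have s2 := H_step α (v := u) (by omega) hN
      obtain ⟨c, hc0, hc1, hc⟩ := H_parity α (v := u) (by omega) (by omega)
      obtain ⟨d, hd0, hd1, hd⟩ := H_parity δ (v := u) (by omega) (by omega)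
      by_contra k
      exact hα ⟨by omega, by omega⟩
    · rw [hout u k1 (by omega) hu]
      exact hb.le k1 k2
  unfold SI
  rw [Finset.mul_sum]
  symm
  refine Finset.sum_bij' (fun C _ => C ∪ {seg δ v v 0}) (fun C _ => C \ {seg δ v v 0})
    ?_ ?_ ?_ ?_ ?_
  · intro C hC
    simp only [Finset.mem_filter] at hC ⊢
    refine ⟨hE.union_mem_Conf hb' hC.1, hE.union_ruleI hb' hC.1 hC.2 ?_⟩
    intro D hD D' hD'
    rw [Finset.mem_singleton] at hD'
    subst hD'
    rintro ⟨s, hs, hs'⟩ t ht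
    rw [mem_seg] at hs ht
    rwa [show t = s from Prod.ext (by omega) (by
      rw [hs.2.2, ht.2.2, show t.1 = s.1 by omega])]
  · intro C hC
    simp only [Finset.mem_filter] at hC ⊢
    have hsub : {seg δ v v 0} ⊆ C := by
      simpa using seg_peak_mem hb hC.1 hC.2 h0 hN h1 h2 hα
    exact ⟨hE.sdiff_mem_Conf hb' hC.1 hsub, hE.sdiff_ruleI hC.2 hsub⟩
  · intro C hC
    simp only [Finset.mem_filter] at hC
    exact Finset.union_sdiff_cancel_right (hE.disjoint hb' hC.1)
  · intro C hC
    simp only [Finset.mem_filter] at hC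
    have hsub : {seg δ v v 0} ⊆ C := by
      simpa using seg_peak_mem hb hC.1 hC.2 h0 hN h1 h2 hα
    exact Finset.sdiff_union_of_subset hsub
  · intro C hC
    simp only [Finset.mem_filter] at hC
    rw [hE.prod_union hb' hC.1]

/-- If `δ` is somewhere above `p`, then it has a peak above `p`. -/
lemma exists_peak {δ p : Path} (hl : δ.length = p.length) (hN : H δ δ.length ≤ H p p.length)
    (h : ∃ v : ℤ, 0 ≤ v ∧ v ≤ δ.length ∧ H p v < H δ v) :
    ∃ v : ℤ, 0 < v ∧ v < δ.length ∧ H p v < H δ v ∧ H δ (v - 1) = H δ v - 1 ∧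
      H δ (v + 1) = H δ v - 1 := by
  obtain ⟨v0, a0, a1, a2⟩ := h
  -- Choose a highest point of `δ` among those above `p`: a neighbour higher on `δ` would still be
  -- above `p`.
  obtain ⟨M, ⟨v, h0, h1, h2, rfl⟩, hmax⟩ := Int.exists_greatest_of_bdd
    (P := fun j => ∃ v : ℤ, 0 ≤ v ∧ v ≤ δ.length ∧ H p v < H δ v ∧ H δ v = j)
    ⟨δ.length, by
      rintro j ⟨v, h0, h1, h2, rfl⟩
      obtain ⟨c, hc0, hc1, hc⟩ := H_parity δ h0 h1
      omega⟩ ⟨_, v0, a0, a1, a2, rfl⟩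
  have hv0 : v ≠ 0 := by rintro rfl; simp [H_zero] at h2
  have hvN : v ≠ δ.length := by
    rintro rfl
    rw [← hl] at hN
    exact hN.not_gt h2
  have s1 := step_cases δ (v := v) (by omega) h1
  have s2 := H_step δ (v := v) h0 (by omega)
  have t1 := step_cases p (v := v) (by omega) (by omega)
  have t2 := H_step p (v := v) h0 (by omega)
  refine ⟨v, by omega, by omega, h2, ?_, ?_⟩
  · by_contra k
    have := hmax _ ⟨v - 1, by omega, by omega, by omega, rfl⟩
    omega
  · by_contra k
    have := hmax _ ⟨v + 1, by omega, by omega, by omega, rfl⟩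
    omega

/-- If `p` is somewhere below `δ`, then it has a valley below `δ`. -/
lemma exists_valley {δ p : Path} (hl : δ.length = p.length) (hN : H δ δ.length ≤ H p p.length)
    (h : ∃ v : ℤ, 0 ≤ v ∧ v ≤ δ.length ∧ H p v < H δ v) :
    ∃ v : ℤ, 0 < v ∧ v < p.length ∧ H p v < H δ v ∧ H p (v - 1) = H p v + 1 ∧
      H p (v + 1) = H p v + 1 := by
  obtain ⟨v0, a0, a1, a2⟩ := h
  obtain ⟨M, ⟨v, h0, h1, h2, rfl⟩, hmin⟩ := Int.exists_least_of_bdd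
    (P := fun j => ∃ v : ℤ, 0 ≤ v ∧ v ≤ δ.length ∧ H p v < H δ v ∧ H p v = j)
    ⟨-δ.length, by
      rintro j ⟨v, h0, h1, h2, rfl⟩
      obtain ⟨c, hc0, hc1, hc⟩ := H_parity p h0 (by omega)
      omega⟩ ⟨_, v0, a0, a1, a2, rfl⟩
  have hv0 : v ≠ 0 := by rintro rfl; simp [H_zero] at h2
  have hvN : v ≠ δ.length := by
    rintro rfl
    rw [← hl] at hN
    exact hN.not_gt h2
  have s1 := step_cases δ (v := v) (by omega) h1
  have s2 := H_step δ (v := v) h0 (by omega)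
  have t1 := step_cases p (v := v) (by omega) (by omega)
  have t2 := H_step p (v := v) h0 (by omega)
  refine ⟨v, by omega, by omega, h2, ?_, ?_⟩
  · by_contra k
    have := hmin _ ⟨v - 1, by omega, by omega, by omega, rfl⟩
    omega
  · by_contra k
    have := hmin _ ⟨v + 1, by omega, by omega, by omega, rfl⟩
    omega

/-- A path without peaks outside `B` which is below `δ` on `B` is below `δ`. -/
lemma NoTurn.below {B : Set ℤ} {α δ : Path} (hα : NoTurn 1 B α) (hl : α.length = δ.length)
    (hB : ∀ v ∈ B, H α v ≤ H δ v) (hN : (α.length : ℤ) ∈ B) : Below α δ := by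
  rw [below_iff]
  refine ⟨hl, fun v h0 h1 => ?_⟩
  by_contra k
  push Not at k
  obtain ⟨w, w0, w1, w2, w3, w4⟩ := exists_peak hl (by rw [← hl]; exact hB _ hN) ⟨v, h0, h1, k⟩
  exact hα w w0 w1 (fun hw => (hB w hw).not_gt w2) ⟨by omega, by omega⟩

/-- A path without valleys outside `B` which is above `δ` on `B` is above `δ`. -/
lemma NoTurn.above {B : Set ℤ} {ζ δ : Path} (hζ : NoTurn (-1) B ζ) (hl : δ.length = ζ.length)
    (hB : ∀ v ∈ B, H δ v ≤ H ζ v) (hN : (ζ.length : ℤ) ∈ B) : Below δ ζ := by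
  rw [below_iff]
  refine ⟨hl, fun v h0 h1 => ?_⟩
  by_contra k
  push Not at k
  obtain ⟨w, w0, w1, w2, w3, w4⟩ := exists_valley hl (by rw [hl]; exact hB _ hN) ⟨v, h0, h1, k⟩
  exact hζ w w0 w1 (fun hw => (hB w hw).not_gt w2) ⟨by omega, by omega⟩

/-- Lowering the upper path to a path with the same values on `B`, if the lower path has no peaks
outside `B`. -/
lemma SI_eq_pow_mul {B : Set ℤ} {α p δ : Path} (hα : NoTurn 1 B α) (hp : Below α p)
    (hδ : Below p δ) (hB : ∀ v ∈ B, H δ v = H p v) (hN : (p.length : ℤ) ∈ B) :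
    SI α δ = T (-1) ^ (skew p δ).card * SI α p := by
  classical
  induction hc : (skew p δ).card generalizing δ with
  | zero =>
    rw [Finset.card_eq_zero, ← skew_self p] at hc
    rw [eq_of_skew_eq hδ (Below.refl p) hc, pow_zero, one_mul]
  | succ n ih =>
    have hl := hδ.1
    have hl' := hp.1
    have hne : ∃ v : ℤ, 0 ≤ v ∧ v ≤ δ.length ∧ H p v < H δ v := by
      obtain ⟨s, hs⟩ := Finset.card_pos.1 (show 0 < (skew p δ).card by omega)
      rw [mem_skew hl] at hs
      exact ⟨s.1, by omega, by omega, by omega⟩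
    -- This peak is above `p`, hence outside `B`, where `α` has no peak; `SI_peak` removes the one
    -- square under it.
    obtain ⟨v, v0, v1, v2, v3, v4⟩ := exists_peak hl.symm
      (by rw [← hl]; exact (hB _ hN).le) hne
    have hvB : v ∉ B := fun h => by have := hB v h; omega
    obtain ⟨δ', d1, d2⟩ := exists_path δ.length (fun u => if u = v then H δ v - 2 else H δ u)
      (by rw [if_neg (by omega), H_zero]) (by
        intro u u0 u1
        have := H_step δ u0 u1
        split_ifs with e1 e2 e2
        · omega
        · rw [show u = v - 1 by omega]; omega
        · subst e2; omega
        · exact this)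
    have hin : H δ' v = H δ v - 2 := by rw [d2 v v0.le v1.le, if_pos rfl]
    have hout : ∀ u : ℤ, 0 ≤ u → u ≤ δ.length → u ≠ v → H δ' u = H δ u := fun u u0 u1 u2 => by
      rw [d2 u u0 u1, if_neg u2]
    obtain ⟨c, hc0, hc1, hc2⟩ := H_parity δ (v := v) v0.le v1.le
    obtain ⟨d, hd0, hd1, hd2⟩ := H_parity p (v := v) v0.le (by omega)
    have hb' : Below p δ' := by
      rw [below_iff]
      refine ⟨by omega, fun u u0 u1 => ?_⟩
      by_cases hu : u = v
      · subst hu; omega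
      · rw [hout u u0 (by omega) hu]; exact hδ.le u0 u1
    have hins : skew p δ = insert ((v, H δ v - 1) : Square) (skew p δ') := by
      ext ⟨w, j⟩
      rw [Finset.mem_insert, mem_skew hl, mem_skew hb'.1, Prod.mk.injEq]
      dsimp only
      by_cases hw : w = v
      · subst hw; omega
      · constructor
        · rintro ⟨k1, k2, k3⟩
          rw [hout w (by omega) (by omega) hw]; omega
        · rintro (k | ⟨k1, k2, k3⟩)
          · omega
          · rw [hout w (by omega) (by omega) hw] at k3; omega
    have hnot : ((v, H δ v - 1) : Square) ∉ skew p δ' := by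
      rw [mem_skew hb'.1]; dsimp only; omega
    rw [hins, Finset.card_insert_of_notMem hnot] at hc
    rw [SI_peak (hp.trans hδ) d1 (by omega) (by omega) v3 v4 (fun k => hα v v0 (by omega) hvB
      ⟨by omega, by omega⟩) hin hout, ih hb' ?_ (by omega), pow_succ', mul_assoc]
    intro u hu
    by_cases hu0 : 0 ≤ u ∧ u ≤ δ.length
    · rw [hout u hu0.1 hu0.2 (fun e => hvB (e ▸ hu)), hB u hu]
    -- `B` is arbitrary and may contain abscissas outside the range of the path, where `H` is
    -- constant on each side.
    · rcases not_and_or.1 hu0 with h | h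
      · rw [← hB u hu]
        simp [H, height, show u.toNat = 0 by omega]
      · rw [← hB u hu]
        have e1 : δ.length ≤ u.toNat := by omega
        have e3 : (δ.length : ℤ) ∈ B := hl ▸ hN
        have := hout δ.length (by omega) le_rfl (fun e => hvB (e ▸ e3))
        unfold H height at this ⊢
        rw [List.take_of_length_le e1, List.take_of_length_le (by omega)]
        rwa [Int.toNat_natCast, List.take_of_length_le le_rfl,
          List.take_of_length_le (by omega)] at this

end BallotStrip

/-! ### The paths η(k) and ζ(k), and the ends of the blocks. -/

namespace BallotStrip

lemma H_append_left {a b : Path} {v : ℤ} (h : v ≤ a.length) : H (a ++ b) v = H a v := by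
  unfold H height
  rw [List.take_append_of_le_length (by omega)]

lemma H_append_right {a b : Path} {u v : ℤ} (h : v = a.length + u) (hu : 0 ≤ u) :
    H (a ++ b) v = H a a.length + H b u := by
  subst h
  unfold H height
  rw [show ((a.length : ℤ) + u).toNat = a.length + u.toNat by omega,
    List.take_length_add_append]
  simp

lemma H_replicate (s : Bool) {x : ℕ} {v : ℤ} (h0 : 0 ≤ v) (h1 : v ≤ x) :
    H (List.replicate x s) v = if s then v else -v := by
  unfold H height
  rw [List.take_replicate, List.map_replicate, List.sum_replicate, nsmul_eq_mul,
    min_eq_left (by omega)]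
  have : ((v.toNat : ℕ) : ℤ) = v := by omega
  cases s <;> simp [this]

lemma H_vee (a b : ℕ) {v : ℤ} (h0 : 0 ≤ v) (h1 : v ≤ a + b) :
    H (List.replicate a false ++ List.replicate b true) v = max (-v) (v - 2 * a) := by
  rcases le_total v a with h | h
  · rw [H_append_left (by simpa using h), H_replicate false h0 h, max_eq_left (by omega)]
    simp
  · rw [H_append_right (u := v - a) (by simp) (by omega), H_replicate true (by omega) (by omega),
      List.length_replicate, H_replicate false (by omega) le_rfl, max_eq_right (by omega)]
    simp; ring

lemma H_wedge (a b : ℕ) {v : ℤ} (h0 : 0 ≤ v) (h1 : v ≤ b + a) :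
    H (List.replicate b true ++ List.replicate a false) v = min v (2 * b - v) := by
  rcases le_total v b with h | h
  · rw [H_append_left (by simpa using h), H_replicate true h0 h, min_eq_left (by omega)]
    simp
  · rw [H_append_right (u := v - b) (by simp) (by omega), H_replicate false (by omega) (by omega),
      List.length_replicate, H_replicate true (by omega) le_rfl, min_eq_right (by omega)]
    simp; ring

/-- The abscissas of the ends of the blocks. -/
def ends : (n : ℕ) → (Fin n → ℕ) → Set ℤ
  | 0, _ => {0}
  | n + 1, m => {v | v = 0 ∨ v - m 0 ∈ ends n (fun i => m i.succ)}

lemma zero_mem_ends : ∀ (n : ℕ) (m : Fin n → ℕ), (0 : ℤ) ∈ ends n m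
  | 0, _ => rfl
  | _ + 1, _ => Or.inl rfl

lemma sum_mem_ends : ∀ (n : ℕ) (m : Fin n → ℕ), ((∑ i, m i : ℕ) : ℤ) ∈ ends n m
  | 0, _ => by simp [ends]
  | n + 1, m => by
    right
    have := sum_mem_ends n (fun i => m i.succ)
    rw [Fin.sum_univ_succ]
    simpa using this

lemma ends_bounds : ∀ (n : ℕ) (m : Fin n → ℕ) (v : ℤ), v ∈ ends n m → 0 ≤ v ∧ v ≤ (∑ i, m i : ℕ)
  | 0, _, v, h => by
    rw [show v = 0 from h]; simp
  | n + 1, m, v, h => by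
    rw [Fin.sum_univ_succ]
    rcases h with rfl | h
    · exact ⟨le_rfl, by omega⟩
    · have := ends_bounds n _ _ h
      omega

lemma NoTurn.append {ε : ℤ} {a b : Path} {B : Set ℤ} (ha : NoTurn ε ∅ a) (hb : NoTurn ε B b)
    (h0 : (0 : ℤ) ∈ B) : NoTurn ε {v | v = 0 ∨ v - a.length ∈ B} (a ++ b) := by
  intro v v0 v1 hv
  rw [List.length_append] at v1
  push_cast at v1
  rcases lt_trichotomy v a.length with h | h | h
  · rw [H_append_left h.le, H_append_left (by omega), H_append_left (by omega)]
    exact ha v v0 h (Set.notMem_empty v)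
  · exact absurd (Or.inr (by rw [h, sub_self]; exact h0)) hv
  · rw [H_append_right (u := v - a.length) (by ring) (by omega),
      H_append_right (u := v - a.length - 1) (by ring) (by omega),
      H_append_right (u := v - a.length + 1) (by ring) (by omega)]
    have := hb (v - a.length) (by omega) (by omega) (fun k => hv (Or.inr k))
    rwa [add_sub_add_left_eq_sub, add_sub_add_left_eq_sub]

lemma noTurn_vee (a b : ℕ) :
    NoTurn 1 ∅ (List.replicate a false ++ List.replicate b true) := by
  intro v v0 v1 _
  simp only [List.length_append, List.length_replicate, Nat.cast_add] at v1
  rw [H_vee a b (by omega) (by omega), H_vee a b (by omega) (by omega),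
    H_vee a b (by omega) (by omega)]
  omega

lemma noTurn_wedge (a b : ℕ) :
    NoTurn (-1) ∅ (List.replicate b true ++ List.replicate a false) := by
  intro v v0 v1 _
  simp only [List.length_append, List.length_replicate, Nat.cast_add] at v1
  rw [H_wedge a b (by omega) (by omega), H_wedge a b (by omega) (by omega),
    H_wedge a b (by omega) (by omega)]
  omega

lemma mem_weights_succ {n : ℕ} {m : Fin (n + 1) → ℕ} {k : Fin (n + 1) → ℤ} :
    k ∈ weights m ↔ (-(m 0 : ℤ) ≤ k 0 ∧ k 0 ≤ m 0 ∧ k 0 % 2 = m 0 % 2) ∧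
      (fun i => k i.succ) ∈ weights (fun i => m i.succ) := by
  simp only [weights, Fintype.mem_piFinset, Fin.forall_fin_succ, Finset.mem_filter,
    Finset.mem_Icc, and_assoc]
  rfl

lemma eta_succ {n : ℕ} (m : Fin (n + 1) → ℕ) (k : Fin (n + 1) → ℤ) :
    eta m k = (List.replicate ((m 0 + k 0) / 2).toNat false ++
      List.replicate ((m 0 - k 0) / 2).toNat true) ++
        eta (fun i => m i.succ) (fun i => k i.succ) := by
  simp [eta, List.ofFn_succ]

lemma zeta_succ {n : ℕ} (m : Fin (n + 1) → ℕ) (k : Fin (n + 1) → ℤ) :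
    zeta m k = (List.replicate ((m 0 - k 0) / 2).toNat true ++
      List.replicate ((m 0 + k 0) / 2).toNat false) ++
        zeta (fun i => m i.succ) (fun i => k i.succ) := by
  simp [zeta, List.ofFn_succ]

lemma eta_spec {n : ℕ} {m : Fin n → ℕ} {k : Fin n → ℤ} (hk : k ∈ weights m) :
    (eta m k).length = ∑ i, m i ∧ NoTurn 1 (ends n m) (eta m k) := by
  induction n with
  | zero =>
    refine ⟨by simp [eta], fun v h0 h1 => ?_⟩
    simp [eta] at h1
    omega
  | succ n ih =>
    obtain ⟨⟨h1, h2, h3⟩, h4⟩ := mem_weights_succ.1 hk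
    obtain ⟨i1, i2⟩ := ih h4
    have hl : (List.replicate ((m 0 + k 0) / 2).toNat false ++
      List.replicate ((m 0 - k 0) / 2).toNat true).length = m 0 := by
      rw [List.length_append, List.length_replicate, List.length_replicate]; omega
    refine ⟨by rw [eta_succ, List.length_append, i1, hl, Fin.sum_univ_succ], ?_⟩
    have := (noTurn_vee ((m 0 + k 0) / 2).toNat ((m 0 - k 0) / 2).toNat).append i2
      (zero_mem_ends _ _)
    rwa [hl, ← eta_succ] at this

lemma zeta_spec {n : ℕ} {m : Fin n → ℕ} {k : Fin n → ℤ} (hk : k ∈ weights m) :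
    (zeta m k).length = ∑ i, m i ∧ NoTurn (-1) (ends n m) (zeta m k) ∧
      ∀ v ∈ ends n m, H (zeta m k) v = H (eta m k) v := by
  induction n with
  | zero =>
    refine ⟨by simp [zeta], fun v h0 h1 => ?_, fun v _ => by simp [zeta, eta]⟩
    simp [zeta] at h1
    omega
  | succ n ih =>
    obtain ⟨⟨h1, h2, h3⟩, h4⟩ := mem_weights_succ.1 hk
    obtain ⟨i1, i2, i3⟩ := ih h4
    have hl : (List.replicate ((m 0 - k 0) / 2).toNat true ++
      List.replicate ((m 0 + k 0) / 2).toNat false).length = m 0 := by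
      rw [List.length_append, List.length_replicate, List.length_replicate]; omega
    have hl' : (List.replicate ((m 0 + k 0) / 2).toNat false ++
      List.replicate ((m 0 - k 0) / 2).toNat true).length = m 0 := by
      rw [List.length_append, List.length_replicate, List.length_replicate]; omega
    refine ⟨by rw [zeta_succ, List.length_append, i1, hl, Fin.sum_univ_succ], ?_, ?_⟩
    · have := (noTurn_wedge ((m 0 + k 0) / 2).toNat ((m 0 - k 0) / 2).toNat).append i2
        (zero_mem_ends _ _)
      rwa [hl, ← zeta_succ] at this
    · rintro v (rfl | hv)
      · rw [H_zero, H_zero]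
      · have := (ends_bounds _ _ _ hv).1
        rw [zeta_succ, eta_succ, H_append_right (v := v) (u := v - m 0) (by rw [hl]; ring) this,
          H_append_right (v := v) (u := v - m 0) (by rw [hl']; ring) this, i3 _ hv, hl, hl',
          H_vee _ _ (by omega) (by omega), H_wedge _ _ (by omega) (by omega)]
        omega

/-- Every path agrees with some `η(k)` at the ends of the blocks. -/
lemma exists_eta {n : ℕ} (m : Fin n → ℕ) (δ : Path) (hδ : δ.length = ∑ i, m i) :
    ∃ k ∈ weights m, ∀ v ∈ ends n m, H (eta m k) v = H δ v := by
  induction n generalizing δ with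
  | zero =>
    refine ⟨default, by rw [weights, Fintype.mem_piFinset]; exact fun i => i.elim0, ?_⟩
    rintro v rfl
    rw [H_zero, H_zero]
  | succ n ih =>
    rw [Fin.sum_univ_succ] at hδ
    obtain ⟨k, hk, h⟩ := ih (fun i => m i.succ) (δ.drop (m 0)) (by rw [List.length_drop]; omega)
    obtain ⟨c, hc0, hc1, hc⟩ := H_parity δ (v := m 0) (by omega) (by omega)
    -- A block of η(k) changes the height by minus its entry in `k`, hence the sign.
    have hK : Fin.cons (-H δ (m 0)) k ∈ weights m :=
      mem_weights_succ.2 ⟨by simp only [Fin.cons_zero]; omega, by simpa using hk⟩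
    refine ⟨_, hK, ?_⟩
    rintro v (rfl | hv)
    · rw [H_zero, H_zero]
    · have hv0 := (ends_bounds _ _ _ hv).1
      have hl : (δ.take (m 0)).length = m 0 := by rw [List.length_take]; omega
      have hl' : (List.replicate ((m 0 + -H δ (m 0)) / 2).toNat false ++
        List.replicate ((m 0 - -H δ (m 0)) / 2).toNat true).length = m 0 := by
        rw [List.length_append, List.length_replicate, List.length_replicate]; omega
      have e := h _ hv
      have e1 := H_append_right (a := δ.take (m 0)) (b := δ.drop (m 0)) (u := v - m 0) (v := v)
        (by rw [hl]; ring) hv0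
      have e2 := H_append_left (a := δ.take (m 0)) (b := δ.drop (m 0)) (v := m 0) (by rw [hl])
      rw [List.take_append_drop] at e1 e2
      rw [eta_succ]
      simp only [Fin.cons_zero, Fin.cons_succ]
      rw [H_append_right (u := v - m 0) (by rw [hl']; ring) hv0, e, e1, hl', hl, ← e2,
        H_vee _ _ (by omega) (by omega)]
      omega

end BallotStrip

/-! ### Projection domains and the sum over all intermediate paths. -/

namespace BallotStrip

open LaurentPolynomial

lemma singleton_ballot (s : Square) : Ballot {s} s.1 s.1 (fun _ => s.2) where
  le := le_rfl
  step := fun v h1 h2 => by omega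
  low := fun _ _ _ => le_rfl
  mem := fun t => by rw [Finset.mem_singleton, Prod.ext_iff]; omega

lemma hasLength_singleton {s : Square} {l l' : ℕ} :
    HasLength {s} l l' ↔ l = 0 ∧ l' = 0 := by
  rw [(singleton_ballot s).hasLength_iff]; omega

lemma mem_skew_iff_or {β δ γ : Path} (h1 : Below β δ) (h2 : Below δ γ) {s : Square} :
    s ∈ skew β γ ↔ s ∈ skew δ γ ∨ s ∈ skew β δ := by
  have l1 := h1.1
  have l2 := h2.1
  rw [mem_skew (h1.trans h2).1, mem_skew l2, mem_skew l1]
  by_cases hs : 1 ≤ s.1 ∧ s.1 ≤ β.length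
  · have b1 := h1.le (v := s.1) (by omega) (by omega)
    have b2 := h2.le (v := s.1) (by omega) (by omega)
    obtain ⟨c, hc0, hc1, hc⟩ := H_parity δ (v := s.1) (by omega) (by omega)
    omega
  · omega

lemma disjoint_skew {β δ γ : Path} (h1 : Below β δ) (h2 : Below δ γ) {s : Square}
    (hs : s ∈ skew δ γ) : s ∉ skew β δ := by
  rw [mem_skew h2.1] at hs
  rw [mem_skew h1.1]
  omega

/-- The region above a path is closed under going up, NW and NE, since the path has slopes `±1`. So
no square of the projection domain is above, NW or NE of a strip outside it. -/
lemma uppers_notMem_skew {β δ γ : Path} (h1 : Below β δ) (h2 : Below δ γ) {s u : Square}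
    (hs : s ∈ skew δ γ) (hu : u ∈ uppers s) : u ∉ skew β δ := by
  intro hm
  rw [mem_skew h2.1] at hs
  rw [mem_skew h1.1] at hm
  have l1 := h1.1
  simp only [uppers, up, Finset.mem_insert, Finset.mem_singleton] at hu
  rcases hu with rfl | rfl | rfl <;> dsimp only at hm
  · omega
  · have := step_cases δ hs.1 hs.2.1
    omega
  · have := H_step δ (v := s.1) (by omega) (by omega)
    omega

section

variable {β δ γ : Path} (h1 : Below β δ) (h2 : Below δ γ) {C : Finset (Finset Square)}
  [DecidableEq (Finset Square)]

include h1 h2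

lemma union_units_mem_Conf (hC : C ∈ Conf δ γ) :
    C ∪ (skew β δ).image singleton ∈ Conf β γ := by
  obtain ⟨c1, c2, c3⟩ := mem_Conf.1 hC
  have key : ∀ D ∈ C, ∀ s ∈ D, s ∉ skew β δ := fun D hD s hs =>
    disjoint_skew h1 h2 ((c3 s).2 ⟨D, hD, hs⟩)
  simp only [mem_Conf, Finset.mem_union, Finset.mem_image]
  refine ⟨?_, ?_, fun s => ?_⟩
  · rintro D (hD | ⟨s, -, rfl⟩)
    · rw [h1.1]; exact c1 D hD
    · exact ⟨0, 0, hasLength_singleton.2 ⟨rfl, rfl⟩, by omega⟩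
  · rintro D (hD | ⟨s, hs, rfl⟩) D' (hD' | ⟨s', hs', rfl⟩) t ht ht'
    · exact c2 D hD D' hD' t ht ht'
    · rw [Finset.mem_singleton] at ht'
      exact absurd (ht' ▸ hs') (key D hD t ht)
    · rw [Finset.mem_singleton] at ht
      exact absurd (ht ▸ hs) (key D' hD' t ht')
    · rw [Finset.mem_singleton] at ht ht'
      rw [← ht, ← ht']
  · rw [mem_skew_iff_or h1 h2, c3]
    constructor
    · rintro (⟨D, hD, hs⟩ | hs)
      · exact ⟨D, Or.inl hD, hs⟩
      · exact ⟨{s}, Or.inr ⟨s, hs, rfl⟩, Finset.mem_singleton_self s⟩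
    · rintro ⟨D, hD | ⟨t, ht, rfl⟩, hs⟩
      · exact Or.inl ⟨D, hD, hs⟩
      · rw [Finset.mem_singleton] at hs
        exact Or.inr (hs ▸ ht)

/-- The units of the domain are exempt from condition (a) as lower strips, and they never act as
upper strips for `C` by `uppers_notMem_skew`. They have `l' = 0`, so (b) asks nothing of them. -/
lemma union_units_ruleII (hC : C ∈ Conf δ γ) {N : ℕ} (hR : RuleII N ∅ C) :
    RuleII N (skew β δ) (C ∪ (skew β δ).image singleton) := by
  obtain ⟨c1, c2, c3⟩ := mem_Conf.1 hC
  obtain ⟨r1, r2, -, -⟩ := hR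
  have key : ∀ D ∈ C, ∀ s ∈ D, s ∈ skew δ γ := fun D hD s hs => (c3 s).2 ⟨D, hD, hs⟩
  simp only [RuleII, Finset.mem_union, Finset.mem_image]
  refine ⟨?_, ?_, ?_, fun s hs => Or.inr ⟨s, hs, rfl⟩⟩
  · rintro D (hD | ⟨t, ht, rfl⟩) D' hD' hne ⟨s, hs, u, hu, hu'⟩ s' hs' hP v hv hvN
    · rcases hD' with hD' | ⟨t, ht, rfl⟩
      · exact r1 D hD D' hD' hne ⟨s, hs, u, hu, hu'⟩ s' hs' (Finset.notMem_empty _) v hv hvN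
      · rw [Finset.mem_singleton] at hu'
        exact absurd (hu' ▸ ht) (uppers_notMem_skew h1 h2 (key D hD s hs) hu)
    · rw [Finset.mem_singleton] at hs'
      exact absurd (hs' ▸ ht) hP
  · rintro D (hD | ⟨t, ht, rfl⟩) l l' hl hL
    · obtain ⟨q1, q2⟩ := r2 D hD l l' hl hL
      refine ⟨fun ho => ?_, fun he => ?_⟩
      · obtain ⟨D', hD', x⟩ := q1 ho
        exact ⟨D', Or.inl hD', x⟩
      · obtain ⟨D', hD', x⟩ := q2 he
        exact ⟨D', Or.inl hD', x⟩
    · rw [hasLength_singleton] at hL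
      omega
  · rintro D (hD | ⟨t, ht, rfl⟩) l l' hl hL
    · rw [Finset.disjoint_left]
      exact fun s hs => disjoint_skew h1 h2 (key D hD s hs)
    · rw [hasLength_singleton] at hL
      omega

omit h1 h2 [DecidableEq (Finset Square)] in
lemma notMem_of_notMem_units (hC : C ∈ Conf β γ) (hd : ∀ s ∈ skew β δ, {s} ∈ C)
    {D : Finset Square} (hD : D ∈ C) (hn : ∀ s ∈ skew β δ, {s} ≠ D) {s : Square} (hs : s ∈ D) :
    s ∉ skew β δ := fun hm =>
  hn s hm ((mem_Conf.1 hC).2.1 _ (hd s hm) D hD s (Finset.mem_singleton_self s) hs)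

lemma sdiff_units_mem_Conf (hC : C ∈ Conf β γ) (hd : ∀ s ∈ skew β δ, {s} ∈ C) :
    C \ (skew β δ).image singleton ∈ Conf δ γ := by
  obtain ⟨c1, c2, c3⟩ := mem_Conf.1 hC
  simp only [mem_Conf, Finset.mem_sdiff, Finset.mem_image, not_exists, not_and]
  refine ⟨fun D hD => h1.1 ▸ c1 D hD.1, fun D hD D' hD' => c2 D hD.1 D' hD'.1, fun s => ?_⟩
  constructor
  · intro hs
    obtain ⟨D, hD, hm⟩ := (c3 s).1 ((mem_skew_iff_or h1 h2).2 (Or.inl hs))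
    refine ⟨D, ⟨hD, ?_⟩, hm⟩
    rintro t ht rfl
    rw [Finset.mem_singleton] at hm
    exact disjoint_skew h1 h2 hs (hm ▸ ht)
  · rintro ⟨D, ⟨hD, hn⟩, hm⟩
    have := (mem_skew_iff_or h1 h2).1 ((c3 s).2 ⟨D, hD, hm⟩)
    exact this.resolve_right (notMem_of_notMem_units hC hd hD hn hm)

omit h1 h2 in
-- The strips demanded by condition (b) have `l' ≥ 1`, so none of them is lost with the unit
-- squares.
lemma sdiff_units_ruleII (hC : C ∈ Conf β γ) {N : ℕ} (hR : RuleII N (skew β δ) C) :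
    RuleII N ∅ (C \ (skew β δ).image singleton) := by
  obtain ⟨r1, r2, r3, r4⟩ := hR
  simp only [RuleII, Finset.mem_sdiff, Finset.mem_image, not_exists, not_and]
  have key : ∀ D ∈ C, ∀ l l' : ℕ, 1 ≤ l' → HasLength D l l' → ∀ s ∈ skew β δ, {s} ≠ D := by
    rintro D hD l l' hl hL s hs rfl
    rw [hasLength_singleton] at hL
    omega
  refine ⟨?_, ?_, ?_, ?_⟩
  · rintro D ⟨hD, hn⟩ D' ⟨hD', hn'⟩ hne hx s hs - u hu huN
    exact r1 D hD D' hD' hne hx s hs (notMem_of_notMem_units hC r4 hD hn hs) u hu huN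
  · rintro D ⟨hD, hn⟩ l l' hl hL
    obtain ⟨q1, q2⟩ := r2 D hD l l' hl hL
    refine ⟨fun ho => ?_, fun he => ?_⟩
    · obtain ⟨D', hD', l'', hl'', hL', x⟩ := q1 ho
      exact ⟨D', ⟨hD', key D' hD' _ _ (by omega) hL'⟩, l'', hl'', hL', x⟩
    · obtain ⟨D', hD', l'', hl'', hL', x⟩ := q2 he
      rw [Nat.even_iff] at he
      exact ⟨D', ⟨hD', key D' hD' _ _ (by omega) hL'⟩, l'', hl'', hL', x⟩
  · intros
    exact Finset.disjoint_empty_right _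
  · intro s hs
    exact absurd hs (Finset.notMem_empty s)

lemma disjoint_units (hC : C ∈ Conf δ γ) : Disjoint C ((skew β δ).image singleton) := by
  rw [Finset.disjoint_left]
  intro D hD hm
  obtain ⟨s, hs, rfl⟩ := Finset.mem_image.1 hm
  exact disjoint_skew h1 h2 (((mem_Conf.1 hC).2.2 s).2 ⟨_, hD, Finset.mem_singleton_self s⟩) hs

lemma prod_union_units (hC : C ∈ Conf δ γ) :
    ∏ D ∈ C ∪ (skew β δ).image singleton, wtII (skew β δ) D =
      T (-1) ^ (skew β δ).card * ∏ D ∈ C, wtII ∅ D := by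
  rw [Finset.prod_union (disjoint_units h1 h2 hC), mul_comm,
    Finset.prod_image fun s _ t _ h => Finset.singleton_injective h]
  congr 1
  · refine Finset.prod_eq_pow_card fun s hs => ?_
    rw [wtII, if_pos ⟨s, hs, rfl⟩]
  · refine Finset.prod_congr rfl fun D hD => ?_
    have hn : ¬ ∃ s ∈ skew β δ, D = {s} := by
      rintro ⟨s, hs, rfl⟩
      exact disjoint_skew h1 h2
        (((mem_Conf.1 hC).2.2 s).2 ⟨_, hD, Finset.mem_singleton_self s⟩) hs
    unfold wtII
    rw [if_neg hn]
    exact (if_neg fun ⟨s, hs, _⟩ => Finset.notMem_empty s hs).symm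

end

/-- The configurations with a given projection domain. -/
lemma sum_ruleII {β δ γ : Path} (h1 : Below β δ) (h2 : Below δ γ)
    [DecidablePred (RuleII β.length (skew β δ))] :
    ∑ C ∈ (Conf β γ).filter (RuleII β.length (skew β δ)), ∏ D ∈ C, wtII (skew β δ) D =
      T (-1) ^ (skew β δ).card * SII δ γ := by
  classical
  unfold SII
  rw [Finset.mul_sum]
  symm
  refine Finset.sum_bij' (fun C _ => C ∪ (skew β δ).image singleton)
    (fun C _ => C \ (skew β δ).image singleton) ?_ ?_ ?_ ?_ ?_
  · intro C hC
    simp only [Finset.mem_filter] at hC ⊢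
    exact ⟨union_units_mem_Conf h1 h2 hC.1, union_units_ruleII h1 h2 hC.1 (h1.1 ▸ hC.2)⟩
  · intro C hC
    simp only [Finset.mem_filter] at hC ⊢
    exact ⟨sdiff_units_mem_Conf h1 h2 hC.1 hC.2.2.2.2,
      h1.1 ▸ sdiff_units_ruleII hC.1 hC.2⟩
  · intro C hC
    simp only [Finset.mem_filter] at hC
    exact Finset.union_sdiff_cancel_right (disjoint_units h1 h2 hC.1)
  · intro C hC
    simp only [Finset.mem_filter] at hC
    refine Finset.sdiff_union_of_subset fun D hD => ?_
    obtain ⟨s, hs, rfl⟩ := Finset.mem_image.1 hD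
    exact hC.2.2.2.2 s hs
  · intro C hC
    simp only [Finset.mem_filter] at hC
    rw [prod_union_units h1 h2 hC.1]

open Classical in
/-- The paths between `β` and `γ` which agree with `β` on `B`. -/
noncomputable def fiber (B : Set ℤ) (β γ : Path) : Finset Path :=
  (List.finite_length_eq Bool γ.length).toFinset.filter fun δ =>
    Below β δ ∧ Below δ γ ∧ ∀ v ∈ B, H δ v = H β v

lemma mem_fiber {B : Set ℤ} {β γ δ : Path} :
    δ ∈ fiber B β γ ↔ Below β δ ∧ Below δ γ ∧ ∀ v ∈ B, H δ v = H β v := by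
  unfold fiber
  simp only [Finset.mem_filter, Set.Finite.mem_toFinset, Set.mem_ofPred_eq, and_iff_right_iff_imp]
  exact fun h => h.2.1.1

lemma SII_self (β : Path) : SII β β = 1 := by
  classical
  unfold SII
  rw [Conf_self, Finset.filter_singleton, if_pos (ruleII_empty _), Finset.sum_singleton,
    Finset.prod_empty]

lemma exists_min_path {γ γ' : Path} (hl : γ'.length = γ.length) :
    ∃ δ : Path, δ.length = γ.length ∧
      ∀ v : ℤ, 0 ≤ v → v ≤ γ.length → H δ v = min (H γ' v) (H γ v) := by
  refine exists_path γ.length (fun v => min (H γ' v) (H γ v)) (by simp [H_zero]) ?_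
  intro v v0 v1
  obtain ⟨c, hc0, hc1, hc⟩ := H_parity γ (v := v) v0 v1.le
  obtain ⟨d, hd0, hd1, hd⟩ := H_parity γ' (v := v) v0 (by omega)
  have := H_step γ v0 v1
  have := H_step γ' v0 (by omega)
  omega

/-- A path above η(k) is below ζ(k) once it agrees with η(k) at the block ends, because ζ(k) has no
valley inside a block; conversely η(k) and ζ(k) agree there. Intersecting with the diagram replaces
a path by its minimum with `γ`. So the projection domains correspond bijectively to the paths of the
fibre. -/
lemma QII_eq {n : ℕ} {m : Fin n → ℕ} {k : Fin n → ℤ} (hk : k ∈ weights m) {γ : Path}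
    (hb : Below (eta m k) γ) : QII m (eta m k) γ =
      ∑ δ ∈ fiber (ends n m) (eta m k) γ, T (-1) ^ (skew (eta m k) δ).card * SII δ γ := by
  classical
  obtain ⟨e1, e2⟩ := eta_spec hk
  obtain ⟨z1, z2, z3⟩ := zeta_spec hk
  unfold QII
  split_ifs with h
  · have : fiber (ends n m) (eta m k) γ = {γ} := by
      ext δ
      rw [mem_fiber, Finset.mem_singleton, h]
      constructor
      · exact fun q => q.2.1.antisymm q.1
      · rintro rfl
        exact ⟨Below.refl _, Below.refl _, fun _ _ => rfl⟩
    rw [this, Finset.sum_singleton, h, skew_self, SII_self]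
    simp
  · symm
    refine Finset.sum_bij (fun δ _ => skew (eta m k) δ) ?_ ?_ ?_ ?_
    · intro δ hδ
      obtain ⟨d1, d2, d3⟩ := mem_fiber.1 hδ
      have hs : skew (eta m k) δ ⊆ skew (eta m k) γ := fun s hs =>
        (mem_skew_iff_or d1 d2).2 (Or.inr hs)
      unfold pDomains
      simp only [Finset.mem_filter, Finset.mem_powerset]
      refine ⟨hs, k, hk, rfl, δ, d1, z2.above (by rw [← d1.1, e1, z1]) (fun v hv => ?_) ?_,
        (Finset.inter_eq_left.2 hs).symm⟩
      · rw [z3 v hv, d3 v hv]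
      · rw [z1]; exact sum_mem_ends n m
    · intro δ hδ δ' hδ' he
      exact eq_of_skew_eq (mem_fiber.1 hδ).1 (mem_fiber.1 hδ').1 he
    · intro P hP
      unfold pDomains at hP
      simp only [Finset.mem_filter, Finset.mem_powerset] at hP
      -- The vector `k2` need not be compared with `k`; only the equality of the two paths is used.
      obtain ⟨-, k2, hk2, hkk, γ', g1, g2, rfl⟩ := hP
      have hl := hb.1
      have hl' := g1.1
      obtain ⟨y1, -, y3⟩ := zeta_spec hk2
      obtain ⟨δ, d1, d2⟩ := exists_min_path (γ := γ) (γ' := γ') (by omega)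
      have hd : Below (eta m k) δ := by
        rw [below_iff]
        refine ⟨by omega, fun v v0 v1 => ?_⟩
        rw [d2 v v0 (by omega)]
        exact le_min (g1.le v0 v1) (hb.le v0 v1)
      refine ⟨δ, mem_fiber.2 ⟨hd, below_iff.2 ⟨d1, fun v v0 v1 => ?_⟩, fun v hv => ?_⟩, ?_⟩
      · rw [d2 v v0 (by omega)]
        exact min_le_right _ _
      · obtain ⟨v0, v1⟩ := ends_bounds _ _ _ hv
        have q1 := g1.le v0 (by omega)
        have q2 := g2.le v0 (by omega)
        have q3 := hb.le v0 (by omega)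
        rw [y3 v hv, ← hkk] at q2
        rw [d2 v v0 (by omega)]
        omega
      · ext s
        rw [Finset.mem_inter, mem_skew hd.1, mem_skew hl, mem_skew hl']
        by_cases hs : 1 ≤ s.1 ∧ s.1 ≤ (eta m k).length
        · rw [d2 s.1 (by omega) (by omega)]
          omega
        · omega
    · intro δ hδ
      obtain ⟨d1, d2, -⟩ := mem_fiber.1 hδ
      rw [← sum_ruleII d1 d2]

end BallotStrip

open BallotStrip
theorem mainTheorem6 (n : ℕ) (m : Fin n → ℕ) (hm : ∀ i, 0 < m i)
    (k k' : Fin n → ℤ) (hk : k ∈ BallotStrip.weights m) (hk' : k' ∈ BallotStrip.weights m)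
    (α γ : BallotStrip.Path) (hα : α = BallotStrip.eta m k) (hγ : γ = BallotStrip.eta m k') :
    ∑ β ∈ BallotStrip.Adm m α γ, BallotStrip.QI α β * BallotStrip.QII m β γ =
      if α = γ then 1 else 0 := by
  classical
  obtain ⟨a1, a2⟩ := eta_spec hk
  rw [← hα] at a1 a2
  have hadm : ∀ β, β ∈ Adm m α γ ↔
      (∃ k'' ∈ weights m, eta m k'' = β) ∧ Below α β ∧ Below β γ := fun β => by
    unfold Adm
    simp only [Finset.mem_filter, Finset.mem_image]
  -- The fibres over the admissible paths partition the paths between `α` and `γ`.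
  rw [← sum_SI_mul_SII α γ ((Adm m α γ).biUnion (fiber (ends n m) · γ)), Finset.sum_biUnion]
  · refine Finset.sum_congr rfl fun β hβ => ?_
    obtain ⟨⟨k'', hk'', rfl⟩, h1, h2⟩ := (hadm β).1 hβ
    rw [QI_eq, QII_eq hk'' h2, Finset.mul_sum]
    refine Finset.sum_congr rfl fun δ hδ => ?_
    obtain ⟨d1, d2, d3⟩ := mem_fiber.1 hδ
    rw [SI_eq_pow_mul a2 h1 d1 d3 (by rw [(eta_spec hk'').1]; exact sum_mem_ends n m)]
    ring
  · intro β hβ β' hβ' hne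
    obtain ⟨⟨p, hp, rfl⟩, -, -⟩ := (hadm β).1 hβ
    obtain ⟨⟨q, hq, rfl⟩, -, -⟩ := (hadm β').1 hβ'
    obtain ⟨p1, p2⟩ := eta_spec hp
    obtain ⟨q1, q2⟩ := eta_spec hq
    rw [Function.onFun, Finset.disjoint_left]
    intro δ hδ hδ'
    have hv : ∀ v ∈ ends n m, H (eta m p) v = H (eta m q) v := fun v hv => by
      rw [← (mem_fiber.1 hδ).2.2 v hv, (mem_fiber.1 hδ').2.2 v hv]
    -- Having no peak inside a block, each of these paths is the lowest one with its heights at the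
    -- block ends, so these heights determine it.
    exact hne ((p2.below (by omega) (fun v h => (hv v h).le) (p1 ▸ sum_mem_ends n m)).antisymm
      (q2.below (by omega) (fun v h => (hv v h).ge) (q1 ▸ sum_mem_ends n m)))
  · intro δ
    rw [Finset.mem_biUnion]
    constructor
    · rintro ⟨β, hβ, hδ⟩
      obtain ⟨d1, d2, -⟩ := mem_fiber.1 hδ
      exact ⟨((hadm β).1 hβ).2.1.trans d1, d2⟩
    · rintro ⟨h1, h2⟩
      have hl : δ.length = ∑ i, m i := by rw [← h1.1, a1]
      obtain ⟨p, hp, hv⟩ := exists_eta m δ hl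
      obtain ⟨p1, p2⟩ := eta_spec hp
      have hb : Below (eta m p) δ :=
        p2.below (by omega) (fun v h => (hv v h).le) (p1 ▸ sum_mem_ends n m)
      refine ⟨eta m p, (hadm _).2 ⟨⟨p, hp, rfl⟩, ?_, hb.trans h2⟩,
        mem_fiber.2 ⟨hb, h2, fun v h => (hv v h).symm⟩⟩
      -- `α` has no peak inside a block either, so the comparison is needed only at the block ends,
      -- where η(p) agrees with `δ`.
      refine a2.below (by omega) (fun v h => ?_) (a1 ▸ sum_mem_ends n m)
      rw [hv v h]
      obtain ⟨v0, v1⟩ := ends_bounds _ _ _ h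
      exact h1.le v0 (by omega)
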